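/- Let $d\ge 2$ and $0<\mu_\bullet,\mu^\bullet<\infty$. Write $B(x_0,r)$ for the ball in $\mathbb R^d$, $\mathrm S_\theta=\{z\in\mathbb C\setminus\{0\}:|\arg z|<\theta\}$, $\mathrm L^2_\sigma(\mathbb R^d)$ for the space of $f\in \mathrm L^2(\mathbb R^d;\mathbb C^d)$ with $\operatorname{div} f=0$ in the sense of distributions, and $\mathrm H^1_\sigma(\mathbb R^d)=\{u\in \mathrm H^1(\mathbb R^d;\mathbb C^d):\operatorname{div}u=0\}$. All norms of vectors and matrices are Euclidean. Consider coefficients $\mu=(\mu^{ij}_{\alpha\beta})_{\alpha,\beta,i,j=1}^d$ with $\mu^{ij}_{\alpha\beta}\in \mathrm L^\infty(\mathbb R^d;\mathbb C)$ such that $$\max_{i,j,\alpha,\beta}\|\mu^{ij}_{\alpha\beta}\|_{\mathrm L^\infty}\le\mu^\bullet,\qquad \operatorname{Re}\sum_{\alpha,\beta,i,j=1}^d\int_{\mathbb R^d}\mu^{ij}_{\alpha\beta}\,\partial_\beta u_j\,\overline{\partial_\alpha u_i}\,dx\ \ge\ \mu_\bullet\|\nabla u\|_{\mathrm L^2}^2\quad(u\in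 \mathrm H^1(\mathbb R^d;\mathbb C^d)),\tag{1}$$ and put $\mathfrak a(u,v)=\sum_{\alpha,\beta,i,j=1}^d\int_{\mathbb R^d}\mu^{ij}_{\alpha\beta}\,\partial_\beta u_j\,\overline{\partial_\alpha v_i}\,dx$ for $u,v\in \mathrm H^1_\sigma(\mathbb R^d)$. Then there is $\omega\in(\pi/2,\pi)$, depending only on $d,\mu_\bullet,\mu^\bullet$, such that for all $\theta\in(0,\omega)$ and all $0<\nu<d+2$ there is $C>0$, depending only on $d,\mu_\bullet,\mu^\bullet,\theta,\nu$, such that for all $\mu$ satisfying (1), all $\lambda\in\mathrm S_\theta$, all $f\in \mathrm L^2_\sigma(\mathbb R^d)$ and all $F\in \mathrm L^2(\mathbb R^d;\mathbb C^{d\times d})$ the following holds. There is a unique $u\in \mathrm H^1_\sigma(\mathbb R^d)$ with $$\lambda\int_{\mathbb R^d}u\cdot\overline v\,dx+\mathfrak a(u,v)=\int_{\mathbb R^d}f\cdot\overline v\,dx-\sum_{\alpha,\beta=1}^d\int_{\mathbb R^d}F_{\alpha\beta}\,\overline{\partial_\alpha v_\beta}\,dx\qquad(v\in \mathrm H^1_\sigma(\mathbb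 R^d)),$$ and for all $x_0\in\mathbb R^d$, $r>0$ and all sequences $(c_k)_{k\ge0}$ in $\mathbb C^d$ it satisfies $$\begin{aligned} &|\lambda|\sum_{k=0}^\infty2^{-\nu k}\int_{B(x_0,2^kr)}|u|^2\,dx+\sum_{k=0}^\infty2^{-\nu k}\int_{B(x_0,2^kr)}|\nabla u|^2\,dx\\ &\quad\le\frac{C}{r^2}\sum_{k=0}^\infty2^{-(\nu+2)k}\int_{B(x_0,2^{k+1}r)}|u+c_k|^2\,dx+|\lambda|\sum_{k=0}^\infty|c_k|\,2^{-\nu k}\int_{B(x_0,2^{k+1}r)}|u|\,dx\\ &\qquad+\frac{C}{|\lambda|}\sum_{k=0}^\infty2^{-\nu k}\int_{B(x_0,2^{k+1}r)}|f|^2\,dx+C\sum_{k=0}^\infty2^{-\nu k}\int_{B(x_0,2^{k+1}r)}|F|^2\,dx, \end{aligned}$$ where the series on the right-hand side may take the value $+\infty$. -/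

import Mathlib

open MeasureTheory
open scoped ENNReal ContDiff ComplexConjugate

namespace StokesCaccioppoli

/-- Vector fields on `ℝ^d` with values in `ℂ^d`; all norms are Euclidean. -/
abbrev Field (d : ℕ) := EuclideanSpace ℝ (Fin d) → EuclideanSpace ℂ (Fin d)

/-- Matrix fields on `ℝ^d` with values in `ℂ^{d × d}`, with the Frobenius norm. The gradient of `u`
is the matrix field with entries `(α, i) ↦ ∂_α u_i`. -/
abbrev MatField (d : ℕ) := EuclideanSpace ℝ (Fin d) → EuclideanSpace ℂ (Fin d × Fin d)

/-- Coefficients: `μ α β i j x` is the value at `x` of the coefficient with lower indices `α, β`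
and upper indices `i, j`. -/
abbrev Coeff (d : ℕ) := Fin d → Fin d → Fin d → Fin d → EuclideanSpace ℝ (Fin d) → ℂ

/-- The partial derivative `∂_α φ` of a real function. -/
noncomputable def partialDeriv {d : ℕ} (α : Fin d) (φ : EuclideanSpace ℝ (Fin d) → ℝ)
    (x : EuclideanSpace ℝ (Fin d)) : ℝ :=
  fderiv ℝ φ x (EuclideanSpace.single α 1)

/-- `g` is the weak (distributional) partial derivative `∂_α h` on `ℝ^d`, for `h` and `g` locally
integrable. -/
def HasWeakPartialDeriv {d : ℕ} (α : Fin d) (h g : EuclideanSpace ℝ (Fin d) → ℂ) : Prop :=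
  ∀ φ : EuclideanSpace ℝ (Fin d) → ℝ, ContDiff ℝ ∞ φ → HasCompactSupport φ →
    ∫ x, partialDeriv α φ x • h x = -∫ x, φ x • g x

/-- `u ∈ H¹(ℝ^d; ℂ^d)` with weak gradient `∇u = Du`. -/
structure IsH1 {d : ℕ} (u : Field d) (Du : MatField d) : Prop where
  memLp : MemLp u 2 volume
  grad_memLp : MemLp Du 2 volume
  weakDeriv : ∀ α i, HasWeakPartialDeriv α (fun x => u x i) (fun x => Du x (α, i))

/-- `u ∈ H¹_σ(ℝ^d)` with weak gradient `∇u = Du`: moreover `div u = 0`. -/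
structure IsH1Sigma {d : ℕ} (u : Field d) (Du : MatField d) : Prop extends IsH1 u Du where
  div_eq_zero : ∀ᵐ x, ∑ i, Du x (i, i) = 0

/-- `f ∈ L²_σ(ℝ^d)`: an `L²` vector field that is divergence free in the sense of
distributions. -/
structure IsL2Sigma {d : ℕ} (f : Field d) : Prop where
  memLp : MemLp f 2 volume
  div_eq_zero : ∀ φ : EuclideanSpace ℝ (Fin d) → ℝ, ContDiff ℝ ∞ φ → HasCompactSupport φ →
    ∫ x, ∑ i, partialDeriv i φ x • f x i = 0

/-- The value `𝔞(u, v)` of the sesquilinear form, as a function of the gradients of `u` and `v`. -/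
noncomputable def form {d : ℕ} (μ : Coeff d) (Du Dv : MatField d) : ℂ :=
  ∑ α, ∑ β, ∑ i, ∑ j, ∫ x, μ α β i j x * Du x (β, j) * conj (Dv x (α, i))

/-- The coefficients are essentially bounded by `M` and satisfy the Gårding type ellipticity
inequality with constant `m` on `H¹(ℝ^d; ℂ^d)`. -/
structure IsEllipticCoeff {d : ℕ} (m M : ℝ) (μ : Coeff d) : Prop where
  memLp : ∀ α β i j, MemLp (μ α β i j) ∞ volume
  norm_le : ∀ α β i j, eLpNorm (μ α β i j) ∞ volume ≤ ENNReal.ofReal M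
  elliptic : ∀ (u : Field d) (Du : MatField d), IsH1 u Du →
    m * (∫ x, ‖Du x‖ ^ 2) ≤ (form μ Du Du).re

/-- The open sector `S_θ = {z ∈ ℂ \ {0} : |arg z| < θ}`. -/
def sector (θ : ℝ) : Set ℂ := {z | z ≠ 0 ∧ |z.arg| < θ}

/-- `u ∈ H¹_σ(ℝ^d)`, with weak gradient `Du`, is a weak solution of the Stokes resolvent problem
`l u - div (μ ∇u) + ∇φ = f + div F`, `div u = 0`. -/
structure IsSolution {d : ℕ} (μ : Coeff d) (l : ℂ) (f : Field d) (F : MatField d)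
    (u : Field d) (Du : MatField d) : Prop where
  isH1Sigma : IsH1Sigma u Du
  eq : ∀ (v : Field d) (Dv : MatField d), IsH1Sigma v Dv →
    l * (∫ x, ∑ i, u x i * conj (v x i)) + form μ Du Dv =
      (∫ x, ∑ i, f x i * conj (v x i)) -
        ∑ α, ∑ β, ∫ x, F x (α, β) * conj (Dv x (α, β))

/-- The dyadic series `∑_{k ≥ 0} 2^{-s k} ∫_{B(x₀, 2^{k+n} r)} g_k`, with values in `[0, ∞]`. -/
noncomputable def dyadicSum {d : ℕ} (s : ℝ) (n : ℕ) (x₀ : EuclideanSpace ℝ (Fin d)) (r : ℝ)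
    (g : ℕ → EuclideanSpace ℝ (Fin d) → ℝ≥0∞) : ℝ≥0∞ :=
  ∑' k : ℕ, ENNReal.ofReal ((2 : ℝ) ^ (-(s * k))) *
    ∫⁻ x in Metric.ball x₀ (2 ^ (k + n) * r), g k x

end StokesCaccioppoli

/-! The classical Caccioppoli argument tests the equation with `η² (u + c)`, where `η` is a cutoff
between `B(x₀, r)` and `B(x₀, 2r)`. This field `v` is not solenoidal, so it is no admissible test
function. It is corrected by the gradient of the Newtonian potential of `div v`. A gradient is
orthogonal to the solenoidal fields `u` and `f`, so the only trace the correction leaves is the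
pairing of the Hessian of that potential with the flux `μ ∇u + F`. This is why no pressure appears,
and why the inequality is nonlocal.

The Hessian has two properties. Its `L²` norm is bounded by that of `div v` (two integrations by
parts). Away from the support of `v` it decays like `|x - x₀|^{-(d+1)}`, one order better than the
kernel, because `div v` has mean value zero. Its squared norm on the `n`-th dyadic shell is
therefore of order `2^{-(d+2)n}` (`lintegral_shell_potentialHess_le`), and this is the origin of the
restriction `ν < d + 2`. Young's inequality on every shell bounds the defect by a small multiple of
a dyadic sum of `|μ ∇u + F|²` of any order `s < d + 2`, plus a multiple of `‖div v‖²`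
(`exists_defect_bound`). Since `div u = 0`, the function `div v` contains no derivative of `u`, only
`∇η · (u + c)`. To avoid singular integrals, `|x|` is replaced by `√(|x|² + ε²)` in the kernel. The
divergence of the regularised kernel is exactly an approximate identity, so mollifying `v` with it
and subtracting the regularised gradient gives an exactly solenoidal `H¹` field. All quantitative
bounds are uniform in `ε`, and `ε → 0` is taken in the `L²` pairings only.

On one ball, the sectorial coercivity `exists_rotation` yields the estimate, with two regimes in
`exists_local_estimate`. If `|λ| r²` is large, `c = 0` is used and the constant is inserted
afterwards. If it is small, the term with `λ` is a perturbation of the gradient term. In both cases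
the coefficient of `|λ| |c| ∫ |u|` is at most `3/4`. This one-ball estimate is applied at the radii
`2^k r` with the constants `c_k`, multiplied by `2^{-νk}` and summed. For `ν < s < d + 2` the double
sum collapses (`tsum_tsum_dyadic_le`), a quarter of the left-hand side is absorbed, and `3/4`
becomes precisely the constant one of the statement.

Solvability is the Lax–Milgram lemma, with `H¹_σ` realised as an orthogonal complement in `L² × L²`.
Uniqueness follows from the same coercivity. -/

namespace StokesCaccioppoli

/-! ### The regularised Newtonian kernel: derivatives, decay and integrability. -/

section Kernel

variable {d : ℕ}

/-- The inverse of the regularised norm `√(‖x‖² + ε²)`. -/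
noncomputable def invBracket (ε : ℝ) (x : EuclideanSpace ℝ (Fin d)) : ℝ :=
  (√(‖x‖ ^ 2 + ε ^ 2))⁻¹

theorem bracket_pos {ε : ℝ} (hε : 0 < ε) (x : EuclideanSpace ℝ (Fin d)) :
    0 < ‖x‖ ^ 2 + ε ^ 2 := by positivity

theorem invBracket_pos {ε : ℝ} (hε : 0 < ε) (x : EuclideanSpace ℝ (Fin d)) :
    0 < invBracket ε x := inv_pos.2 (Real.sqrt_pos.2 (bracket_pos hε x))

theorem invBracket_sq {ε : ℝ} (hε : 0 < ε) (x : EuclideanSpace ℝ (Fin d)) :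
    invBracket ε x ^ 2 * (‖x‖ ^ 2 + ε ^ 2) = 1 := by
  rw [invBracket, inv_pow, Real.sq_sqrt (bracket_pos hε x).le,
    inv_mul_cancel₀ (bracket_pos hε x).ne']

theorem norm_mul_invBracket_le {ε : ℝ} (hε : 0 < ε) (x : EuclideanSpace ℝ (Fin d)) :
    ‖x‖ * invBracket ε x ≤ 1 := by
  have h := invBracket_sq hε x
  have : (‖x‖ * invBracket ε x) ^ 2 ≤ 1 := by nlinarith [sq_nonneg (invBracket ε x * ε)]
  exact (abs_le_of_sq_le_sq' (by simpa using this) zero_le_one).2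

theorem abs_apply_mul_invBracket_le {ε : ℝ} (hε : 0 < ε) (x : EuclideanSpace ℝ (Fin d))
    (i : Fin d) : |x i| * invBracket ε x ≤ 1 := by
  refine le_trans ?_ (norm_mul_invBracket_le hε x)
  have : |x i| ≤ ‖x‖ := by simpa using PiLp.norm_apply_le x i
  exact mul_le_mul_of_nonneg_right this (invBracket_pos hε x).le

theorem hasFDerivAt_invBracket {ε : ℝ} (hε : 0 < ε) (x : EuclideanSpace ℝ (Fin d)) :
    HasFDerivAt (invBracket ε) (-(invBracket ε x ^ 3) • innerSL ℝ x) x := by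
  have h1 : HasFDerivAt (fun x : EuclideanSpace ℝ (Fin d) => ‖x‖ ^ 2 + ε ^ 2)
      (2 • innerSL ℝ x) x := ((hasStrictFDerivAt_norm_sq x).hasFDerivAt).add_const _
  have h2 := (h1.sqrt (bracket_pos hε x).ne')
  have h3 := (hasDerivAt_inv (Real.sqrt_pos.2 (bracket_pos hε x)).ne').comp_hasFDerivAt x h2
  refine h3.congr_fderiv ?_
  ext v
  have hs := (Real.sqrt_pos.2 (bracket_pos hε x)).ne'
  simp [invBracket]
  field_simp

theorem contDiff_invBracket {ε : ℝ} (hε : 0 < ε) :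
    ContDiff ℝ ∞ (invBracket ε : EuclideanSpace ℝ (Fin d) → ℝ) := by
  unfold invBracket
  refine ContDiff.inv (ContDiff.sqrt ((contDiff_norm_sq ℝ).add contDiff_const)
    fun x => (bracket_pos hε x).ne') fun x => (Real.sqrt_pos.2 (bracket_pos hε x)).ne'

/-- The regularised gradient `x_i (‖x‖² + ε²)^{-d/2}` of the Newtonian potential. -/
noncomputable def kern (ε : ℝ) (i : Fin d) (x : EuclideanSpace ℝ (Fin d)) : ℝ :=
  x i * invBracket ε x ^ d

/-- The partial derivative `∂_j` of `kern ε i`. -/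
noncomputable def kernGrad (ε : ℝ) (i j : Fin d) (x : EuclideanSpace ℝ (Fin d)) : ℝ :=
  (if i = j then 1 else 0) * invBracket ε x ^ d - d * (x i * x j * invBracket ε x ^ (d + 2))

/-- The partial derivative `∂_k` of `kernGrad ε i j`. -/
noncomputable def kernHess (ε : ℝ) (i j k : Fin d) (x : EuclideanSpace ℝ (Fin d)) : ℝ :=
  d * (d + 2) * (x i * x j * x k * invBracket ε x ^ (d + 4)) -
    d * (((if i = j then 1 else 0) * x k + (if i = k then 1 else 0) * x j +
      (if j = k then 1 else 0) * x i) * invBracket ε x ^ (d + 2))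

/-- The divergence of `kern ε`, an approximate identity. -/
noncomputable def approxDelta (ε : ℝ) (x : EuclideanSpace ℝ (Fin d)) : ℝ :=
  d * ε ^ 2 * invBracket ε x ^ (d + 2)

/-- With `q = invBracket ε x`, the relation `q² (‖x‖² + ε²) = 1` turns `d q^d - d ‖x‖² q^(d+2)` into
`d ε² q^(d+2)`. Because this identity is exact, the corrected test fields are solenoidal for every
`ε`, not only in the limit. -/
theorem sum_kernGrad {ε : ℝ} (hε : 0 < ε) (x : EuclideanSpace ℝ (Fin d)) :
    ∑ i, kernGrad ε i i x = approxDelta ε x := by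
  simp only [kernGrad, if_true, one_mul, Finset.sum_sub_distrib, Finset.sum_const,
    Finset.card_univ, Fintype.card_fin, nsmul_eq_mul, ← Finset.mul_sum, ← Finset.sum_mul]
  have h : ∑ i, x i * x i = ‖x‖ ^ 2 := by
    rw [EuclideanSpace.norm_sq_eq]; simp [sq]
  rw [h, approxDelta]
  have := invBracket_sq hε x
  rw [pow_add]
  linear_combination (-(d * invBracket ε x ^ d)) * this

theorem kernGrad_comm (ε : ℝ) (i j : Fin d) (x : EuclideanSpace ℝ (Fin d)) :
    kernGrad ε i j x = kernGrad ε j i x := by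
  simp only [kernGrad, eq_comm (a := i), mul_comm (x i)]

theorem kernHess_swap (ε : ℝ) (i j k : Fin d) (x : EuclideanSpace ℝ (Fin d)) :
    kernHess ε i j k x = kernHess ε i k j x := by
  simp only [kernHess, eq_comm (a := j) (b := k)]; ring

theorem hasFDerivAt_coord (i : Fin d) (x : EuclideanSpace ℝ (Fin d)) :
    HasFDerivAt (fun x : EuclideanSpace ℝ (Fin d) => x i)
      (EuclideanSpace.proj i : EuclideanSpace ℝ (Fin d) →L[ℝ] ℝ) x :=
  (EuclideanSpace.proj i : EuclideanSpace ℝ (Fin d) →L[ℝ] ℝ).hasFDerivAt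

theorem hasFDerivAt_invBracket_pow {ε : ℝ} (hε : 0 < ε) (n : ℕ)
    (x : EuclideanSpace ℝ (Fin d)) :
    HasFDerivAt (fun x => invBracket ε x ^ n) (-(n * invBracket ε x ^ (n + 2)) • innerSL ℝ x) x := by
  refine ((hasFDerivAt_invBracket hε x).pow n).congr_fderiv ?_
  ext v
  cases n with
  | zero => simp
  | succ n => simp; ring

theorem partialDeriv_kern {ε : ℝ} (hε : 0 < ε) (i j : Fin d) (x : EuclideanSpace ℝ (Fin d)) :
    partialDeriv j (kern ε i) x = kernGrad ε i j x := by
  have h := (hasFDerivAt_coord i x).mul (hasFDerivAt_invBracket_pow hε d x)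
  rw [partialDeriv, HasFDerivAt.fderiv (f := kern ε i) h]
  simp [kernGrad, EuclideanSpace.inner_single_right]
  ring

theorem partialDeriv_kernGrad {ε : ℝ} (hε : 0 < ε) (i j k : Fin d)
    (x : EuclideanSpace ℝ (Fin d)) :
    partialDeriv k (kernGrad ε i j) x = kernHess ε i j k x := by
  have h1 := (hasFDerivAt_invBracket_pow hε d x).const_mul (if i = j then (1 : ℝ) else 0)
  have h2 := ((hasFDerivAt_coord i x).mul (hasFDerivAt_coord j x)).mul
    (hasFDerivAt_invBracket_pow hε (d + 2) x)
  have h := h1.sub (h2.const_mul (d : ℝ))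
  rw [partialDeriv, HasFDerivAt.fderiv (f := kernGrad ε i j) h]
  rw [kernHess]
  split_ifs <;> simp_all [EuclideanSpace.inner_single_right] <;> ring

theorem contDiff_coord (i : Fin d) :
    ContDiff ℝ ∞ (fun x : EuclideanSpace ℝ (Fin d) => x i) :=
  (EuclideanSpace.proj i : EuclideanSpace ℝ (Fin d) →L[ℝ] ℝ).contDiff

theorem contDiff_kern {ε : ℝ} (hε : 0 < ε) (i : Fin d) : ContDiff ℝ ∞ (kern ε i) :=
  (contDiff_coord i).mul ((contDiff_invBracket hε).pow d)

theorem contDiff_kernGrad {ε : ℝ} (hε : 0 < ε) (i j : Fin d) :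
    ContDiff ℝ ∞ (kernGrad ε i j) :=
  (contDiff_const.mul ((contDiff_invBracket hε).pow d)).sub (contDiff_const.mul
    (((contDiff_coord i).mul (contDiff_coord j)).mul ((contDiff_invBracket hε).pow (d + 2))))

theorem contDiff_approxDelta {ε : ℝ} (hε : 0 < ε) :
    ContDiff ℝ ∞ (approxDelta ε : EuclideanSpace ℝ (Fin d) → ℝ) :=
  contDiff_const.mul ((contDiff_invBracket hε).pow (d + 2))

theorem approxDelta_nonneg {ε : ℝ} (hε : 0 < ε) (x : EuclideanSpace ℝ (Fin d)) :
    0 ≤ approxDelta ε x := by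
  have := invBracket_pos hε x
  unfold approxDelta; positivity

theorem abs_kern_le {ε : ℝ} (hε : 0 < ε) (hd : 1 ≤ d) (i : Fin d)
    (x : EuclideanSpace ℝ (Fin d)) : |kern ε i x| ≤ invBracket ε x ^ (d - 1) := by
  have hq := invBracket_pos hε x
  obtain ⟨n, rfl⟩ : ∃ n, d = n + 1 := ⟨d - 1, by omega⟩
  rw [kern, abs_mul, abs_of_pos (pow_pos hq _), pow_succ', ← mul_assoc, Nat.add_sub_cancel]
  exact mul_le_of_le_one_left (pow_pos hq _).le (abs_apply_mul_invBracket_le hε x i)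

theorem abs_kernGrad_le {ε : ℝ} (hε : 0 < ε) (i j : Fin d)
    (x : EuclideanSpace ℝ (Fin d)) : |kernGrad ε i j x| ≤ (1 + d) * invBracket ε x ^ d := by
  have hq := invBracket_pos hε x
  have h1 : |x i * x j * invBracket ε x ^ (d + 2)| ≤ invBracket ε x ^ d := by
    have : x i * x j * invBracket ε x ^ (d + 2) =
      (x i * invBracket ε x) * (x j * invBracket ε x) * invBracket ε x ^ d := by ring
    rw [this, abs_mul, abs_mul, abs_mul, abs_mul, abs_of_pos hq, abs_of_pos (pow_pos hq d)]
    refine mul_le_of_le_one_left (pow_pos hq _).le (mul_le_one₀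
      (abs_apply_mul_invBracket_le hε x i) (by positivity) (abs_apply_mul_invBracket_le hε x j))
  rw [kernGrad]
  refine (abs_sub _ _).trans ?_
  rw [add_mul, one_mul, abs_mul, abs_mul (d : ℝ), abs_of_pos (pow_pos hq d), Nat.abs_cast]
  refine add_le_add (mul_le_of_le_one_left (pow_pos hq _).le ?_)
    (mul_le_mul_of_nonneg_left h1 (Nat.cast_nonneg d))
  split_ifs <;> simp

/-- Each coordinate absorbs one factor of `invBracket`. The constant is `d (d + 2)` for the cubic
term plus `d` for each of the three linear terms. -/
theorem abs_kernHess_le {ε : ℝ} (hε : 0 < ε) (i j k : Fin d)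
    (x : EuclideanSpace ℝ (Fin d)) :
    |kernHess ε i j k x| ≤ (d * (d + 5)) * invBracket ε x ^ (d + 1) := by
  have hq := invBracket_pos hε x
  have hQ := pow_pos hq (d + 1)
  have h1 : |x i * x j * x k * invBracket ε x ^ (d + 4)| ≤ invBracket ε x ^ (d + 1) := by
    have : x i * x j * x k * invBracket ε x ^ (d + 4) =
      (x i * invBracket ε x) * (x j * invBracket ε x) * (x k * invBracket ε x) *
        invBracket ε x ^ (d + 1) := by ring
    rw [this, abs_mul, abs_mul, abs_mul, abs_mul, abs_mul, abs_mul, abs_of_pos hq, abs_of_pos hQ]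
    refine mul_le_of_le_one_left hQ.le (mul_le_one₀ (mul_le_one₀
      (abs_apply_mul_invBracket_le hε x i) (by positivity) (abs_apply_mul_invBracket_le hε x j))
      (by positivity) (abs_apply_mul_invBracket_le hε x k))
  have h2 : ∀ (p : Prop) [Decidable p] (l : Fin d),
      |(if p then 1 else 0) * (x l * invBracket ε x ^ (d + 2))| ≤ invBracket ε x ^ (d + 1) := by
    intro p _ l
    have h3 : |x l * invBracket ε x ^ (d + 2)| ≤ invBracket ε x ^ (d + 1) := by
      have : x l * invBracket ε x ^ (d + 2) =
        (x l * invBracket ε x) * invBracket ε x ^ (d + 1) := by ring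
      rw [this, abs_mul, abs_mul, abs_of_pos hq, abs_of_pos hQ]
      exact mul_le_of_le_one_left hQ.le (abs_apply_mul_invBracket_le hε x l)
    split_ifs
    · simpa using h3
    · simpa using hQ.le
  have hsplit : kernHess ε i j k x = d * ((d + 2) * (x i * x j * x k * invBracket ε x ^ (d + 4)) -
      ((if i = j then 1 else 0) * (x k * invBracket ε x ^ (d + 2)) +
       (if i = k then 1 else 0) * (x j * invBracket ε x ^ (d + 2)) +
       (if j = k then 1 else 0) * (x i * invBracket ε x ^ (d + 2)))) := by
    rw [kernHess]; ring
  rw [hsplit, abs_mul, Nat.abs_cast, mul_assoc (d : ℝ)]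
  refine mul_le_mul_of_nonneg_left ((abs_sub _ _).trans ?_) (Nat.cast_nonneg d)
  have h4 := (abs_add_three ((if i = j then 1 else 0) * (x k * invBracket ε x ^ (d + 2)))
    ((if i = k then 1 else 0) * (x j * invBracket ε x ^ (d + 2)))
    ((if j = k then 1 else 0) * (x i * invBracket ε x ^ (d + 2))))
  have h5 : |((d : ℝ) + 2) * (x i * x j * x k * invBracket ε x ^ (d + 4))| ≤
      (d + 2) * invBracket ε x ^ (d + 1) := by
    rw [abs_mul, abs_of_pos (by positivity : (0 : ℝ) < d + 2)]
    exact mul_le_mul_of_nonneg_left h1 (by positivity)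
  linarith [h2 (i = j) k, h2 (i = k) j, h2 (j = k) i]

theorem invBracket_le {ε : ℝ} (hε : 0 < ε) (x : EuclideanSpace ℝ (Fin d)) :
    invBracket ε x ≤ ε⁻¹ := by
  refine inv_anti₀ hε (Real.le_sqrt_of_sq_le ?_)
  nlinarith [sq_nonneg ‖x‖]

theorem invBracket_le_inv_norm {ε : ℝ} (hε : 0 < ε) {x : EuclideanSpace ℝ (Fin d)} {a : ℝ}
    (ha : 0 < a) (hx : a ≤ ‖x‖) : invBracket ε x ≤ a⁻¹ := by
  refine inv_anti₀ ha (Real.le_sqrt_of_sq_le ?_)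
  nlinarith [sq_nonneg ε]

/-- A Peetre type inequality: a bounded translation changes the weight only by a factor. It makes
convolution with boundedly supported functions preserve decay. -/
theorem invBracket_sub_le {ε R : ℝ} (hε : 0 < ε) {x y : EuclideanSpace ℝ (Fin d)}
    (hy : ‖y‖ ≤ R) : invBracket ε (x - y) ≤ (2 * (1 + R / ε)) * invBracket ε x := by
  have hq := invBracket_pos hε x
  have hp := invBracket_pos hε (x - y)
  have hR : 0 ≤ R := (norm_nonneg y).trans hy
  have e1 := invBracket_sq hε x
  have e2 := invBracket_sq hε (x - y)
  have h1 : ‖x‖ ≤ ‖x - y‖ + R := by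
    have := norm_add_le (x - y) y
    rw [sub_add_cancel] at this
    linarith
  have h2 : ‖x‖ ^ 2 + ε ^ 2 ≤ (2 * (1 + R / ε)) ^ 2 * (‖x - y‖ ^ 2 + ε ^ 2) := by
    have h3 : ‖x‖ ^ 2 ≤ (‖x - y‖ + R) ^ 2 := by gcongr
    have h4 : R ^ 2 = (R / ε) ^ 2 * ε ^ 2 := by field_simp
    have h5 : 0 ≤ R / ε := by positivity
    have h6 : (‖x - y‖ + R) ^ 2 ≤ 2 * ‖x - y‖ ^ 2 + 2 * R ^ 2 := by
      nlinarith [sq_nonneg (‖x - y‖ - R)]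
    have h7 : 2 * (1 + (R / ε) ^ 2) ≤ (2 * (1 + R / ε)) ^ 2 := by nlinarith
    have h8 : (2 * (1 + (R / ε) ^ 2)) * (‖x - y‖ ^ 2 + ε ^ 2) ≤
      (2 * (1 + R / ε)) ^ 2 * (‖x - y‖ ^ 2 + ε ^ 2) := by gcongr
    nlinarith [sq_nonneg (R / ε * ‖x - y‖), sq_nonneg ε]
  refine (abs_le_of_sq_le_sq' ?_ (by positivity)).2
  have h9 : 0 < invBracket ε x ^ 2 * invBracket ε (x - y) ^ 2 := by positivity
  have h10 := mul_le_mul_of_nonneg_left h2 h9.le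
  calc invBracket ε (x - y) ^ 2 = invBracket ε (x - y) ^ 2 *
        (invBracket ε x ^ 2 * (‖x‖ ^ 2 + ε ^ 2)) := by rw [e1, mul_one]
    _ ≤ (2 * (1 + R / ε)) ^ 2 * invBracket ε x ^ 2 *
        (invBracket ε (x - y) ^ 2 * (‖x - y‖ ^ 2 + ε ^ 2)) := by linarith
    _ = _ := by rw [e2]; ring

/-- By comparison with `ε = 1`, since `invBracket ε ≤ max 1 ε⁻¹ * invBracket 1`. -/
theorem integrable_invBracket_pow {ε : ℝ} (hε : 0 < ε) {n : ℕ} (hn : d < n) :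
    Integrable (fun x : EuclideanSpace ℝ (Fin d) => invBracket ε x ^ n) := by
  have h1 := integrable_rpow_neg_one_add_norm_sq (E := EuclideanSpace ℝ (Fin d))
    (μ := volume) (r := n) (by simpa using hn)
  refine (h1.const_mul (max 1 (ε⁻¹) ^ n)).mono'
    ((contDiff_invBracket hε).continuous.pow n).aestronglyMeasurable (.of_forall fun x => ?_)
  have hq := invBracket_pos hε x
  have h2 : (1 + ‖x‖ ^ 2) ^ (-(n : ℝ) / 2) = invBracket 1 x ^ n := by
    rw [invBracket, Real.sqrt_eq_rpow, ← Real.rpow_neg (by positivity), ← Real.rpow_mul_natCast (by positivity)]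
    congr 1 <;> ring
  rw [h2, Real.norm_of_nonneg (by positivity), ← mul_pow]
  refine pow_le_pow_left₀ hq.le ?_ n
  have h3 := invBracket_pos one_pos x
  refine (abs_le_of_sq_le_sq' ?_ (by positivity)).2
  have e1 := invBracket_sq hε x
  have e2 := invBracket_sq one_pos x
  have h4 : ‖x‖ ^ 2 + 1 ^ 2 ≤ max 1 ε⁻¹ ^ 2 * (‖x‖ ^ 2 + ε ^ 2) := by
    have h5 : 1 ≤ max 1 ε⁻¹ ^ 2 := one_le_pow₀ (le_max_left _ _)
    have h6 : (ε⁻¹) ^ 2 ≤ max 1 ε⁻¹ ^ 2 := by gcongr; exact le_max_right _ _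
    have h7 : 1 ≤ max 1 ε⁻¹ ^ 2 * ε ^ 2 := by
      calc (1 : ℝ) = (ε⁻¹) ^ 2 * ε ^ 2 := by field_simp
        _ ≤ _ := by gcongr
    nlinarith [sq_nonneg ‖x‖]
  calc invBracket ε x ^ 2 = invBracket ε x ^ 2 * (invBracket 1 x ^ 2 * (‖x‖ ^ 2 + 1 ^ 2)) := by
        rw [e2, mul_one]
    _ ≤ invBracket ε x ^ 2 * (invBracket 1 x ^ 2 * (max 1 ε⁻¹ ^ 2 * (‖x‖ ^ 2 + ε ^ 2))) := by
        gcongr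
    _ = (invBracket ε x ^ 2 * (‖x‖ ^ 2 + ε ^ 2)) * (max 1 ε⁻¹ * invBracket 1 x) ^ 2 := by ring
    _ = _ := by rw [e1, one_mul]

theorem norm_fderiv_le_sum_partialDeriv (φ : EuclideanSpace ℝ (Fin d) → ℝ)
    (x : EuclideanSpace ℝ (Fin d)) : ‖fderiv ℝ φ x‖ ≤ ∑ i, |partialDeriv i φ x| := by
  refine ContinuousLinearMap.opNorm_le_bound _ (Finset.sum_nonneg fun _ _ => abs_nonneg _)
    fun v => ?_
  have hv : v = ∑ i, v i • EuclideanSpace.single i (1 : ℝ) := by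
    ext j; simp [Pi.single_apply]
  conv_lhs => rw [hv]
  rw [map_sum, Finset.sum_mul]
  refine (norm_sum_le _ _).trans (Finset.sum_le_sum fun i _ => ?_)
  rw [map_smul, smul_eq_mul, norm_mul, mul_comm]
  exact mul_le_mul_of_nonneg_left (PiLp.norm_apply_le v i) (abs_nonneg _)

end Kernel

/-! ### Convolution with smooth kernels, and weak derivatives. -/

section Convolution

open Filter Topology

variable {d : ℕ}

/-- The convolution of a real kernel with a complex function. -/
noncomputable def conv (k : EuclideanSpace ℝ (Fin d) → ℝ) (h : EuclideanSpace ℝ (Fin d) → ℂ)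
    (x : EuclideanSpace ℝ (Fin d)) : ℂ :=
  ∫ y, k (x - y) • h y

theorem integrable_kernel_smul {k : EuclideanSpace ℝ (Fin d) → ℝ}
    {h : EuclideanSpace ℝ (Fin d) → ℂ} (hk : Continuous k) {C : ℝ} (hC : ∀ x, |k x| ≤ C)
    (hh : Integrable h) (x : EuclideanSpace ℝ (Fin d)) :
    Integrable (fun y => k (x - y) • h y) := by
  refine (hh.norm.const_mul C).mono' ?_ (.of_forall fun y => ?_)
  · exact (hk.comp (continuous_const.sub continuous_id)).aestronglyMeasurable.smul
      hh.aestronglyMeasurable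
  · rw [norm_smul, Real.norm_eq_abs]
    exact mul_le_mul_of_nonneg_right (hC _) (norm_nonneg _)

theorem continuous_conv {k : EuclideanSpace ℝ (Fin d) → ℝ}
    {h : EuclideanSpace ℝ (Fin d) → ℂ} (hk : Continuous k) {C : ℝ} (hC : ∀ x, |k x| ≤ C)
    (hh : Integrable h) : Continuous (conv k h) := by
  refine continuous_of_dominated (bound := fun y => C * ‖h y‖)
    (fun x => (integrable_kernel_smul hk hC hh x).aestronglyMeasurable)
    (fun x => .of_forall fun y => ?_) (hh.norm.const_mul C) (.of_forall fun y => by fun_prop)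
  rw [norm_smul, Real.norm_eq_abs]
  exact mul_le_mul_of_nonneg_right (hC _) (norm_nonneg _)

/-- Differentiation under the integral sign: all derivatives fall on the kernel, so that
integrability of `h` suffices. -/
theorem hasFDerivAt_conv {k : EuclideanSpace ℝ (Fin d) → ℝ}
    {h : EuclideanSpace ℝ (Fin d) → ℂ} (hk : ContDiff ℝ ∞ k) {C C' : ℝ} (hC : ∀ x, |k x| ≤ C)
    (hC' : ∀ i x, |partialDeriv i k x| ≤ C') (hh : Integrable h)
    (x : EuclideanSpace ℝ (Fin d)) :
    DifferentiableAt ℝ (conv k h) x ∧ ∀ i, fderiv ℝ (conv k h) x (EuclideanSpace.single i 1) =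
      conv (partialDeriv i k) h x := by
  have hdk : Differentiable ℝ k := hk.differentiable (by simp)
  have hcont : Continuous (fderiv ℝ k) := hk.continuous_fderiv (by simp)
  have hb : ∀ z, ‖fderiv ℝ k z‖ ≤ d * C' := fun z => by
    refine (norm_fderiv_le_sum_partialDeriv k z).trans ?_
    refine (Finset.sum_le_sum fun i _ => hC' i z).trans (by simp)
  have hmeas : ∀ x : EuclideanSpace ℝ (Fin d), AEStronglyMeasurable
      (fun y => (fderiv ℝ k (x - y)).smulRight (h y)) volume := fun x => by
    exact (ContinuousLinearMap.smulRightL ℝ (EuclideanSpace ℝ (Fin d)) ℂ).aestronglyMeasurable_comp₂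
      (hcont.comp (continuous_const.sub continuous_id)).aestronglyMeasurable
      hh.aestronglyMeasurable
  have hbd : ∀ x y : EuclideanSpace ℝ (Fin d),
      ‖(fderiv ℝ k (x - y)).smulRight (h y)‖ ≤ d * C' * ‖h y‖ := fun x y => by
    rw [ContinuousLinearMap.norm_smulRight_apply]
    exact mul_le_mul_of_nonneg_right (hb _) (norm_nonneg _)
  have key : HasFDerivAt (conv k h) (∫ y, (fderiv ℝ k (x - y)).smulRight (h y)) x := by
    refine hasFDerivAt_integral_of_dominated_of_fderiv_le (s := Set.univ)
      (F' := fun x y => (fderiv ℝ k (x - y)).smulRight (h y))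
      (bound := fun y => d * C' * ‖h y‖) univ_mem
      (.of_forall fun x => (integrable_kernel_smul hk.continuous hC hh x).aestronglyMeasurable)
      (integrable_kernel_smul hk.continuous hC hh x) (hmeas x)
      (.of_forall fun y z _ => hbd z y) (hh.norm.const_mul _) (.of_forall fun y z _ => ?_)
    have h1 : HasFDerivAt (fun z => k (z - y)) (fderiv ℝ k (z - y)) z :=
      ((hdk (z - y)).hasFDerivAt.comp z ((hasFDerivAt_id z).sub_const y)).congr_fderiv
        (ContinuousLinearMap.comp_id _)
    exact h1.smul_const (h y)
  refine ⟨key.differentiableAt, fun i => ?_⟩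
  rw [key.fderiv, ContinuousLinearMap.integral_apply
    ((hh.norm.const_mul (d * C')).mono' (hmeas x) (.of_forall fun y => hbd x y))]
  rfl

/-- The decay of the kernel passes to the convolution. The constant degenerates as `ε → 0`, which is
harmless: it serves only for integrability and for vanishing boundary terms at fixed `ε`. -/
theorem norm_conv_le {ε R C : ℝ} (hε : 0 < ε) {n : ℕ}
    {k : EuclideanSpace ℝ (Fin d) → ℝ}
    {h : EuclideanSpace ℝ (Fin d) → ℂ} (hC : ∀ x, |k x| ≤ C * invBracket ε x ^ n)
    (hh : Integrable h) (hsupp : ∀ y, R ≤ ‖y‖ → h y = 0) :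
    ∃ C' : ℝ, ∀ x, ‖conv k h x‖ ≤ C' * invBracket ε x ^ n := by
  have hC0 : 0 ≤ C := by
    have h1 := (abs_nonneg _).trans (hC 0)
    exact nonneg_of_mul_nonneg_left h1 (pow_pos (invBracket_pos hε 0) n)
  refine ⟨C * (2 * (1 + R / ε)) ^ n * ∫ y, ‖h y‖, fun x => ?_⟩
  rw [← integral_const_mul, ← integral_mul_const]
  refine norm_integral_le_of_norm_le ((hh.norm.const_mul _).mul_const _)
    (.of_forall fun y => ?_)
  rw [norm_smul, Real.norm_eq_abs]
  have hq := invBracket_pos hε x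
  by_cases hy : R ≤ ‖y‖
  · simp [hsupp y hy]
  · have h1 := invBracket_sub_le hε (x := x) (not_le.1 hy).le
    calc |k (x - y)| * ‖h y‖ ≤ (C * invBracket ε (x - y) ^ n) * ‖h y‖ := by gcongr; exact hC _
      _ ≤ (C * ((2 * (1 + R / ε)) * invBracket ε x) ^ n) * ‖h y‖ := by
        have := invBracket_pos hε (x - y)
        gcongr
      _ = _ := by rw [mul_pow]; ring

theorem conj_conv (k : EuclideanSpace ℝ (Fin d) → ℝ) (h : EuclideanSpace ℝ (Fin d) → ℂ)
    (x : EuclideanSpace ℝ (Fin d)) : conj (conv k h x) = conv k (fun y => conj (h y)) x := by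
  rw [conv, ← integral_conj, conv]
  simp

/-- A smooth cutoff function which equals one on a given ball. -/
theorem exists_cutoff (R : ℝ) (hR : 0 < R) : ∃ χ : EuclideanSpace ℝ (Fin d) → ℝ,
    ContDiff ℝ ∞ χ ∧ HasCompactSupport χ ∧ ∀ x, ‖x‖ < R → χ =ᶠ[𝓝 x] 1 := by
  let f : ContDiffBump (0 : EuclideanSpace ℝ (Fin d)) := ⟨R, 2 * R, hR, by linarith⟩
  exact ⟨f, f.contDiff, f.hasCompactSupport, fun x hx =>
    f.eventuallyEq_one_of_mem_ball (by simpa using hx)⟩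

/-- Since `h` has bounded support, only the values of `k` on a fixed ball matter near a given point.
The kernel may thus be cut off there and the result for compactly supported kernels applies. -/
theorem contDiff_conv {R : ℝ} {k : EuclideanSpace ℝ (Fin d) → ℝ}
    {h : EuclideanSpace ℝ (Fin d) → ℂ} (hk : ContDiff ℝ ∞ k)
    (hh : Integrable h) (hR : 0 < R) (hsupp : ∀ y, R ≤ ‖y‖ → h y = 0) :
    ContDiff ℝ ∞ (conv k h) := by
  rw [contDiff_iff_contDiffAt]
  intro x
  obtain ⟨χ, hχ, hχc, hχ1⟩ := exists_cutoff (d := d) (‖x‖ + 1 + R) (by positivity)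
  have h1 : ContDiff ℝ ∞ (convolution (fun z => χ z * k z) h (ContinuousLinearMap.lsmul ℝ ℝ)
      volume) :=
    HasCompactSupport.contDiff_convolution_left (n := ⊤) _ hχc.mul_right (hχ.mul hk)
      hh.locallyIntegrable
  refine h1.contDiffAt.congr_of_eventuallyEq ?_
  filter_upwards [Metric.ball_mem_nhds x one_pos] with z hz
  rw [convolution_lsmul_swap, conv]
  refine integral_congr_ae (.of_forall fun y => ?_)
  by_cases hy : R ≤ ‖y‖
  · simp [hsupp y hy]
  · have h2 : ‖z - y‖ < ‖x‖ + 1 + R := by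
      have h3 : ‖z - x‖ < 1 := by simpa [dist_eq_norm] using hz
      have h4 : ‖z - y‖ ≤ ‖z - x‖ + ‖x‖ + ‖y‖ := by
        have : z - y = (z - x) + x - y := by abel
        rw [this]
        exact (norm_sub_le _ _).trans (add_le_add_left (norm_add_le _ _) _)
      linarith
    simp [(hχ1 _ h2).self_of_nhds]

theorem integrable_of_memLp_two {F : Type*} [NormedAddCommGroup F]
    {h : EuclideanSpace ℝ (Fin d) → F} {x₀ : EuclideanSpace ℝ (Fin d)} {R : ℝ}
    (hh : MemLp h 2 volume) (hsupp : ∀ y, y ∉ Metric.ball x₀ R → h y = 0) : Integrable h := by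
  have h1 : IntegrableOn h (Metric.ball x₀ R) :=
    have : IsFiniteMeasure (volume.restrict (Metric.ball x₀ R)) :=
      isFiniteMeasure_restrict.2 measure_ball_lt_top.ne
    (hh.restrict (Metric.ball x₀ R)).integrable (by norm_num)
  exact (integrableOn_iff_integrable_of_support_subset fun y hy => by
    by_contra hc; exact hy (hsupp y hc)).1 h1

theorem memLp_two_of_bound {F : Type*} [NormedAddCommGroup F] {ε C : ℝ} (hε : 0 < ε) {n : ℕ}
    (hn : d < 2 * n) {h : EuclideanSpace ℝ (Fin d) → F} (hh : AEStronglyMeasurable h volume)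
    (hC : ∀ x, ‖h x‖ ≤ C * invBracket ε x ^ n) : MemLp h 2 volume := by
  rw [memLp_two_iff_integrable_sq_norm hh]
  refine ((integrable_invBracket_pow hε hn).const_mul (C ^ 2)).mono' (hh.norm.pow 2)
    (.of_forall fun x => ?_)
  rw [Real.norm_of_nonneg (by positivity)]
  calc ‖h x‖ ^ 2 ≤ (C * invBracket ε x ^ n) ^ 2 := by gcongr; exact hC x
    _ = _ := by ring

theorem hasWeakPartialDeriv_of_fderiv {α : Fin d} {h g : EuclideanSpace ℝ (Fin d) → ℂ}
    (hh : Differentiable ℝ h) (hg : Continuous g)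
    (hgh : ∀ x, fderiv ℝ h x (EuclideanSpace.single α 1) = g x) : HasWeakPartialDeriv α h g := by
  intro φ hφ hc
  have hdφ : Continuous (partialDeriv α φ) :=
    (hφ.continuous_fderiv (by simp)).clm_apply continuous_const
  have hcφ : HasCompactSupport (partialDeriv α φ) := hc.fderiv_apply (𝕜 := ℝ) _
  have key := integral_bilinear_fderiv_right_eq_neg_left_of_integrable (μ := volume)
    (f := φ) (g := h) (v := EuclideanSpace.single α (1 : ℝ))
    (B := ContinuousLinearMap.lsmul ℝ ℝ) ?_ ?_ ?_
    (fun x _ => hφ.differentiable (by simp) x) (fun x _ => hh x)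
  · simp only [ContinuousLinearMap.lsmul_apply, hgh] at key
    rw [key, neg_neg]; rfl
  · exact (hdφ.smul hh.continuous).integrable_of_hasCompactSupport hcφ.smul_right
  · simp only [ContinuousLinearMap.lsmul_apply, hgh]
    exact (hφ.continuous.smul hg).integrable_of_hasCompactSupport hc.smul_right
  · exact (hφ.continuous.smul hh.continuous).integrable_of_hasCompactSupport hc.smul_right

theorem partialDeriv_mul {α : Fin d} {φ χ : EuclideanSpace ℝ (Fin d) → ℝ}
    (hφ : ContDiff ℝ ∞ φ) (hχ : ContDiff ℝ ∞ χ) (x : EuclideanSpace ℝ (Fin d)) :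
    partialDeriv α (fun x => φ x * χ x) x =
      φ x * partialDeriv α χ x + partialDeriv α φ x * χ x := by
  rw [partialDeriv, fderiv_fun_mul (hφ.differentiable (by simp) x) (hχ.differentiable (by simp) x)]
  simp [partialDeriv, mul_comm]

/-- Weak derivatives of functions with bounded support may be tested with all smooth functions. -/
theorem HasWeakPartialDeriv.integral_eq {α : Fin d} {h g : EuclideanSpace ℝ (Fin d) → ℂ} {R : ℝ}
    (hw : HasWeakPartialDeriv α h g) (hR : 0 < R) (hh : ∀ y, R ≤ ‖y‖ → h y = 0)
    (hg : ∀ y, R ≤ ‖y‖ → g y = 0) {φ : EuclideanSpace ℝ (Fin d) → ℝ} (hφ : ContDiff ℝ ∞ φ) :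
    ∫ x, partialDeriv α φ x • h x = -∫ x, φ x • g x := by
  obtain ⟨χ, hχ, hχc, hχ1⟩ := exists_cutoff (d := d) R hR
  have key := hw (fun x => φ x * χ x) (hφ.mul hχ) hχc.mul_left
  have e1 : ∫ x, partialDeriv α (fun x => φ x * χ x) x • h x = ∫ x, partialDeriv α φ x • h x := by
    refine integral_congr_ae (.of_forall fun x => ?_)
    by_cases hx : R ≤ ‖x‖
    · simp [hh x hx]
    · have h1 := hχ1 x (not_le.1 hx)
      have h2 : partialDeriv α χ x = 0 := by
        rw [partialDeriv, h1.fderiv_eq]; simp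
      simp only [partialDeriv_mul hφ hχ, h2, h1.self_of_nhds]
      simp
  have e2 : ∫ x, (φ x * χ x) • g x = ∫ x, φ x • g x := by
    refine integral_congr_ae (.of_forall fun x => ?_)
    by_cases hx : R ≤ ‖x‖
    · simp [hg x hx]
    · simp [(hχ1 x (not_le.1 hx)).self_of_nhds]
  rw [← e1, key, e2]

/-- Convolution moves a weak derivative onto the kernel. -/
theorem HasWeakPartialDeriv.conv_eq {α : Fin d} {h g : EuclideanSpace ℝ (Fin d) → ℂ} {R : ℝ}
    (hw : HasWeakPartialDeriv α h g) (hR : 0 < R) (hh : ∀ y, R ≤ ‖y‖ → h y = 0)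
    (hg : ∀ y, R ≤ ‖y‖ → g y = 0) {k : EuclideanSpace ℝ (Fin d) → ℝ} (hk : ContDiff ℝ ∞ k)
    (x : EuclideanSpace ℝ (Fin d)) : conv (partialDeriv α k) h x = conv k g x := by
  have key := hw.integral_eq hR hh hg (φ := fun y => k (x - y))
    (hk.comp (contDiff_const.sub contDiff_id))
  have h1 : ∀ y, partialDeriv α (fun y => k (x - y)) y = -partialDeriv α k (x - y) := fun y => by
    have h2 : HasFDerivAt (fun y => x - y)
      (-ContinuousLinearMap.id ℝ (EuclideanSpace ℝ (Fin d))) y := (hasFDerivAt_id y).const_sub x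
    have h3 : HasFDerivAt (fun y => k (x - y)) _ y :=
      (hk.differentiable (by simp) (x - y)).hasFDerivAt.comp y h2
    rw [partialDeriv, h3.fderiv]
    simp [partialDeriv]
  simp only [h1, neg_smul, integral_neg, neg_inj] at key
  exact key

end Convolution

/-! ### The approximate identity `approxDelta` acting on `L²`. -/

section ApproxIdentity

open Filter Topology

variable {d : ℕ}

theorem inner_toLp {X F : Type*} [MeasurableSpace X] {μ : Measure X} [NormedAddCommGroup F]
    [InnerProductSpace ℂ F] {f g : X → F}
    (hf : MemLp f 2 μ) (hg : MemLp g 2 μ) :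
    inner ℂ (hf.toLp f) (hg.toLp g) = ∫ x, inner ℂ (f x) (g x) ∂μ := by
  rw [L2.inner_def]
  refine integral_congr_ae ?_
  filter_upwards [hf.coeFn_toLp, hg.coeFn_toLp] with x h1 h2
  rw [h1, h2]

theorem norm_toLp_sq {X F : Type*} [MeasurableSpace X] {μ : Measure X} [NormedAddCommGroup F]
    [InnerProductSpace ℂ F] {f : X → F}
    (hf : MemLp f 2 μ) : ‖hf.toLp f‖ ^ 2 = ∫ x, ‖f x‖ ^ 2 ∂μ := by
  have h := inner_toLp hf hf
  simp only [inner_self_eq_norm_sq_to_K] at h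
  have h2 : ∫ x, ((‖f x‖ : ℂ)) ^ 2 ∂μ = ((∫ x, ‖f x‖ ^ 2 ∂μ : ℝ) : ℂ) := by
    rw [← integral_complex_ofReal]; simp
  rw [← Complex.ofReal_inj, ← h2]
  simpa using h

theorem memLp_comp_sub {F : Type*} [NormedAddCommGroup F]
    {V : EuclideanSpace ℝ (Fin d) → F} (hV : MemLp V 2 volume)
    (z : EuclideanSpace ℝ (Fin d)) : MemLp (fun x => V (x - z)) 2 volume :=
  hV.comp_measurePreserving (measurePreserving_sub_right volume z)

theorem memLp_conj {X : Type*} [MeasurableSpace X] {μ : Measure X} {G : X → ℂ} {p : ℝ≥0∞}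
    (hG : MemLp G p μ) : MemLp (fun x => conj (G x)) p μ := hG.star

/-- The pairing of `G` with the translate of `V` by `z`. -/
noncomputable def translatePairing (G V : EuclideanSpace ℝ (Fin d) → ℂ)
    (z : EuclideanSpace ℝ (Fin d)) : ℂ := ∫ x, G x * V (x - z)

theorem translatePairing_eq {G V : EuclideanSpace ℝ (Fin d) → ℂ} (hG : MemLp G 2 volume)
    (hV : MemLp V 2 volume) (z : EuclideanSpace ℝ (Fin d)) :
    translatePairing G V z =
      inner ℂ ((memLp_conj hG).toLp _) ((memLp_comp_sub hV z).toLp _) := by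
  rw [inner_toLp]
  simp [translatePairing, mul_comm]

/-- Translation acts strongly continuously on `L²`. -/
theorem continuous_translatePairing {G V : EuclideanSpace ℝ (Fin d) → ℂ} (hG : MemLp G 2 volume)
    (hV : MemLp V 2 volume) : Continuous (translatePairing G V) := by
  have h1 : ∀ z, translatePairing G V z = inner ℂ ((memLp_conj hG).toLp _)
      (DomAddAct.mk (-z) +ᵥ hV.toLp V) := fun z => by
    rw [translatePairing_eq hG hV, DomAddAct.mk_vadd_toLp]
    simp only [vadd_eq_add, neg_add_eq_sub]
  have h2 : Continuous fun z : EuclideanSpace ℝ (Fin d) =>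
      (DomAddAct.mk (-z) +ᵥ hV.toLp V : Lp ℂ 2 volume) := by
    have h3 : Continuous fun z : EuclideanSpace ℝ (Fin d) => DomAddAct.mk (-z) :=
      DomAddAct.continuous_mk.comp continuous_neg
    have : Fact ((2 : ℝ≥0∞) ≠ ⊤) := ⟨by norm_num⟩
    exact h3.vadd continuous_const
  rw [funext h1]
  exact continuous_const.inner h2

theorem norm_translatePairing_le {G V : EuclideanSpace ℝ (Fin d) → ℂ} (hG : MemLp G 2 volume)
    (hV : MemLp V 2 volume) (z : EuclideanSpace ℝ (Fin d)) :
    ‖translatePairing G V z‖ ≤ √(∫ x, ‖G x‖ ^ 2) * √(∫ x, ‖V x‖ ^ 2) := by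
  rw [translatePairing_eq hG hV]
  refine (norm_inner_le_norm _ _).trans (le_of_eq ?_)
  congr 1
  · rw [← Real.sqrt_sq (norm_nonneg _), norm_toLp_sq]; simp
  · rw [← Real.sqrt_sq (norm_nonneg _), norm_toLp_sq,
      integral_sub_right_eq_self (fun x => ‖V x‖ ^ 2) z]

/-- Fubini: pairing with a convolution is averaging the pairings with translates. Both the
convergence and the `L²` bound of the mollification are read off from this formula. -/
theorem integral_mul_conv {k : EuclideanSpace ℝ (Fin d) → ℝ}
    {G V : EuclideanSpace ℝ (Fin d) → ℂ} (hk : Integrable k)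
    (hG : MemLp G 2 volume) (hV : MemLp V 2 volume) :
    ∫ x, G x * conv k V x = ∫ z, k z • translatePairing G V z := by
  have hswap : ∀ x, conv k V x = ∫ z, k z • V (x - z) := fun x => by
    rw [conv, ← integral_sub_left_eq_self _ volume x]
    simp
  have hmeas : AEStronglyMeasurable (fun p : EuclideanSpace ℝ (Fin d) × EuclideanSpace ℝ (Fin d) =>
      G p.1 * (k p.2 • V (p.1 - p.2))) (volume.prod volume) :=
    hG.aestronglyMeasurable.comp_fst.mul
      (AEStronglyMeasurable.convolution_integrand (ContinuousLinearMap.lsmul ℝ ℝ)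
        hk.aestronglyMeasurable hV.aestronglyMeasurable)
  have hG2 : Integrable fun x => ‖G x‖ ^ 2 := (memLp_two_iff_integrable_sq_norm hG.1).1 hG
  have hV2 : ∀ z, Integrable fun x => ‖V (x - z)‖ ^ 2 := fun z =>
    (memLp_two_iff_integrable_sq_norm (memLp_comp_sub hV z).1).1 (memLp_comp_sub hV z)
  have hi : ∀ z, Integrable fun x => G x * (k z • V (x - z)) := fun z =>
    hG.integrable_mul ((memLp_comp_sub hV z).const_smul (k z))
  have hint : Integrable (Function.uncurry fun x z : EuclideanSpace ℝ (Fin d) =>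
      G x * (k z • V (x - z))) (volume.prod volume) := by
    refine (integrable_prod_iff' hmeas).2 ⟨.of_forall hi, ?_⟩
    refine (hk.norm.mul_const ((∫ x, ‖G x‖ ^ 2) + ∫ x, ‖V x‖ ^ 2)).mono'
      hmeas.norm.prod_swap.integral_prod_right' (.of_forall fun z => ?_)
    rw [Real.norm_of_nonneg (by positivity), ← integral_sub_right_eq_self (fun x => ‖V x‖ ^ 2) z,
      ← integral_add hG2 (hV2 z), ← integral_const_mul]
    refine integral_mono (hi z).norm ((hG2.add (hV2 z)).const_mul _) fun x => ?_
    simp only [norm_mul, norm_smul]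
    -- The crude bound `|G| |V| ≤ |G|² + |V|²`, multiplied by `|k z|`, is all that Fubini needs.
    nlinarith [mul_nonneg (norm_nonneg (k z)) (sq_nonneg (‖G x‖ - ‖V (x - z)‖)),
      mul_nonneg (norm_nonneg (k z)) (sq_nonneg (‖G x‖)),
      mul_nonneg (norm_nonneg (k z)) (sq_nonneg (‖V (x - z)‖))]
  simp only [hswap, ← integral_const_mul]
  rw [integral_integral_swap hint]
  refine integral_congr_ae (.of_forall fun z => ?_)
  simp only [translatePairing, mul_smul_comm, integral_smul]

theorem invBracket_smul {ε : ℝ} (hε : 0 < ε) (z : EuclideanSpace ℝ (Fin d)) :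
    invBracket ε (ε • z) = ε⁻¹ * invBracket 1 z := by
  rw [invBracket, invBracket, norm_smul, Real.norm_of_nonneg hε.le,
    show (ε * ‖z‖) ^ 2 + ε ^ 2 = ε ^ 2 * (‖z‖ ^ 2 + 1 ^ 2) by ring,
    Real.sqrt_mul (by positivity), Real.sqrt_sq hε.le, mul_inv]

theorem approxDelta_smul {ε : ℝ} (hε : 0 < ε) (z : EuclideanSpace ℝ (Fin d)) :
    approxDelta ε (ε • z) = (ε ^ d)⁻¹ * approxDelta 1 z := by
  rw [approxDelta, approxDelta, invBracket_smul hε, mul_pow, inv_pow, pow_add ε]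
  field_simp

theorem integrable_approxDelta {ε : ℝ} (hε : 0 < ε) :
    Integrable (approxDelta ε : EuclideanSpace ℝ (Fin d) → ℝ) :=
  (integrable_invBracket_pow hε (by omega)).const_mul _

/-- The mass of the approximate identity. -/
noncomputable def deltaMass (d : ℕ) : ℝ := ∫ x : EuclideanSpace ℝ (Fin d), approxDelta 1 x

theorem deltaMass_pos (hd : 0 < d) : 0 < deltaMass d := by
  rw [deltaMass, integral_pos_iff_support_of_nonneg (approxDelta_nonneg one_pos)
    (integrable_approxDelta one_pos)]
  have : Function.support (approxDelta 1 : EuclideanSpace ℝ (Fin d) → ℝ) = Set.univ := by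
    refine Set.eq_univ_of_forall fun x => ?_
    have h := invBracket_pos one_pos x
    have hd' : (0 : ℝ) < d := by exact_mod_cast hd
    exact (show 0 < approxDelta 1 x by unfold approxDelta; positivity).ne'
  rw [this]
  exact Measure.measure_univ_pos.2 (NeZero.ne _)

theorem integral_approxDelta_smul {F : Type*} [NormedAddCommGroup F] [NormedSpace ℝ F]
    {ε : ℝ} (hε : 0 < ε) (H : EuclideanSpace ℝ (Fin d) → F) :
    ∫ z, approxDelta ε z • H z = ∫ z, approxDelta 1 z • H (ε • z) := by
  have h := Measure.integral_comp_smul_of_nonneg (volume : Measure (EuclideanSpace ℝ (Fin d)))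
    (fun z => approxDelta ε z • H z) ε (hR := hε.le)
  simp only [approxDelta_smul hε, finrank_euclideanSpace, Fintype.card_fin, mul_smul,
    integral_smul] at h
  exact (smul_right_injective F (inv_ne_zero (pow_pos hε d).ne') h).symm

/-- After rescaling, the integrand is `approxDelta 1 z` times a bounded continuous function at `ε
z`, so dominated convergence applies. The kernel is not normalised; its mass is divided out in
`exists_defect_bound`. -/
theorem tendsto_integral_mul_conv {G V : EuclideanSpace ℝ (Fin d) → ℂ}
    (hG : MemLp G 2 volume) (hV : MemLp V 2 volume) :
    Tendsto (fun ε => ∫ x, G x * conv (approxDelta ε) V x) (𝓝[>] 0)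
      (𝓝 (deltaMass d * ∫ x, G x * V x)) := by
  have h1 : ∀ᶠ ε in 𝓝[>] (0 : ℝ), ∫ z, approxDelta 1 z • translatePairing G V (ε • z) =
      ∫ x, G x * conv (approxDelta ε) V x := by
    filter_upwards [self_mem_nhdsWithin] with ε hε
    rw [integral_mul_conv (integrable_approxDelta hε) hG hV, integral_approxDelta_smul hε]
  refine Tendsto.congr' h1 ?_
  have h2 : (deltaMass d : ℂ) * ∫ x, G x * V x =
      ∫ z : EuclideanSpace ℝ (Fin d), approxDelta 1 z • translatePairing G V ((0 : ℝ) • z) := by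
    rw [deltaMass, ← integral_complex_ofReal, ← integral_mul_const]
    simp [translatePairing]
  rw [h2]
  have hcont := continuous_translatePairing hG hV
  refine (tendsto_integral_filter_of_dominated_convergence
    (fun z => approxDelta 1 z * (√(∫ x, ‖G x‖ ^ 2) * √(∫ x, ‖V x‖ ^ 2)))
    (.of_forall fun ε => ?_) (.of_forall fun ε => .of_forall fun z => ?_)
    ((integrable_approxDelta one_pos).mul_const _) (.of_forall fun z => ?_))
  · exact (((contDiff_approxDelta one_pos).continuous).smul
      (hcont.comp (continuous_const_smul ε))).aestronglyMeasurable
  · rw [norm_smul, Real.norm_of_nonneg (approxDelta_nonneg one_pos z)]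
    exact mul_le_mul_of_nonneg_left (norm_translatePairing_le hG hV _)
      (approxDelta_nonneg one_pos z)
  · have : Continuous fun ε : ℝ => approxDelta 1 z • translatePairing G V (ε • z) := by fun_prop
    exact (this.tendsto 0).mono_left nhdsWithin_le_nhds

/-- Young's convolution inequality by duality: the convolution is paired with itself, which gives `I
≤ mass * √I * √J`. Dividing by `√I` requires the convolution to be in `L²` beforehand. -/
theorem integral_norm_sq_conv_le {ε : ℝ} (hε : 0 < ε) {V : EuclideanSpace ℝ (Fin d) → ℂ}
    (hV : MemLp V 2 volume) (hc : MemLp (conv (approxDelta ε) V) 2 volume) :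
    ∫ x, ‖conv (approxDelta ε) V x‖ ^ 2 ≤ deltaMass d ^ 2 * ∫ x, ‖V x‖ ^ 2 := by
  set I := ∫ x, ‖conv (approxDelta ε) V x‖ ^ 2
  set J := ∫ x, ‖V x‖ ^ 2
  have hI : 0 ≤ I := integral_nonneg fun x => by positivity
  have hJ : 0 ≤ J := integral_nonneg fun x => by positivity
  have hκ : 0 ≤ deltaMass d := integral_nonneg (approxDelta_nonneg one_pos)
  have e1 : ∫ x, conj (conv (approxDelta ε) V x) * conv (approxDelta ε) V x = (I : ℂ) := by
    rw [← integral_complex_ofReal]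
    refine integral_congr_ae (.of_forall fun x => ?_)
    simp [Complex.conj_mul']
  rw [integral_mul_conv (integrable_approxDelta hε) (memLp_conj hc) hV] at e1
  have e2 : I ≤ deltaMass d * (√I * √J) := by
    calc I = ‖(I : ℂ)‖ := by simp [abs_of_nonneg hI]
      _ ≤ ∫ z, approxDelta ε z * (√I * √J) := by
        rw [← e1]
        refine norm_integral_le_of_norm_le ((integrable_approxDelta hε).mul_const _)
          (.of_forall fun z => ?_)
        rw [norm_smul, Real.norm_of_nonneg (approxDelta_nonneg hε z)]
        refine mul_le_mul_of_nonneg_left ?_ (approxDelta_nonneg hε z)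
        refine (norm_translatePairing_le (memLp_conj hc) hV z).trans (le_of_eq ?_)
        simp [I, J]
      _ = _ := by
        have := integral_approxDelta_smul (d := d) hε (fun _ => (√I * √J))
        simp only [smul_eq_mul] at this
        rw [this, integral_mul_const, deltaMass]
  rcases hI.eq_or_lt with h0 | hpos
  · rw [← h0]; positivity
  · have h3 : √I ≤ deltaMass d * √J := by
      have h4 : 0 < √I := Real.sqrt_pos.2 hpos
      nlinarith [Real.mul_self_sqrt hI]
    calc I = √I ^ 2 := (Real.sq_sqrt hI).symm
      _ ≤ (deltaMass d * √J) ^ 2 := by gcongr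
      _ = _ := by rw [mul_pow, Real.sq_sqrt hJ]

end ApproxIdentity

/-! ### Potentials: the `L²` identity for second derivatives and their decay. -/

section KernelConvolution

open Filter Topology

variable {d : ℕ}

theorem bounded_of_le_invBracket {ε C : ℝ} (hε : 0 < ε) {n : ℕ}
    {k : EuclideanSpace ℝ (Fin d) → ℝ} (hC : ∀ x, |k x| ≤ C * invBracket ε x ^ n)
    (x : EuclideanSpace ℝ (Fin d)) : |k x| ≤ C * ε⁻¹ ^ n := by
  have hC0 : 0 ≤ C := nonneg_of_mul_nonneg_left ((abs_nonneg _).trans (hC 0))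
    (pow_pos (invBracket_pos hε 0) n)
  have := (invBracket_pos hε x).le
  exact (hC x).trans (by gcongr; exact invBracket_le hε x)

theorem kern_bdd {ε : ℝ} (hε : 0 < ε) (hd : 1 ≤ d) (i : Fin d) (x : EuclideanSpace ℝ (Fin d)) :
    |kern ε i x| ≤ 1 * ε⁻¹ ^ (d - 1) :=
  bounded_of_le_invBracket hε (fun x => by simpa using abs_kern_le hε hd i x) x

theorem kernGrad_bdd {ε : ℝ} (hε : 0 < ε) (i j : Fin d) (x : EuclideanSpace ℝ (Fin d)) :
    |kernGrad ε i j x| ≤ (1 + d) * ε⁻¹ ^ d :=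
  bounded_of_le_invBracket hε (fun x => abs_kernGrad_le hε i j x) x

theorem kernHess_bdd {ε : ℝ} (hε : 0 < ε) (i j k : Fin d) (x : EuclideanSpace ℝ (Fin d)) :
    |kernHess ε i j k x| ≤ d * (d + 5) * ε⁻¹ ^ (d + 1) :=
  bounded_of_le_invBracket hε (fun x => abs_kernHess_le hε i j k x) x

theorem partialDeriv_kern' {ε : ℝ} (hε : 0 < ε) (i j : Fin d) :
    partialDeriv j (kern ε i) = kernGrad ε i j := funext (partialDeriv_kern hε i j)

theorem partialDeriv_kernGrad' {ε : ℝ} (hε : 0 < ε) (i j k : Fin d) :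
    partialDeriv k (kernGrad ε i j) = kernHess ε i j k := funext (partialDeriv_kernGrad hε i j k)

theorem hasFDerivAt_conv_kern {ε : ℝ} (hε : 0 < ε) (hd : 1 ≤ d) (i : Fin d)
    {h : EuclideanSpace ℝ (Fin d) → ℂ} (hh : Integrable h) (x : EuclideanSpace ℝ (Fin d)) :
    DifferentiableAt ℝ (conv (kern ε i) h) x ∧ ∀ j, fderiv ℝ (conv (kern ε i) h) x
      (EuclideanSpace.single j 1) = conv (kernGrad ε i j) h x := by
  simp only [← partialDeriv_kern' hε]
  exact hasFDerivAt_conv (contDiff_kern hε i) (kern_bdd hε hd i)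
    (fun j x => by rw [partialDeriv_kern hε]; exact kernGrad_bdd hε i j x) hh x

theorem hasFDerivAt_conv_kernGrad {ε : ℝ} (hε : 0 < ε) (i j : Fin d)
    {h : EuclideanSpace ℝ (Fin d) → ℂ} (hh : Integrable h) (x : EuclideanSpace ℝ (Fin d)) :
    DifferentiableAt ℝ (conv (kernGrad ε i j) h) x ∧ ∀ k, fderiv ℝ (conv (kernGrad ε i j) h) x
      (EuclideanSpace.single k 1) = conv (kernHess ε i j k) h x := by
  simp only [← partialDeriv_kernGrad' hε]
  exact hasFDerivAt_conv (contDiff_kernGrad hε i j) (kernGrad_bdd hε i j)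
    (fun k x => by rw [partialDeriv_kernGrad hε]; exact kernHess_bdd hε i j k x) hh x

theorem contDiff_kernHess {ε : ℝ} (hε : 0 < ε) (i j k : Fin d) :
    ContDiff ℝ ∞ (kernHess ε i j k) :=
  (contDiff_const.mul ((((contDiff_coord i).mul (contDiff_coord j)).mul (contDiff_coord k)).mul
    ((contDiff_invBracket hε).pow (d + 4)))).sub (contDiff_const.mul
    ((((contDiff_const.mul (contDiff_coord k)).add (contDiff_const.mul (contDiff_coord j))).add
      (contDiff_const.mul (contDiff_coord i))).mul ((contDiff_invBracket hε).pow (d + 2))))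

theorem approxDelta_eq_sum {ε : ℝ} (hε : 0 < ε) :
    (approxDelta ε : EuclideanSpace ℝ (Fin d) → ℝ) = fun x => ∑ i, kernGrad ε i i x :=
  funext fun x => (sum_kernGrad hε x).symm

theorem partialDeriv_approxDelta {ε : ℝ} (hε : 0 < ε) (j : Fin d)
    (x : EuclideanSpace ℝ (Fin d)) :
    partialDeriv j (approxDelta ε) x = ∑ i, kernHess ε i i j x := by
  rw [approxDelta_eq_sum hε, partialDeriv,
    fderiv_fun_sum fun i _ => (contDiff_kernGrad hε i i).differentiable (by simp) x]
  simp only [sum_apply, ← partialDeriv_kernGrad hε]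
  rfl

theorem abs_approxDelta_le {ε : ℝ} (hε : 0 < ε) (x : EuclideanSpace ℝ (Fin d)) :
    |approxDelta ε x| ≤ d * ε ^ 2 * invBracket ε x ^ (d + 2) := by
  rw [abs_of_nonneg (approxDelta_nonneg hε x)]; rfl

theorem hasFDerivAt_conv_approxDelta {ε : ℝ} (hε : 0 < ε)
    {h : EuclideanSpace ℝ (Fin d) → ℂ} (hh : Integrable h) (x : EuclideanSpace ℝ (Fin d)) :
    DifferentiableAt ℝ (conv (approxDelta ε) h) x ∧ ∀ j, fderiv ℝ (conv (approxDelta ε) h) x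
      (EuclideanSpace.single j 1) = conv (partialDeriv j (approxDelta ε)) h x :=
  hasFDerivAt_conv (contDiff_approxDelta hε) (bounded_of_le_invBracket hε (abs_approxDelta_le hε))
    (C' := ∑ _i : Fin d, d * (d + 5) * ε⁻¹ ^ (d + 1))
    (fun j x => by
      rw [partialDeriv_approxDelta hε]
      exact (Finset.abs_sum_le_sum_abs _ _).trans
        (Finset.sum_le_sum fun i _ => kernHess_bdd hε i i j x)) hh x

theorem conv_sum {ι : Type*} [Fintype ι] {k : ι → EuclideanSpace ℝ (Fin d) → ℝ}
    {h : EuclideanSpace ℝ (Fin d) → ℂ} (hk : ∀ i, Continuous (k i)) {C : ℝ}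
    (hC : ∀ i x, |k i x| ≤ C) (hh : Integrable h) (x : EuclideanSpace ℝ (Fin d)) :
    conv (fun z => ∑ i, k i z) h x = ∑ i, conv (k i) h x := by
  simp only [conv, Finset.sum_smul]
  exact integral_finsetSum _ fun i _ => integrable_kernel_smul (hk i) (hC i) hh x

theorem conv_sum_right {ι : Type*} [Fintype ι] {k : EuclideanSpace ℝ (Fin d) → ℝ}
    {h : ι → EuclideanSpace ℝ (Fin d) → ℂ} (hk : Continuous k) {C : ℝ}
    (hC : ∀ x, |k x| ≤ C) (hh : ∀ i, Integrable (h i)) (x : EuclideanSpace ℝ (Fin d)) :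
    conv k (fun y => ∑ i, h i y) x = ∑ i, conv k (h i) x := by
  simp only [conv, Finset.smul_sum]
  exact integral_finsetSum _ fun i _ => integrable_kernel_smul hk hC (hh i) x

theorem conv_approxDelta_eq_sum {ε : ℝ} (hε : 0 < ε) {h : EuclideanSpace ℝ (Fin d) → ℂ}
    (hh : Integrable h) (x : EuclideanSpace ℝ (Fin d)) :
    conv (approxDelta ε) h x = ∑ i, conv (kernGrad ε i i) h x := by
  rw [approxDelta_eq_sum hε]
  exact conv_sum (fun i => (contDiff_kernGrad hε i i).continuous)
    (fun i => kernGrad_bdd hε i i) hh x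

theorem integrable_mul_of_decay {ε C C' : ℝ} (hε : 0 < ε) {n m : ℕ} (hnm : d < n + m)
    {f g : EuclideanSpace ℝ (Fin d) → ℂ} (hf : Continuous f) (hg : Continuous g)
    (hC : ∀ x, ‖f x‖ ≤ C * invBracket ε x ^ n) (hC' : ∀ x, ‖g x‖ ≤ C' * invBracket ε x ^ m) :
    Integrable (fun x => f x * g x) := by
  refine ((integrable_invBracket_pow hε hnm).const_mul (C * C')).mono'
    (hf.mul hg).aestronglyMeasurable (.of_forall fun x => ?_)
  rw [norm_mul]
  calc ‖f x‖ * ‖g x‖ ≤ (C * invBracket ε x ^ n) * (C' * invBracket ε x ^ m) :=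
        mul_le_mul (hC x) (hC' x) (norm_nonneg _) ((norm_nonneg _).trans (hC x))
    _ = _ := by ring

/-- Integration by parts in the direction `j`. Integrability of the undifferentiated product needs
`(d - 1) + d > d`, which is where `2 ≤ d` enters. -/
theorem integral_conv_kernGrad_mul {ε R : ℝ} (hε : 0 < ε) (hd : 2 ≤ d) (i j k l : Fin d)
    {g h : EuclideanSpace ℝ (Fin d) → ℂ} (hg : Integrable g) (hh : Integrable h)
    (hgs : ∀ y, R ≤ ‖y‖ → g y = 0) (hhs : ∀ y, R ≤ ‖y‖ → h y = 0) :
    ∫ x, conv (kernGrad ε i j) g x * conv (kernGrad ε k l) h x =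
      -∫ x, conv (kern ε i) g x * conv (kernHess ε k l j) h x := by
  have hd1 : 1 ≤ d := by omega
  have h1 := fun x => hasFDerivAt_conv_kern hε hd1 i hg x
  have h2 := fun x => hasFDerivAt_conv_kernGrad hε k l hh x
  obtain ⟨C1, b1⟩ := norm_conv_le hε (C := 1) (by simpa using abs_kern_le hε hd1 i) hg hgs
  obtain ⟨C2, b2⟩ := norm_conv_le hε (abs_kernGrad_le hε i j) hg hgs
  obtain ⟨C3, b3⟩ := norm_conv_le hε (abs_kernGrad_le hε k l) hh hhs
  obtain ⟨C4, b4⟩ := norm_conv_le hε (abs_kernHess_le hε k l j) hh hhs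
  have c1 := continuous_conv (contDiff_kern hε i).continuous (kern_bdd hε hd1 i) hg
  have c2 := continuous_conv (contDiff_kernGrad hε i j).continuous (kernGrad_bdd hε i j) hg
  have c3 := continuous_conv (contDiff_kernGrad hε k l).continuous (kernGrad_bdd hε k l) hh
  have c4 := continuous_conv (contDiff_kernHess hε k l j).continuous (kernHess_bdd hε k l j) hh
  have key := integral_mul_fderiv_eq_neg_fderiv_mul_of_integrable (μ := volume) (𝕜 := ℂ)
    (f := conv (kern ε i) g) (g := conv (kernGrad ε k l) h) (v := EuclideanSpace.single j (1 : ℝ))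
    ?_ ?_ ?_ (fun x _ => (h1 x).1) (fun x _ => (h2 x).1)
  · simp only [(h1 _).2, (h2 _).2] at key
    rw [key, neg_neg]
  · simp only [(h1 _).2]
    exact integrable_mul_of_decay hε (by omega) c2 c3 b2 b3
  · simp only [(h2 _).2]
    exact integrable_mul_of_decay hε (by omega) c1 c4 b1 b4
  · exact integrable_mul_of_decay hε (by omega) c1 c3 b1 b3

/-- The `L²` norm of all second derivatives of a potential is that of its Laplacian. -/
theorem sum_integral_norm_sq_conv_kernGrad {ε R : ℝ} (hε : 0 < ε) (hd : 2 ≤ d)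
    {g : EuclideanSpace ℝ (Fin d) → ℂ} (hg : Integrable g)
    (hgs : ∀ y, R ≤ ‖y‖ → g y = 0) :
    ∑ i, ∑ j, ∫ x, ‖conv (kernGrad ε i j) g x‖ ^ 2 = ∫ x, ‖conv (approxDelta ε) g x‖ ^ 2 := by
  have hd1 : 1 ≤ d := by omega
  have hg' : Integrable fun y => conj (g y) := by
    simpa using (Complex.conjCLE.toContinuousLinearMap.integrable_comp hg)
  have hgs' : ∀ y, R ≤ ‖y‖ → conj (g y) = 0 := fun y hy => by simp [hgs y hy]
  have c : ∀ i j, Continuous (conv (kernGrad ε i j) g) := fun i j =>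
    continuous_conv (contDiff_kernGrad hε i j).continuous (kernGrad_bdd hε i j) hg
  have c' : ∀ i j, Continuous (conv (kernGrad ε i j) (fun y => conj (g y))) := fun i j =>
    continuous_conv (contDiff_kernGrad hε i j).continuous (kernGrad_bdd hε i j) hg'
  have hsq : ∀ z : ℂ, ((‖z‖ ^ 2 : ℝ) : ℂ) = z * conj z := fun z => by
    rw [Complex.mul_conj']; simp
  have hint : ∀ i j, Integrable fun x => conv (kernGrad ε i i) g x *
      conv (kernGrad ε j j) (fun y => conj (g y)) x := fun i j => by
    obtain ⟨C2, b2⟩ := norm_conv_le hε (abs_kernGrad_le hε i i) hg hgs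
    obtain ⟨C3, b3⟩ := norm_conv_le hε (abs_kernGrad_le hε j j) hg' hgs'
    exact integrable_mul_of_decay hε (by omega) (c i i) (c' j j) b2 b3
  rw [← Complex.ofReal_inj]
  simp only [Complex.ofReal_sum, ← integral_complex_ofReal, hsq, conj_conv]
  have hR : ∀ x, conv (approxDelta ε) g x * conv (approxDelta ε) (fun y => conj (g y)) x =
      ∑ i, ∑ j, conv (kernGrad ε i i) g x * conv (kernGrad ε j j) (fun y => conj (g y)) x := by
    intro x
    rw [conv_approxDelta_eq_sum hε hg, conv_approxDelta_eq_sum hε hg', Finset.sum_mul_sum]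
  simp only [hR]
  rw [integral_finsetSum _ fun i _ => integrable_finsetSum _ fun j _ => hint i j]
  refine Finset.sum_congr rfl fun i _ => ?_
  rw [integral_finsetSum _ fun j _ => hint i j]
  refine Finset.sum_congr rfl fun j _ => ?_
  have e1 : kernGrad ε i j = (kernGrad ε j i : EuclideanSpace ℝ (Fin d) → ℝ) :=
    funext (kernGrad_comm ε i j)
  -- Moving `∂_j` (left) or `∂_i` (right) off the first factor leaves `kern ε i` against `kernHess ε
  -- j i j` and `kernHess ε j j i` respectively. These agree by symmetry of the third derivatives of
  -- the potential.
  conv_lhs => enter [2, x, 2]; rw [e1]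
  rw [integral_conv_kernGrad_mul hε hd i j j i hg hg' hgs hgs',
    integral_conv_kernGrad_mul hε hd i i j j hg hg' hgs hgs', funext (kernHess_swap ε j i j)]

/-- Decay of the second derivatives of the potential of a function of mean value zero. -/
theorem norm_conv_kernGrad_le {ε ρ : ℝ} (hε : 0 < ε) (hρ : 0 < ρ) (i j : Fin d)
    {g : EuclideanSpace ℝ (Fin d) → ℂ} (hg : Integrable g) {x₀ : EuclideanSpace ℝ (Fin d)}
    (hgs : ∀ y, y ∉ Metric.ball x₀ ρ → g y = 0) (hg0 : ∫ y, g y = 0)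
    {x : EuclideanSpace ℝ (Fin d)} (hx : 2 * ρ ≤ ‖x - x₀‖) :
    ‖conv (kernGrad ε i j) g x‖ ≤
      d * (d * (d + 5) * (2 / ‖x - x₀‖) ^ (d + 1)) * ρ * ∫ y, ‖g y‖ := by
  have hX : 0 < ‖x - x₀‖ := by linarith
  -- As `g` has mean value zero, the constant `kernGrad ε i j (x - x₀)` can be subtracted from the
  -- kernel. The mean value inequality then gains one order of decay.
  have e : conv (kernGrad ε i j) g x =
      ∫ y, (kernGrad ε i j (x - y) - kernGrad ε i j (x - x₀)) • g y := by
    simp only [sub_smul]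
    rw [integral_sub (g := fun y => kernGrad ε i j (x - x₀) • g y)
      (integrable_kernel_smul (contDiff_kernGrad hε i j).continuous
      (kernGrad_bdd hε i j) hg x) (hg.smul (kernGrad ε i j (x - x₀))), integral_smul, hg0, smul_zero, sub_zero]
    rfl
  rw [e, ← integral_const_mul]
  refine norm_integral_le_of_norm_le (hg.norm.const_mul _) (.of_forall fun y => ?_)
  by_cases hy : y ∈ Metric.ball x₀ ρ
  swap
  · simp [hgs y hy]
  have hy' : ‖y - x₀‖ < ρ := by simpa [dist_eq_norm] using hy
  rw [norm_smul]
  refine mul_le_mul_of_nonneg_right ?_ (norm_nonneg _)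
  have hb : ∀ z ∈ Metric.ball (x - x₀) ρ, ‖fderiv ℝ (kernGrad ε i j) z‖ ≤
      d * (d * (d + 5) * (2 / ‖x - x₀‖) ^ (d + 1)) := fun z hz => by
    have hz' : ‖z - (x - x₀)‖ < ρ := by simpa [dist_eq_norm] using hz
    -- The condition `2 ρ ≤ ‖x - x₀‖` keeps the whole ball of radius `ρ` around `x - x₀` at this
    -- distance from the singularity, which makes the bound uniform in `ε`.
    have hz2 : ‖x - x₀‖ / 2 ≤ ‖z‖ := by
      have := norm_sub_norm_le (x - x₀) z
      rw [norm_sub_rev (x - x₀) z] at this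
      linarith
    have hq := invBracket_le_inv_norm hε (by positivity) hz2
    rw [inv_div] at hq
    have := (invBracket_pos hε z).le
    refine (norm_fderiv_le_sum_partialDeriv _ z).trans ?_
    calc ∑ k, |partialDeriv k (kernGrad ε i j) z|
        ≤ ∑ _k : Fin d, d * (d + 5) * (2 / ‖x - x₀‖) ^ (d + 1) := by
          refine Finset.sum_le_sum fun k _ => ?_
          rw [partialDeriv_kernGrad hε]
          exact (abs_kernHess_le hε i j k z).trans (by gcongr)
      _ = _ := by simp
  have h1 := (convex_ball (x - x₀) ρ).norm_image_sub_le_of_norm_fderiv_le (𝕜 := ℝ)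
    (fun z _ => (contDiff_kernGrad hε i j).differentiable (by simp) z) hb
    (Metric.mem_ball_self hρ) (y := x - y) (by
      rw [Metric.mem_ball, dist_eq_norm, sub_sub_sub_cancel_left, norm_sub_rev]; exact hy')
  refine h1.trans ?_
  rw [sub_sub_sub_cancel_left, norm_sub_rev x₀ y]
  gcongr

end KernelConvolution

/-! ### Solenoidal fields are orthogonal to gradients. -/

section Orthogonality

open Filter Topology

variable {d : ℕ}

/-- It bounds the gradient `t (∇χ)(t x)` of a dilated cutoff by a multiple of `invBracket ε x`,
uniformly in `t`. -/
theorem invBracket_dilate_le {ε t : ℝ} (hε : 0 < ε) (ht : 0 < t) (ht1 : t ≤ 1)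
    (x : EuclideanSpace ℝ (Fin d)) : t * invBracket ε (t • x) ≤ invBracket ε x := by
  have h1 := Real.sqrt_pos.2 (bracket_pos hε x)
  have h2 := Real.sqrt_pos.2 (bracket_pos hε (t • x))
  rw [invBracket, invBracket, ← div_eq_mul_inv, div_le_iff₀ h2, inv_mul_eq_div, le_div_iff₀ h1,
    norm_smul, Real.norm_of_nonneg ht.le]
  refine Real.le_sqrt_of_sq_le ?_
  rw [mul_pow, Real.sq_sqrt (bracket_pos hε x).le, mul_pow]
  have : t ^ 2 ≤ 1 := pow_le_one₀ ht.le ht1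
  nlinarith [sq_nonneg ε]

theorem continuous_partialDeriv {φ : EuclideanSpace ℝ (Fin d) → ℝ} (hφ : ContDiff ℝ ∞ φ)
    (i : Fin d) : Continuous (partialDeriv i φ) :=
  (hφ.continuous_fderiv (by simp)).clm_apply continuous_const

theorem memLp_apply {ι : Type*} [Fintype ι] {f : EuclideanSpace ℝ (Fin d) → EuclideanSpace ℂ ι}
    (hf : MemLp f 2 volume) (i : ι) : MemLp (fun x => f x i) 2 volume := hf.eval_piLp i

theorem memLp_invBracket_pow {ε : ℝ} (hε : 0 < ε) {n : ℕ} (hn : d < 2 * n) :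
    MemLp (fun x : EuclideanSpace ℝ (Fin d) => invBracket ε x ^ n) 2 volume :=
  memLp_two_of_bound hε (C := 1) hn ((contDiff_invBracket hε).continuous.pow n).aestronglyMeasurable
    fun x => by
      rw [Real.norm_of_nonneg (pow_nonneg (invBracket_pos hε x).le _), one_mul]

/-- A solenoidal field is orthogonal to gradients of decaying potentials. -/
theorem IsL2Sigma.integral_grad_eq_zero {f : Field d} (hf : IsL2Sigma f) (hd : 1 ≤ d)
    {ψ : EuclideanSpace ℝ (Fin d) → ℝ} (hψ : ContDiff ℝ ∞ ψ) {ε C C' : ℝ} (hε : 0 < ε)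
    (hC : ∀ x, |ψ x| ≤ C * invBracket ε x ^ (d - 1))
    (hC' : ∀ i x, |partialDeriv i ψ x| ≤ C' * invBracket ε x ^ d) :
    ∫ x, ∑ i, partialDeriv i ψ x • f x i = 0 := by
  obtain ⟨χ, hχ, hχc, hχ1⟩ := exists_cutoff (d := d) 1 one_pos
  obtain ⟨A, hA⟩ := hχ.continuous.bounded_above_of_compact_support hχc
  have hB : ∀ i : Fin d, ∃ B, ∀ x, |partialDeriv i χ x| ≤ B * invBracket ε x := fun i => by
    have hc : Continuous fun x => partialDeriv i χ x * (invBracket ε x)⁻¹ :=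
      (continuous_partialDeriv hχ i).mul
        ((contDiff_invBracket hε).continuous.inv₀ fun x => (invBracket_pos hε x).ne')
    have hs : HasCompactSupport fun x => partialDeriv i χ x * (invBracket ε x)⁻¹ :=
      (hχc.fderiv_apply (𝕜 := ℝ) (EuclideanSpace.single i (1 : ℝ))).mul_right
    obtain ⟨B, hB⟩ := hc.bounded_above_of_compact_support hs
    refine ⟨B, fun x => ?_⟩
    have h1 := hB x
    have h2 := invBracket_pos hε x
    rwa [norm_mul, norm_inv, Real.norm_of_nonneg h2.le, ← div_eq_mul_inv, div_le_iff₀ h2] at h1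
  choose B hB using hB
  let t : ℕ → ℝ := fun n => ((n : ℝ) + 1)⁻¹
  have ht : ∀ n, 0 < t n := fun n => by positivity
  have ht1 : ∀ n, t n ≤ 1 := fun n => inv_le_one_of_one_le₀ (by simp)
  have hχn : ∀ n, ContDiff ℝ ∞ fun x => χ (t n • x) := fun n =>
    hχ.comp (contDiff_const_smul _)
  have hχnc : ∀ n, HasCompactSupport fun x => χ (t n • x) := fun n =>
    hχc.comp_homeomorph (Homeomorph.smulOfNeZero (t n) (ht n).ne')
  have hdχ : ∀ n i x, partialDeriv i (fun x => χ (t n • x)) x =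
      t n * partialDeriv i χ (t n • x) := fun n i x => by
    have h2 : HasFDerivAt (fun x : EuclideanSpace ℝ (Fin d) => t n • x)
      (t n • ContinuousLinearMap.id ℝ _) x := (hasFDerivAt_id x).const_smul (t n)
    have h3 : HasFDerivAt (fun x => χ (t n • x)) _ x :=
      (hχ.differentiable (by simp) (t n • x)).hasFDerivAt.comp x h2
    rw [partialDeriv, h3.fderiv]
    simp [partialDeriv]
  have hz : ∀ n, ∫ x, ∑ i, partialDeriv i (fun x => ψ x * χ (t n • x)) x • f x i = 0 := fun n =>
    hf.div_eq_zero _ (hψ.mul (hχn n)) (hχnc n).mul_left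
  have hlim : Tendsto (fun n => ∫ x, ∑ i, partialDeriv i (fun x => ψ x * χ (t n • x)) x • f x i)
      atTop (𝓝 (∫ x, ∑ i, partialDeriv i ψ x • f x i)) := by
    -- Both parts of `∂_i (ψ χ(t x))` are bounded by a multiple of `invBracket ε x ^ d`: in one part
    -- `ψ` of order `d - 1` meets the cutoff gradient of order one. This weight is in `L²`, hence
    -- integrable against `f`.
    refine tendsto_integral_of_dominated_convergence
      (fun x => ∑ i, (C * B i + C' * A) * (invBracket ε x ^ d * ‖f x i‖)) (fun n => ?_) ?_
      (fun n => .of_forall fun x => ?_) (.of_forall fun x => ?_)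
    · refine Finset.aestronglyMeasurable_fun_sum _ fun i _ => ?_
      exact (continuous_partialDeriv (hψ.mul (hχn n)) i).aestronglyMeasurable.smul
        (memLp_apply hf.memLp i).aestronglyMeasurable
    · refine integrable_finsetSum _ fun i _ => Integrable.const_mul ?_ _
      exact (memLp_invBracket_pow hε (by omega)).integrable_mul (memLp_apply hf.memLp i).norm
    · refine (norm_sum_le _ _).trans (Finset.sum_le_sum fun i _ => ?_)
      rw [norm_smul, ← mul_assoc]
      refine mul_le_mul_of_nonneg_right ?_ (norm_nonneg _)
      rw [partialDeriv_mul hψ (hχn n), hdχ]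
      have hq := invBracket_pos hε x
      have h1 : |t n * partialDeriv i χ (t n • x)| ≤ B i * invBracket ε x := by
        rw [abs_mul, abs_of_pos (ht n)]
        have hB0 : 0 ≤ B i := nonneg_of_mul_nonneg_left ((abs_nonneg _).trans (hB i 0))
          (invBracket_pos hε 0)
        calc t n * |partialDeriv i χ (t n • x)| ≤ t n * (B i * invBracket ε (t n • x)) :=
              mul_le_mul_of_nonneg_left (hB i _) (ht n).le
          _ = B i * (t n * invBracket ε (t n • x)) := by ring
          _ ≤ _ := mul_le_mul_of_nonneg_left (invBracket_dilate_le hε (ht n) (ht1 n) x) hB0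
      have h2 : invBracket ε x ^ d = invBracket ε x ^ (d - 1) * invBracket ε x := by
        rw [← pow_succ, Nat.sub_add_cancel hd]
      rw [Real.norm_eq_abs]
      refine (abs_add_le _ _).trans ?_
      rw [abs_mul (ψ x), abs_mul (partialDeriv i ψ x), add_mul]
      refine add_le_add ?_ ?_
      · calc |ψ x| * |t n * partialDeriv i χ (t n • x)|
            ≤ (C * invBracket ε x ^ (d - 1)) * (B i * invBracket ε x) :=
              mul_le_mul (hC x) h1 (abs_nonneg _) ((abs_nonneg _).trans (hC x))
          _ = C * B i * invBracket ε x ^ d := by rw [h2]; ring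
      · calc |partialDeriv i ψ x| * |χ (t n • x)| ≤ (C' * invBracket ε x ^ d) * A :=
              mul_le_mul (hC' i x) (hA _) (abs_nonneg _) ((abs_nonneg _).trans (hC' i x))
          _ = C' * A * invBracket ε x ^ d := by ring
    · refine tendsto_const_nhds.congr' ?_
      obtain ⟨N, hN⟩ := exists_nat_gt ‖x‖
      filter_upwards [eventually_ge_atTop N] with n hn
      have hx : ‖t n • x‖ < 1 := by
        have hn' : (N : ℝ) ≤ n := by exact_mod_cast hn
        rw [norm_smul, Real.norm_of_nonneg (ht n).le, inv_mul_lt_iff₀ (by positivity)]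
        linarith
      have h1 := hχ1 _ hx
      refine Finset.sum_congr rfl fun i _ => ?_
      have h3 : partialDeriv i χ (t n • x) = 0 := by
        rw [partialDeriv, h1.fderiv_eq]; simp
      rw [partialDeriv_mul hψ (hχn n), hdχ, h3, h1.self_of_nhds]
      simp
  simp only [hz] at hlim
  exact (tendsto_nhds_unique hlim tendsto_const_nhds)

/-- Solenoidality is tested with real functions, so a complex potential is split into its real and
imaginary parts. -/
theorem IsL2Sigma.integral_conj_grad_eq_zero {f : Field d} (hf : IsL2Sigma f) (hd : 1 ≤ d)
    {ψ : EuclideanSpace ℝ (Fin d) → ℂ} (hψ : ContDiff ℝ ∞ ψ) {w : Field d} {ε C C' : ℝ}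
    (hε : 0 < ε) (hw : ∀ i x, fderiv ℝ ψ x (EuclideanSpace.single i 1) = w x i)
    (hC : ∀ x, ‖ψ x‖ ≤ C * invBracket ε x ^ (d - 1))
    (hC' : ∀ i x, ‖w x i‖ ≤ C' * invBracket ε x ^ d) :
    ∫ x, ∑ i, f x i * conj (w x i) = 0 := by
  have hre : ContDiff ℝ ∞ fun x => (ψ x).re := Complex.reCLM.contDiff.comp hψ
  have him : ContDiff ℝ ∞ fun x => (ψ x).im := Complex.imCLM.contDiff.comp hψ
  have dre : ∀ i x, partialDeriv i (fun x => (ψ x).re) x = (w x i).re := fun i x => by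
    have h3 : HasFDerivAt (fun x => (ψ x).re) _ x :=
      Complex.reCLM.hasFDerivAt.comp x (hψ.differentiable (by simp) x).hasFDerivAt
    rw [partialDeriv, h3.fderiv]; simp [hw]
  have dim : ∀ i x, partialDeriv i (fun x => (ψ x).im) x = (w x i).im := fun i x => by
    have h3 : HasFDerivAt (fun x => (ψ x).im) _ x :=
      Complex.imCLM.hasFDerivAt.comp x (hψ.differentiable (by simp) x).hasFDerivAt
    rw [partialDeriv, h3.fderiv]; simp [hw]
  have e1 := hf.integral_grad_eq_zero hd hre hε (C := C) (C' := C')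
    (fun x => (Complex.abs_re_le_norm _).trans (hC x))
    (fun i x => by rw [dre]; exact (Complex.abs_re_le_norm _).trans (hC' i x))
  have e2 := hf.integral_grad_eq_zero hd him hε (C := C) (C' := C')
    (fun x => (Complex.abs_im_le_norm _).trans (hC x))
    (fun i x => by rw [dim]; exact (Complex.abs_im_le_norm _).trans (hC' i x))
  have hint : ∀ (φ : EuclideanSpace ℝ (Fin d) → ℝ), ContDiff ℝ ∞ φ →
      (∀ i x, |partialDeriv i φ x| ≤ C' * invBracket ε x ^ d) →
      Integrable fun x => ∑ i, partialDeriv i φ x • f x i := fun φ hφ hb => by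
    refine integrable_finsetSum _ fun i _ => ?_
    exact memLp_one_iff_integrable.1 ((memLp_apply hf.memLp i).smul
      (memLp_two_of_bound hε (by omega) (continuous_partialDeriv hφ i).aestronglyMeasurable (hb i)))
  have hsplit : ∀ x, ∑ i, f x i * conj (w x i) =
      (∑ i, partialDeriv i (fun x => (ψ x).re) x • f x i) -
        Complex.I * ∑ i, partialDeriv i (fun x => (ψ x).im) x • f x i := fun x => by
    rw [Finset.mul_sum, ← Finset.sum_sub_distrib]
    refine Finset.sum_congr rfl fun i _ => ?_
    have : conj (w x i) = (w x i).re - Complex.I * (w x i).im := by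
      apply Complex.ext <;> simp
    rw [dre, dim, this, Complex.real_smul, Complex.real_smul]
    ring
  simp only [hsplit]
  rw [integral_sub, integral_const_mul, e1, e2, mul_zero, sub_zero]
  · exact hint _ hre fun i x => by rw [dre]; exact (Complex.abs_re_le_norm _).trans (hC' i x)
  · exact (hint _ him fun i x => by
      rw [dim]; exact (Complex.abs_im_le_norm _).trans (hC' i x)).const_mul _

/-- The `H¹` solenoidal fields are distributionally solenoidal. -/
theorem IsH1Sigma.isL2Sigma {u : Field d} {Du : MatField d} (hu : IsH1Sigma u Du) :
    IsL2Sigma u where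
  memLp := hu.memLp
  div_eq_zero φ hφ hc := by
    have h1 : ∀ {ψ : EuclideanSpace ℝ (Fin d) → ℝ}, Continuous ψ → HasCompactSupport ψ →
        ∀ {h : EuclideanSpace ℝ (Fin d) → ℂ}, MemLp h 2 volume →
        Integrable fun x => ψ x • h x := fun hψ hψc h hh =>
      memLp_one_iff_integrable.1 (hh.smul (hψ.memLp_of_hasCompactSupport (p := 2) hψc))
    have hD : ∀ i : Fin d, MemLp (fun x => Du x (i, i)) 2 volume := fun i =>
      memLp_apply hu.grad_memLp (i, i)
    rw [integral_finsetSum _ fun i _ => h1 (continuous_partialDeriv hφ i)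
      (hc.fderiv_apply (𝕜 := ℝ) _) (memLp_apply hu.memLp i)]
    simp only [hu.weakDeriv _ _ φ hφ hc]
    rw [Finset.sum_neg_distrib, ← integral_finsetSum _ fun i _ => h1 hφ.continuous hc (hD i),
      neg_eq_zero]
    refine integral_eq_zero_of_ae ?_
    filter_upwards [hu.div_eq_zero] with x hx
    rw [← Finset.smul_sum, hx, smul_zero, Pi.zero_apply]

end Orthogonality

/-! ### The solenoidal corrector and its uniform bounds. -/

section Corrector

open Filter Topology

variable {d : ℕ}

/-- Componentwise regularisation. -/
noncomputable def mollify {ι : Type*} (ε : ℝ)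
    (v : EuclideanSpace ℝ (Fin d) → EuclideanSpace ℂ ι) (x : EuclideanSpace ℝ (Fin d)) :
    EuclideanSpace ℂ ι :=
  WithLp.toLp 2 fun i => conv (approxDelta ε) (fun y => v y i) x

/-- The trace of a matrix field. -/
noncomputable def traceField (D : MatField d) (x : EuclideanSpace ℝ (Fin d)) : ℂ :=
  ∑ i, D x (i, i)

/-- The regularised Newtonian potential of the divergence of `v`. -/
noncomputable def potential (ε : ℝ) (v : Field d) (x : EuclideanSpace ℝ (Fin d)) : ℂ :=
  ∑ i, conv (kern ε i) (fun y => v y i) x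

/-- The gradient of the regularised Newtonian potential of `g`. -/
noncomputable def potentialGrad (ε : ℝ) (g : EuclideanSpace ℝ (Fin d) → ℂ) : Field d :=
  fun x => WithLp.toLp 2 fun i => conv (kern ε i) g x

/-- The second derivatives of the regularised Newtonian potential of `g`. -/
noncomputable def potentialHess (ε : ℝ) (g : EuclideanSpace ℝ (Fin d) → ℂ) : MatField d :=
  fun x => WithLp.toLp 2 fun p => conv (kernGrad ε p.2 p.1) g x

theorem integrable_apply_of_memLp {ι : Type*} [Fintype ι] {R : ℝ}
    {f : EuclideanSpace ℝ (Fin d) → EuclideanSpace ℂ ι}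
    (hf : MemLp f 2 volume) (hs : ∀ y, R ≤ ‖y‖ → f y = 0) (i : ι) :
    Integrable fun x => f x i :=
  integrable_of_memLp_two (x₀ := 0) (R := R) (memLp_apply hf i) fun y hy => by
    rw [hs y (by simpa using hy)]; rfl

theorem memLp_mollify {ι : Type*} [Fintype ι] {ε R : ℝ} (hε : 0 < ε)
    {f : EuclideanSpace ℝ (Fin d) → EuclideanSpace ℂ ι}
    (hf : MemLp f 2 volume) (hs : ∀ y, R ≤ ‖y‖ → f y = 0) : MemLp (mollify ε f) 2 volume := by
  refine memLp_piLp_iff.2 fun i => ?_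
  have hi := integrable_apply_of_memLp hf hs i
  obtain ⟨C, hC⟩ := norm_conv_le hε (abs_approxDelta_le hε) hi
    (fun y hy => by rw [hs y hy]; rfl)
  exact memLp_two_of_bound hε (by omega)
    (continuous_conv (contDiff_approxDelta hε).continuous
      (bounded_of_le_invBracket hε (abs_approxDelta_le hε)) hi).aestronglyMeasurable hC

theorem IsH1.mollify {v : Field d} {Dv : MatField d} (hv : IsH1 v Dv) {ε R : ℝ} (hε : 0 < ε)
    (hR : 0 < R) (hvs : ∀ y, R ≤ ‖y‖ → v y = 0) (hDs : ∀ y, R ≤ ‖y‖ → Dv y = 0) :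
    IsH1 (mollify ε v) (StokesCaccioppoli.mollify ε Dv) where
  memLp := memLp_mollify hε hv.memLp hvs
  grad_memLp := memLp_mollify hε hv.grad_memLp hDs
  weakDeriv α i := by
    have h1 := hasFDerivAt_conv_approxDelta hε (integrable_apply_of_memLp hv.memLp hvs i)
    have h2 := (hv.weakDeriv α i).conv_eq hR (fun y hy => by rw [hvs y hy]; rfl)
      (fun y hy => by rw [hDs y hy]; rfl) (contDiff_approxDelta hε)
    exact hasWeakPartialDeriv_of_fderiv (fun x => (h1 x).1)
      (continuous_conv (contDiff_approxDelta hε).continuous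
        (bounded_of_le_invBracket hε (abs_approxDelta_le hε))
        (integrable_apply_of_memLp hv.grad_memLp hDs (α, i)))
      fun x => ((h1 x).2 α).trans (h2 x)

theorem IsH1.sub {u v : Field d} {Du Dv : MatField d} (hu : IsH1 u Du) (hv : IsH1 v Dv) :
    IsH1 (fun x => u x - v x) (fun x => Du x - Dv x) where
  memLp := hu.memLp.sub hv.memLp
  grad_memLp := hu.grad_memLp.sub hv.grad_memLp
  weakDeriv α i := fun φ hφ hc => by
    have h1 : ∀ {ψ : EuclideanSpace ℝ (Fin d) → ℝ}, Continuous ψ → HasCompactSupport ψ →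
        ∀ {h : EuclideanSpace ℝ (Fin d) → ℂ}, MemLp h 2 volume →
        Integrable fun x => ψ x • h x := fun hψ hψc h hh =>
      memLp_one_iff_integrable.1 (hh.smul (hψ.memLp_of_hasCompactSupport (p := 2) hψc))
    simp only [PiLp.sub_apply, smul_sub]
    rw [integral_sub (h1 (continuous_partialDeriv hφ α) (hc.fderiv_apply (𝕜 := ℝ) _)
      (memLp_apply hu.memLp i)) (h1 (continuous_partialDeriv hφ α) (hc.fderiv_apply (𝕜 := ℝ) _)
      (memLp_apply hv.memLp i)), integral_sub (h1 hφ.continuous hc (memLp_apply hu.grad_memLp _))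
      (h1 hφ.continuous hc (memLp_apply hv.grad_memLp _)), hu.weakDeriv α i φ hφ hc,
      hv.weakDeriv α i φ hφ hc]
    ring

theorem memLp_traceField {D : MatField d} (hD : MemLp D 2 volume) :
    MemLp (traceField D) 2 volume :=
  memLp_finsetSum _ fun i _ => memLp_apply hD (i, i)

/-- The derivative may fall on the kernel or on `v`. The second form shows that `potentialGrad` of
`div v` is a gradient; the first shows its decay. -/
theorem fderiv_potential {v : Field d} {Dv : MatField d} (hv : IsH1 v Dv) {ε R : ℝ} (hε : 0 < ε)
    (hd : 1 ≤ d) (hR : 0 < R) (hvs : ∀ y, R ≤ ‖y‖ → v y = 0) (hDs : ∀ y, R ≤ ‖y‖ → Dv y = 0)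
    (x : EuclideanSpace ℝ (Fin d)) (α : Fin d) :
    fderiv ℝ (potential ε v) x (EuclideanSpace.single α 1) =
        ∑ i, conv (kernGrad ε i α) (fun y => v y i) x ∧
      ∑ i, conv (kernGrad ε i α) (fun y => v y i) x = conv (kern ε α) (traceField Dv) x := by
  have hi := integrable_apply_of_memLp hv.memLp hvs
  have h1 := fun i x => hasFDerivAt_conv_kern hε hd i (hi i) x
  constructor
  · unfold potential
    rw [fderiv_fun_sum fun i _ => (h1 i x).1, sum_apply]
    exact Finset.sum_congr rfl fun i _ => (h1 i x).2 α
  · unfold traceField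
    rw [conv_sum_right (contDiff_kern hε α).continuous (kern_bdd hε hd α)
      fun i => integrable_apply_of_memLp hv.grad_memLp hDs (i, i)]
    refine Finset.sum_congr rfl fun i _ => ?_
    rw [funext (kernGrad_comm ε i α), ← partialDeriv_kern' hε]
    exact (hv.weakDeriv i i).conv_eq hR (fun y hy => by rw [hvs y hy]; rfl)
      (fun y hy => by rw [hDs y hy]; rfl) (contDiff_kern hε α) x

theorem integral_traceField_eq_zero {v : Field d} {Dv : MatField d} (hv : IsH1 v Dv) {R : ℝ}
    (hR : 0 < R) (hvs : ∀ y, R ≤ ‖y‖ → v y = 0) (hDs : ∀ y, R ≤ ‖y‖ → Dv y = 0) :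
    ∫ x, traceField Dv x = 0 := by
  unfold traceField
  rw [integral_finsetSum _ fun i _ => integrable_apply_of_memLp hv.grad_memLp hDs (i, i)]
  refine Finset.sum_eq_zero fun i _ => ?_
  have := (hv.weakDeriv i i).integral_eq hR (fun y hy => by rw [hvs y hy]; rfl)
      (fun y hy => by rw [hDs y hy]; rfl) (φ := fun _ => 1) contDiff_const
  simpa [partialDeriv] using this

/-- Since the density is a divergence, the decay has order `d` instead of the order `d - 1` of
`kern`. The latter would not give square integrability when `d = 2`. -/
theorem norm_potentialGrad_le {v : Field d} {Dv : MatField d} (hv : IsH1 v Dv) {ε R : ℝ}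
    (hε : 0 < ε) (hd : 1 ≤ d) (hR : 0 < R) (hvs : ∀ y, R ≤ ‖y‖ → v y = 0)
    (hDs : ∀ y, R ≤ ‖y‖ → Dv y = 0) :
    ∃ C, ∀ α x, ‖potentialGrad ε (traceField Dv) x α‖ ≤ C * invBracket ε x ^ d := by
  have hi := integrable_apply_of_memLp hv.memLp hvs
  have h1 : ∀ α i, ∃ C, ∀ x, ‖conv (kernGrad ε i α) (fun y => v y i) x‖ ≤
      C * invBracket ε x ^ d := fun α i =>
    norm_conv_le hε (abs_kernGrad_le hε i α) (hi i) (fun y hy => by rw [hvs y hy]; rfl)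
  choose C hC using h1
  refine ⟨∑ α, ∑ i, |C α i|, fun α x => ?_⟩
  have hq := pow_pos (invBracket_pos hε x) d
  have e : potentialGrad ε (traceField Dv) x α =
      ∑ i, conv (kernGrad ε i α) (fun y => v y i) x :=
    (fderiv_potential hv hε hd hR hvs hDs x α).2.symm
  rw [e]
  calc _ ≤ ∑ i, ‖conv (kernGrad ε i α) (fun y => v y i) x‖ := norm_sum_le _ _
    _ ≤ ∑ i, |C α i| * invBracket ε x ^ d := Finset.sum_le_sum fun i _ =>
        (hC α i x).trans (mul_le_mul_of_nonneg_right (le_abs_self _) hq.le)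
    _ = (∑ i, |C α i|) * invBracket ε x ^ d := by rw [Finset.sum_mul]
    _ ≤ _ := mul_le_mul_of_nonneg_right (Finset.single_le_sum (f := fun α => ∑ i, |C α i|)
        (fun α _ => Finset.sum_nonneg fun i _ => abs_nonneg _) (Finset.mem_univ α)) hq.le

theorem traceField_eq_zero {D : MatField d} {y : EuclideanSpace ℝ (Fin d)} (h : D y = 0) :
    traceField D y = 0 := by simp [traceField, h]

theorem integrable_traceField {D : MatField d} {R : ℝ} (hD : MemLp D 2 volume)
    (hs : ∀ y, R ≤ ‖y‖ → D y = 0) : Integrable (traceField D) :=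
  integrable_finsetSum _ fun i _ => integrable_apply_of_memLp hD hs (i, i)

theorem isH1_potentialGrad {v : Field d} {Dv : MatField d} (hv : IsH1 v Dv) {ε R : ℝ}
    (hε : 0 < ε) (hd : 1 ≤ d) (hR : 0 < R) (hvs : ∀ y, R ≤ ‖y‖ → v y = 0)
    (hDs : ∀ y, R ≤ ‖y‖ → Dv y = 0) :
    IsH1 (potentialGrad ε (traceField Dv)) (potentialHess ε (traceField Dv)) := by
  have hg := integrable_traceField hv.grad_memLp hDs
  have c1 := fun i => continuous_conv (contDiff_kern hε i).continuous (kern_bdd hε hd i) hg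
  have c2 := fun i j =>
    continuous_conv (contDiff_kernGrad hε i j).continuous (kernGrad_bdd hε i j) hg
  obtain ⟨C, hC⟩ := norm_potentialGrad_le hv hε hd hR hvs hDs
  refine ⟨memLp_piLp_iff.2 fun i => ?_, memLp_piLp_iff.2 fun p => ?_, fun α i => ?_⟩
  · exact memLp_two_of_bound hε (by omega) (c1 i).aestronglyMeasurable (hC i)
  · obtain ⟨C', hC'⟩ := norm_conv_le hε (abs_kernGrad_le hε p.2 p.1) hg
      (fun y hy => traceField_eq_zero (hDs y hy))
    exact memLp_two_of_bound hε (by omega) (c2 p.2 p.1).aestronglyMeasurable hC'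
  · have h1 := fun x => hasFDerivAt_conv_kern hε hd i hg x
    exact hasWeakPartialDeriv_of_fderiv (fun x => (h1 x).1) (c2 i α) fun x => (h1 x).2 α

/-- Both fields have the divergence `approxDelta ε * div v`: the first because mollification
commutes with derivatives, the second by `sum_kernGrad`. -/
theorem isH1Sigma_mollify_sub {v : Field d} {Dv : MatField d} (hv : IsH1 v Dv) {ε R : ℝ}
    (hε : 0 < ε) (hd : 1 ≤ d) (hR : 0 < R) (hvs : ∀ y, R ≤ ‖y‖ → v y = 0)
    (hDs : ∀ y, R ≤ ‖y‖ → Dv y = 0) :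
    IsH1Sigma (fun x => mollify ε v x - potentialGrad ε (traceField Dv) x)
      (fun x => mollify ε Dv x - potentialHess ε (traceField Dv) x) where
  toIsH1 := (hv.mollify hε hR hvs hDs).sub (isH1_potentialGrad hv hε hd hR hvs hDs)
  div_eq_zero := .of_forall fun x => by
    have hi := fun i : Fin d => integrable_apply_of_memLp hv.grad_memLp hDs (i, i)
    simp only [PiLp.sub_apply, Finset.sum_sub_distrib]
    rw [sub_eq_zero]
    have h1 := conv_approxDelta_eq_sum hε (integrable_traceField hv.grad_memLp hDs) x
    have h2 := conv_sum_right (contDiff_approxDelta hε).continuous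
      (bounded_of_le_invBracket hε (abs_approxDelta_le hε)) hi x
    exact h2.symm.trans h1

theorem integral_conj_potentialGrad {v : Field d} {Dv : MatField d} (hv : IsH1 v Dv) {ε R : ℝ}
    (hε : 0 < ε) (hd : 1 ≤ d) (hR : 0 < R) (hvs : ∀ y, R ≤ ‖y‖ → v y = 0)
    (hDs : ∀ y, R ≤ ‖y‖ → Dv y = 0) {f : Field d} (hf : IsL2Sigma f) :
    ∫ x, ∑ i, f x i * conj (potentialGrad ε (traceField Dv) x i) = 0 := by
  have hi := integrable_apply_of_memLp hv.memLp hvs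
  obtain ⟨C', hC'⟩ := norm_potentialGrad_le hv hε hd hR hvs hDs
  have h1 : ∀ i, ∃ C, ∀ x, ‖conv (kern ε i) (fun y => v y i) x‖ ≤
      C * invBracket ε x ^ (d - 1) := fun i =>
    norm_conv_le hε (C := 1) (by simpa using abs_kern_le hε hd i) (hi i)
      (fun y hy => by rw [hvs y hy]; rfl)
  choose C hC using h1
  refine hf.integral_conj_grad_eq_zero hd (ψ := potential ε v) (C := ∑ i, C i) (C' := C')
    (ContDiff.sum fun i _ => contDiff_conv (contDiff_kern hε i) (hi i) hR
      (fun y hy => by rw [hvs y hy]; rfl)) hε (fun i x => ?_) (fun x => ?_) hC'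
  · obtain ⟨e1, e2⟩ := fderiv_potential hv hε hd hR hvs hDs x i
    exact e1.trans e2
  · rw [Finset.sum_mul]
    exact (norm_sum_le _ _).trans (Finset.sum_le_sum fun i _ => hC i x)

theorem norm_sq_euclidean {ι : Type*} [Fintype ι] (z : EuclideanSpace ℂ ι) :
    ‖z‖ ^ 2 = ∑ i, ‖z i‖ ^ 2 := EuclideanSpace.norm_sq_eq z

/-- The full Hessian has the `L²` norm of the Laplacian, which is a mollification of `div v`. The
bound does not depend on `ε`. -/
theorem integral_norm_sq_potentialHess_le {v : Field d} {Dv : MatField d} (hv : IsH1 v Dv)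
    {ε R : ℝ} (hε : 0 < ε) (hd : 2 ≤ d) (hR : 0 < R) (hvs : ∀ y, R ≤ ‖y‖ → v y = 0)
    (hDs : ∀ y, R ≤ ‖y‖ → Dv y = 0) :
    ∫ x, ‖potentialHess ε (traceField Dv) x‖ ^ 2 ≤
      deltaMass d ^ 2 * ∫ x, ‖traceField Dv x‖ ^ 2 := by
  have hH := (isH1_potentialGrad hv hε (by omega) hR hvs hDs).grad_memLp
  have hg := integrable_traceField hv.grad_memLp hDs
  have hgs : ∀ y, R ≤ ‖y‖ → traceField Dv y = 0 := fun y hy => traceField_eq_zero (hDs y hy)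
  obtain ⟨C, hC⟩ := norm_conv_le hε (abs_approxDelta_le hε) hg hgs
  have hc : MemLp (conv (approxDelta ε) (traceField Dv)) 2 volume :=
    memLp_two_of_bound hε (by omega)
      (continuous_conv (contDiff_approxDelta hε).continuous
        (bounded_of_le_invBracket hε (abs_approxDelta_le hε)) hg).aestronglyMeasurable hC
  refine le_trans (le_of_eq ?_) (integral_norm_sq_conv_le hε (memLp_traceField hv.grad_memLp) hc)
  rw [← sum_integral_norm_sq_conv_kernGrad hε hd hg hgs]
  simp only [norm_sq_euclidean]
  rw [integral_finsetSum _ fun p _ =>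
    (memLp_two_iff_integrable_sq_norm (memLp_apply hH p).1).1 (memLp_apply hH p),
    Fintype.sum_prod_type_right]
  rfl

/-- The Cauchy–Schwarz inequality, obtained by expanding the nonnegative integral of `(m ‖g‖ - I)²`
over the ball, where `m` is its volume and `I = ∫ ‖g‖`. -/
theorem sq_integral_norm_le {F : Type*} [NormedAddCommGroup F]
    {g : EuclideanSpace ℝ (Fin d) → F} {x₀ : EuclideanSpace ℝ (Fin d)} {ρ : ℝ} (hρ : 0 < ρ)
    (hg : MemLp g 2 volume) (hgs : ∀ y, y ∉ Metric.ball x₀ ρ → g y = 0) :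
    (∫ y, ‖g y‖) ^ 2 ≤ volume.real (Metric.ball x₀ ρ) * ∫ y, ‖g y‖ ^ 2 := by
  have hi := (integrable_of_memLp_two hg hgs).norm
  have hi2 := (memLp_two_iff_integrable_sq_norm hg.1).1 hg
  set m := volume.real (Metric.ball x₀ ρ)
  have hm : 0 < m := ENNReal.toReal_pos
    (Metric.measure_ball_pos volume x₀ hρ).ne' measure_ball_lt_top.ne
  set I := ∫ y, ‖g y‖
  have h0 : 0 ≤ ∫ y in Metric.ball x₀ ρ, (m * ‖g y‖ - I) ^ 2 :=
    setIntegral_nonneg measurableSet_ball fun y _ => sq_nonneg _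
  have e : ∀ y, (m * ‖g y‖ - I) ^ 2 = m ^ 2 * ‖g y‖ ^ 2 - 2 * m * I * ‖g y‖ + I ^ 2 :=
    fun y => by ring
  have hs1 : ∫ y in Metric.ball x₀ ρ, ‖g y‖ = I :=
    setIntegral_eq_integral_of_forall_compl_eq_zero fun y hy => by rw [hgs y hy, norm_zero]
  have hs2 : ∫ y in Metric.ball x₀ ρ, ‖g y‖ ^ 2 = ∫ y, ‖g y‖ ^ 2 :=
    setIntegral_eq_integral_of_forall_compl_eq_zero fun y hy => by simp [hgs y hy]
  simp only [e] at h0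
  have i1 : IntegrableOn (fun y => m ^ 2 * ‖g y‖ ^ 2 - 2 * m * I * ‖g y‖) (Metric.ball x₀ ρ) :=
    ((hi2.const_mul _).sub (hi.const_mul _)).integrableOn
  rw [integral_add i1
    (integrableOn_const measure_ball_lt_top.ne), integral_sub
    ((hi2.const_mul _).integrableOn) ((hi.const_mul _).integrableOn), integral_const_mul,
    integral_const_mul, hs1, hs2, setIntegral_const, smul_eq_mul] at h0
  have h1 : 0 ≤ m * (m * (∫ y, ‖g y‖ ^ 2) - I ^ 2) := by
    have : volume.real (Metric.ball x₀ ρ) = m := rfl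
    rw [this] at h0
    linarith
  have := nonneg_of_mul_nonneg_right h1 hm
  linarith

/-- The numerical constant in the decay estimate for `potentialHess`. -/
noncomputable def hessConst (d : ℕ) : ℝ := (d * (d * (d * (d + 5) * 2 ^ (d + 1)))) ^ 2

/-- The divergence of a boundedly supported field has mean value zero, so the improved decay of
`norm_conv_kernGrad_le` applies to every entry. -/
theorem norm_sq_potentialHess_le {v : Field d} {Dv : MatField d} (hv : IsH1 v Dv)
    {ε ρ : ℝ} (hε : 0 < ε) (hρ : 0 < ρ) {x₀ : EuclideanSpace ℝ (Fin d)}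
    (hvs : ∀ y, y ∉ Metric.ball x₀ ρ → v y = 0) (hDs : ∀ y, y ∉ Metric.ball x₀ ρ → Dv y = 0)
    {x : EuclideanSpace ℝ (Fin d)} (hx : 2 * ρ ≤ ‖x - x₀‖) :
    ‖potentialHess ε (traceField Dv) x‖ ^ 2 ≤
      hessConst d * ρ ^ 2 * (‖x - x₀‖⁻¹) ^ (2 * d + 2) *
        (volume.real (Metric.ball x₀ ρ) * ∫ y, ‖traceField Dv y‖ ^ 2) := by
  have hsub : ∀ y : EuclideanSpace ℝ (Fin d), ‖x₀‖ + ρ ≤ ‖y‖ → y ∉ Metric.ball x₀ ρ :=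
    fun y hy hm => by
      have h1 : ‖y - x₀‖ < ρ := by simpa [dist_eq_norm] using hm
      have := norm_sub_norm_le y x₀
      linarith
  have hR : 0 < ‖x₀‖ + ρ := by positivity
  have hX : 0 < ‖x - x₀‖ := by linarith
  have hg := integrable_traceField hv.grad_memLp fun y hy => hDs y (hsub y hy)
  have h0 := integral_traceField_eq_zero hv hR (fun y hy => hvs y (hsub y hy))
    fun y hy => hDs y (hsub y hy)
  have hgs : ∀ y, y ∉ Metric.ball x₀ ρ → traceField Dv y = 0 := fun y hy =>
    traceField_eq_zero (hDs y hy)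
  have h1 := fun i j : Fin d => norm_conv_kernGrad_le hε hρ i j hg hgs h0 hx
  rw [norm_sq_euclidean]
  calc ∑ p, ‖potentialHess ε (traceField Dv) x p‖ ^ 2
      ≤ ∑ _p : Fin d × Fin d, (d * (d * (d + 5) * (2 / ‖x - x₀‖) ^ (d + 1)) * ρ *
          ∫ y, ‖traceField Dv y‖) ^ 2 :=
        Finset.sum_le_sum fun p _ => pow_le_pow_left₀ (norm_nonneg _) (h1 p.2 p.1) 2
    _ = hessConst d * ρ ^ 2 * (‖x - x₀‖⁻¹) ^ (2 * d + 2) * (∫ y, ‖traceField Dv y‖) ^ 2 := by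
        simp [hessConst, div_eq_mul_inv, mul_pow, ← pow_mul]
        ring
    _ ≤ _ := mul_le_mul_of_nonneg_left
        (sq_integral_norm_le hρ (memLp_traceField hv.grad_memLp) hgs)
        (by unfold hessConst; positivity)

end Corrector

/-! ### Dyadic shells and weighted dyadic sums. -/

section Dyadic

variable {d : ℕ}

theorem tsum_ofReal_geometric {q : ℝ} (hq : 0 ≤ q) (hq1 : q < 1) :
    ∑' n : ℕ, ENNReal.ofReal (q ^ n) = ENNReal.ofReal (1 - q)⁻¹ := by
  rw [← ENNReal.ofReal_tsum_of_nonneg (fun n => pow_nonneg hq n)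
    (summable_geometric_of_lt_one hq hq1), tsum_geometric_of_lt_one hq hq1]

theorem two_rpow_neg_mul (s : ℝ) (n : ℕ) : (2 : ℝ) ^ (-(s * n)) = ((2 : ℝ) ^ (-s)) ^ n := by
  rw [← Real.rpow_mul_natCast (by norm_num)]; ring_nf

theorem two_rpow_neg_lt_one {s : ℝ} (hs : 0 < s) : (2 : ℝ) ^ (-s) < 1 :=
  Real.rpow_lt_one_of_one_lt_of_neg (by norm_num) (by linarith)

theorem enorm_sq_eq_ofReal {F : Type*} [NormedAddCommGroup F] (a : F) :
    ‖a‖ₑ ^ 2 = ENNReal.ofReal (‖a‖ ^ 2) := by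
  rw [← ofReal_norm, ENNReal.ofReal_pow (norm_nonneg _)]

theorem enorm_mul_enorm_le {F G : Type*} [NormedAddCommGroup F] [NormedAddCommGroup G]
    {t : ℝ} (ht : 0 < t) (a : F) (b : G) :
    ‖a‖ₑ * ‖b‖ₑ ≤ ENNReal.ofReal t * ‖b‖ₑ ^ 2 + ENNReal.ofReal t⁻¹ * ‖a‖ₑ ^ 2 := by
  rw [enorm_sq_eq_ofReal, enorm_sq_eq_ofReal, ← ofReal_norm, ← ofReal_norm,
    ← ENNReal.ofReal_mul (norm_nonneg _), ← ENNReal.ofReal_mul ht.le,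
    ← ENNReal.ofReal_mul (by positivity), ← ENNReal.ofReal_add (by positivity) (by positivity)]
  refine ENNReal.ofReal_le_ofReal ?_
  have h1 : ‖a‖ * ‖b‖ = (t * ‖b‖) * (t⁻¹ * ‖a‖) := by field_simp
  have h2 : t * ‖b‖ ^ 2 + t⁻¹ * ‖a‖ ^ 2 - ‖a‖ * ‖b‖ =
      t * ((‖b‖ - t⁻¹ * ‖a‖ / 2) ^ 2 + 3 / 4 * (t⁻¹ * ‖a‖) ^ 2) := by field_simp; ring
  have h3 : 0 ≤ t * ((‖b‖ - t⁻¹ * ‖a‖ / 2) ^ 2 + 3 / 4 * (t⁻¹ * ‖a‖) ^ 2) := by positivity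
  linarith

/-- The dyadic shells around `x₀`, the innermost one being the ball of radius `4 r`. -/
def shell (x₀ : EuclideanSpace ℝ (Fin d)) (r : ℝ) (n : ℕ) : Set (EuclideanSpace ℝ (Fin d)) :=
  {x | x ∈ Metric.ball x₀ (2 ^ (n + 2) * r) ∧ (1 ≤ n → x ∉ Metric.ball x₀ (2 ^ (n + 1) * r))}

theorem iUnion_shell (x₀ : EuclideanSpace ℝ (Fin d)) {r : ℝ} (hr : 0 < r) :
    ⋃ n, shell x₀ r n = Set.univ := by
  refine Set.eq_univ_of_forall fun x => Set.mem_iUnion.2 ?_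
  have hex : ∃ n : ℕ, x ∈ Metric.ball x₀ (2 ^ (n + 2) * r) := by
    obtain ⟨n, hn⟩ := pow_unbounded_of_one_lt (dist x x₀ / r) (one_lt_two (α := ℝ))
    refine ⟨n, Metric.mem_ball.2 (lt_of_lt_of_le ((div_lt_iff₀ hr).1 hn) ?_)⟩
    gcongr
    · norm_num
    · omega
  classical
  refine ⟨Nat.find hex, Nat.find_spec hex, fun h1 hx => ?_⟩
  refine Nat.find_min hex (m := Nat.find hex - 1) (by omega) ?_
  rwa [show Nat.find hex - 1 + 2 = Nat.find hex + 1 by omega]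

/-- Young's inequality is used on each shell with a weight proportional to `2^{-sn}`. The terms in
`W` reassemble a dyadic sum, and the terms in `H` leave a geometric series of ratio `2^{-(s'-s)}`.
-/
theorem lintegral_mul_le_dyadicSum {F G : Type*} [NormedAddCommGroup F] [NormedAddCommGroup G]
    {H : EuclideanSpace ℝ (Fin d) → F} {W : EuclideanSpace ℝ (Fin d) → G}
    (hW : AEStronglyMeasurable W volume)
    {s s' δ K : ℝ} (hss : s < s') (hδ : 0 < δ) (hK : 0 ≤ K)
    (x₀ : EuclideanSpace ℝ (Fin d)) {r : ℝ} (hr : 0 < r) {J : ℝ≥0∞}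
    (hJ : ∀ n, ∫⁻ x in shell x₀ r n, ‖H x‖ₑ ^ 2 ≤
      ENNReal.ofReal (K * (2 : ℝ) ^ (-(s' * n))) * J) :
    ∫⁻ x, ‖H x‖ₑ * ‖W x‖ₑ ≤ ENNReal.ofReal δ * dyadicSum s 0 x₀ r (fun _ x => ‖W x‖ₑ ^ 2) +
      ENNReal.ofReal (K * δ⁻¹ * 2 ^ (2 * s) * (1 - 2 ^ (-(s' - s)))⁻¹) * J := by
  -- The shift by two matches the outer radius `2^(n+2) r` of the shell; its price is the factor
  -- `2^(2s)`.
  let t : ℕ → ℝ := fun n => δ * (2 : ℝ) ^ (-(s * (n + 2 : ℕ)))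
  have ht : ∀ n, 0 < t n := fun n => by positivity
  have h1 : ∀ n, ∫⁻ x in shell x₀ r n, ‖H x‖ₑ * ‖W x‖ₑ ≤
      ENNReal.ofReal δ * (ENNReal.ofReal ((2 : ℝ) ^ (-(s * (n + 2 : ℕ)))) *
        ∫⁻ x in Metric.ball x₀ (2 ^ (n + 2 + 0) * r), ‖W x‖ₑ ^ 2) +
      ENNReal.ofReal (K * δ⁻¹ * 2 ^ (2 * s)) *
        (ENNReal.ofReal (((2 : ℝ) ^ (-(s' - s))) ^ n) * J) := fun n => by
    have hsub : shell x₀ r n ⊆ Metric.ball x₀ (2 ^ (n + 2 + 0) * r) := fun x hx => hx.1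
    calc ∫⁻ x in shell x₀ r n, ‖H x‖ₑ * ‖W x‖ₑ
        ≤ ∫⁻ x in shell x₀ r n, (ENNReal.ofReal (t n) * ‖W x‖ₑ ^ 2 +
            ENNReal.ofReal (t n)⁻¹ * ‖H x‖ₑ ^ 2) :=
          lintegral_mono fun x => enorm_mul_enorm_le (ht n) _ _
      _ = ENNReal.ofReal (t n) * (∫⁻ x in shell x₀ r n, ‖W x‖ₑ ^ 2) +
            ENNReal.ofReal (t n)⁻¹ * ∫⁻ x in shell x₀ r n, ‖H x‖ₑ ^ 2 := by
          rw [lintegral_add_left' (((hW.enorm.pow_const 2).const_mul _).restrict),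
            lintegral_const_mul' _ _ ENNReal.ofReal_ne_top,
            lintegral_const_mul' _ _ ENNReal.ofReal_ne_top]
      _ ≤ ENNReal.ofReal (t n) * (∫⁻ x in Metric.ball x₀ (2 ^ (n + 2 + 0) * r), ‖W x‖ₑ ^ 2) +
            ENNReal.ofReal (t n)⁻¹ * (ENNReal.ofReal (K * (2 : ℝ) ^ (-(s' * n))) * J) :=
          add_le_add (mul_le_mul_right (lintegral_mono_set hsub) _) (mul_le_mul_right (hJ n) _)
      _ = _ := by
          congr 1
          · rw [ENNReal.ofReal_mul hδ.le, mul_assoc]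
          · rw [← mul_assoc, ← mul_assoc, ← ENNReal.ofReal_mul (by positivity),
              ← ENNReal.ofReal_mul (by positivity)]
            congr 2
            simp only [t]
            rw [mul_inv, ← Real.rpow_neg (by norm_num), neg_neg, ← two_rpow_neg_mul]
            have e1 : (2 : ℝ) ^ (s * (n + 2 : ℕ)) * (2 : ℝ) ^ (-(s' * n)) =
              2 ^ (2 * s) * (2 : ℝ) ^ (-((s' - s) * n)) := by
              rw [← Real.rpow_add (by norm_num), ← Real.rpow_add (by norm_num)]
              congr 1; push_cast; ring
            linear_combination (K * δ⁻¹) * e1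
  calc ∫⁻ x, ‖H x‖ₑ * ‖W x‖ₑ = ∫⁻ x in ⋃ n, shell x₀ r n, ‖H x‖ₑ * ‖W x‖ₑ := by
        rw [iUnion_shell x₀ hr, Measure.restrict_univ]
    _ ≤ ∑' n, ∫⁻ x in shell x₀ r n, ‖H x‖ₑ * ‖W x‖ₑ := lintegral_iUnion_le _ _
    _ ≤ _ := ENNReal.tsum_le_tsum h1
    _ = ENNReal.ofReal δ * (∑' n : ℕ, (ENNReal.ofReal ((2 : ℝ) ^ (-(s * (n + 2 : ℕ)))) *
        ∫⁻ x in Metric.ball x₀ (2 ^ (n + 2 + 0) * r), ‖W x‖ₑ ^ 2)) +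
      ENNReal.ofReal (K * δ⁻¹ * 2 ^ (2 * s)) *
        ((∑' n : ℕ, ENNReal.ofReal (((2 : ℝ) ^ (-(s' - s))) ^ n)) * J) := by
        rw [ENNReal.tsum_add, ENNReal.tsum_mul_left, ENNReal.tsum_mul_left, ENNReal.tsum_mul_right]
    _ ≤ _ := by
        rw [tsum_ofReal_geometric (by positivity) (two_rpow_neg_lt_one (by linarith)),
          ENNReal.ofReal_mul (p := K * δ⁻¹ * 2 ^ (2 * s)) (by positivity),
          mul_assoc (ENNReal.ofReal (K * δ⁻¹ * 2 ^ (2 * s)))]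
        refine add_le_add (mul_le_mul_right ?_ _) le_rfl
        -- The shells only produce the indices `n + 2`; the two missing nonnegative terms are added.
        exact ENNReal.tsum_comp_le_tsum_of_injective (add_left_injective 2) _

/-- Shifted dyadic sums are controlled by dyadic sums with slower decay. -/
theorem tsum_tsum_dyadic_le {s s' : ℝ} (hss : s < s') (a : ℕ → ℝ≥0∞) :
    ∑' k : ℕ, ENNReal.ofReal ((2 : ℝ) ^ (-(s * k))) *
        ∑' j : ℕ, ENNReal.ofReal ((2 : ℝ) ^ (-(s' * j))) * a (k + j) ≤
      ENNReal.ofReal (1 - 2 ^ (-(s' - s)))⁻¹ *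
        ∑' k : ℕ, ENNReal.ofReal ((2 : ℝ) ^ (-(s * k))) * a k := by
  -- The factorisation `2^{-sk} 2^{-s'j} = 2^{-(s'-s)j} 2^{-s(k+j)}`: for fixed `j` the sum over `k`
  -- is a tail of the single sum, and the sum over `j` is geometric.
  have h1 : ∀ k j : ℕ, ENNReal.ofReal ((2 : ℝ) ^ (-(s * k))) *
      (ENNReal.ofReal ((2 : ℝ) ^ (-(s' * j))) * a (k + j)) =
      ENNReal.ofReal (((2 : ℝ) ^ (-(s' - s))) ^ j) *
        (ENNReal.ofReal ((2 : ℝ) ^ (-(s * (k + j : ℕ)))) * a (k + j)) := fun k j => by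
    rw [← mul_assoc, ← mul_assoc, ← ENNReal.ofReal_mul (by positivity),
      ← ENNReal.ofReal_mul (by positivity), ← two_rpow_neg_mul, ← Real.rpow_add (by norm_num),
      ← Real.rpow_add (by norm_num)]
    congr 3; push_cast; ring
  simp only [← ENNReal.tsum_mul_left, h1]
  rw [ENNReal.tsum_comm]
  simp only [ENNReal.tsum_mul_left]
  rw [← tsum_ofReal_geometric (by positivity) (two_rpow_neg_lt_one (by linarith)),
    ← ENNReal.tsum_mul_right]
  refine ENNReal.tsum_le_tsum fun j => mul_le_mul_right ?_ _
  exact ENNReal.tsum_comp_le_tsum_of_injective (add_left_injective j)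
    (fun n => ENNReal.ofReal ((2 : ℝ) ^ (-(s * n))) * a n)

theorem volume_ball_eq (x₀ : EuclideanSpace ℝ (Fin d)) {r : ℝ} (hr : 0 < r) :
    volume (Metric.ball x₀ r) =
      ENNReal.ofReal (r ^ d * volume.real (Metric.ball (0 : EuclideanSpace ℝ (Fin d)) 1)) := by
  rw [Measure.addHaar_ball_of_pos _ _ hr, ENNReal.ofReal_mul (by positivity), finrank_euclideanSpace,
    Fintype.card_fin, measureReal_def, ENNReal.ofReal_toReal measure_ball_lt_top.ne]

theorem volume_real_ball_eq (x₀ : EuclideanSpace ℝ (Fin d)) {r : ℝ} (hr : 0 < r) :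
    volume.real (Metric.ball x₀ r) =
      r ^ d * volume.real (Metric.ball (0 : EuclideanSpace ℝ (Fin d)) 1) := by
  rw [measureReal_def, volume_ball_eq x₀ hr, ENNReal.toReal_ofReal (by positivity)]

/-- The constant in the estimate of `potentialHess` on shells. -/
noncomputable def shellConst (d : ℕ) : ℝ :=
  deltaMass d ^ 2 +
    hessConst d * volume.real (Metric.ball (0 : EuclideanSpace ℝ (Fin d)) 1) ^ 2 * 2 ^ d

theorem lintegral_enorm_sq_eq {F : Type*} [NormedAddCommGroup F]
    {g : EuclideanSpace ℝ (Fin d) → F} (hg : MemLp g 2 volume)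
    (s : Set (EuclideanSpace ℝ (Fin d))) :
    ∫⁻ x in s, ‖g x‖ₑ ^ 2 = ENNReal.ofReal (∫ x in s, ‖g x‖ ^ 2) := by
  rw [ofReal_integral_eq_lintegral_ofReal
    ((memLp_two_iff_integrable_sq_norm hg.1).1 hg).integrableOn (.of_forall fun x => by positivity)]
  simp only [enorm_sq_eq_ofReal]

theorem lintegral_enorm_sq_eq' {F : Type*} [NormedAddCommGroup F]
    {g : EuclideanSpace ℝ (Fin d) → F} (hg : MemLp g 2 volume) :
    ∫⁻ x, ‖g x‖ₑ ^ 2 = ENNReal.ofReal (∫ x, ‖g x‖ ^ 2) := by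
  simpa using lintegral_enorm_sq_eq hg Set.univ

/-- The source of the exponent `d + 2`: the squared decay `|x - x₀|^{-(2d+2)}` meets a volume of
order `2^{nd}`. On the innermost shell the global `L²` bound is used; the others lie at distance at
least `4 r`, twice the radius of the support, as the decay estimate requires. -/
theorem lintegral_shell_potentialHess_le {v : Field d} {Dv : MatField d} (hv : IsH1 v Dv)
    (hd : 2 ≤ d) {ε r : ℝ} (hε : 0 < ε) (hr : 0 < r) {x₀ : EuclideanSpace ℝ (Fin d)}
    (hvs : ∀ y, y ∉ Metric.ball x₀ (2 * r) → v y = 0)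
    (hDs : ∀ y, y ∉ Metric.ball x₀ (2 * r) → Dv y = 0) (n : ℕ) :
    ∫⁻ x in shell x₀ r n, ‖potentialHess ε (traceField Dv) x‖ₑ ^ 2 ≤
      ENNReal.ofReal (shellConst d * (2 : ℝ) ^ (-(((d : ℝ) + 2) * n))) *
        ∫⁻ x, ‖traceField Dv x‖ₑ ^ 2 := by
  have hsub : ∀ y : EuclideanSpace ℝ (Fin d), ‖x₀‖ + 2 * r ≤ ‖y‖ → y ∉ Metric.ball x₀ (2 * r) :=
    fun y hy hm => by
      have h1 : ‖y - x₀‖ < 2 * r := by simpa [dist_eq_norm] using hm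
      have := norm_sub_norm_le y x₀
      linarith
  have hR : 0 < ‖x₀‖ + 2 * r := by positivity
  have hvs' := fun y hy => hvs y (hsub y hy)
  have hDs' := fun y hy => hDs y (hsub y hy)
  have hH := (isH1_potentialGrad hv hε (by omega) hR hvs' hDs').grad_memLp
  have hg := memLp_traceField hv.grad_memLp
  set J := ∫ x, ‖traceField Dv x‖ ^ 2 with hJ
  have hJ0 : 0 ≤ J := integral_nonneg fun x => by positivity
  set b := volume.real (Metric.ball (0 : EuclideanSpace ℝ (Fin d)) 1) with hb1
  have hb0 : 0 ≤ b := measureReal_nonneg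
  have hh0 : 0 ≤ hessConst d := by unfold hessConst; positivity
  rw [lintegral_enorm_sq_eq' hg, ← hJ]
  rcases Nat.eq_zero_or_pos n with rfl | hn
  · refine (lintegral_mono_set (Set.subset_univ _)).trans ?_
    rw [Measure.restrict_univ, lintegral_enorm_sq_eq' hH]
    simp only [Nat.cast_zero, mul_zero, neg_zero, Real.rpow_zero, mul_one]
    rw [← ENNReal.ofReal_mul (by unfold shellConst; positivity)]
    refine ENNReal.ofReal_le_ofReal
      ((integral_norm_sq_potentialHess_le hv hε hd hR hvs' hDs').trans ?_)
    refine mul_le_mul_of_nonneg_right ?_ hJ0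
    exact le_add_of_nonneg_right (by positivity)
  · have hx : ∀ x ∈ shell x₀ r n, ‖potentialHess ε (traceField Dv) x‖ₑ ^ 2 ≤
        ENNReal.ofReal (hessConst d * (2 * r) ^ 2 * ((2 ^ (n + 1) * r)⁻¹) ^ (2 * d + 2) *
          ((2 * r) ^ d * b * J)) := fun x hx => by
      have hx1 : 2 ^ (n + 1) * r ≤ ‖x - x₀‖ := by
        simpa [dist_eq_norm] using hx.2 hn
      have hx2 : 2 * (2 * r) ≤ 2 ^ (n + 1) * r := by
        have : (2 : ℝ) ^ 2 ≤ 2 ^ (n + 1) := pow_le_pow_right₀ (by norm_num) (by omega)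
        nlinarith
      have h1 := norm_sq_potentialHess_le hv hε (by positivity) hvs hDs (hx2.trans hx1)
      rw [volume_real_ball_eq x₀ (by positivity)] at h1
      rw [enorm_sq_eq_ofReal]
      refine ENNReal.ofReal_le_ofReal (h1.trans ?_)
      gcongr
    calc _ ≤ ∫⁻ _x in shell x₀ r n, ENNReal.ofReal (hessConst d * (2 * r) ^ 2 *
          ((2 ^ (n + 1) * r)⁻¹) ^ (2 * d + 2) * ((2 * r) ^ d * b * J)) :=
          setLIntegral_mono measurable_const hx
      _ ≤ ENNReal.ofReal (hessConst d * (2 * r) ^ 2 *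
          ((2 ^ (n + 1) * r)⁻¹) ^ (2 * d + 2) * ((2 * r) ^ d * b * J)) *
          volume (Metric.ball x₀ (2 ^ (n + 2) * r)) := by
          rw [setLIntegral_const]
          exact mul_le_mul_right (measure_mono fun x hx => hx.1) _
      _ ≤ _ := by
          rw [volume_ball_eq x₀ (by positivity), ← hb1, ← ENNReal.ofReal_mul (by positivity),
            ← ENNReal.ofReal_mul (by unfold shellConst; positivity)]
          refine ENNReal.ofReal_le_ofReal ?_
          have e1 : (2 : ℝ) ^ (-(((d : ℝ) + 2) * n)) = ((2 ^ n)⁻¹) ^ (d + 2) := by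
            rw [Real.rpow_neg (by norm_num), inv_pow, ← pow_mul, mul_comm n, ← Real.rpow_natCast]
            push_cast; rfl
          rw [e1]
          have e2 : hessConst d * (2 * r) ^ 2 * ((2 ^ (n + 1) * r)⁻¹) ^ (2 * d + 2) *
              ((2 * r) ^ d * b * J) * ((2 ^ (n + 2) * r) ^ d * b) =
              (hessConst d * b ^ 2 * 2 ^ d) * ((2 ^ n)⁻¹) ^ (d + 2) * J := by
            simp only [mul_pow, mul_inv, pow_add, inv_pow, pow_mul]
            field_simp
            ring
          rw [e2]
          gcongr
          exact le_add_of_nonneg_left (by positivity)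

end Dyadic

/-! ### The `L²` pairing, the flux, and testing with non-solenoidal fields. -/

section Pairing

open Filter Topology

variable {d : ℕ} {ι : Type*} [Fintype ι]

/-- The `L²` pairing of vector fields, linear in the second argument. -/
noncomputable def pair (a b : EuclideanSpace ℝ (Fin d) → EuclideanSpace ℂ ι) : ℂ :=
  ∫ x, inner ℂ (a x) (b x)

theorem inner_eq_sum (a b : EuclideanSpace ℂ ι) : inner ℂ a b = ∑ i, b i * conj (a i) := by
  simp [PiLp.inner_apply]

theorem pair_eq_inner {a b : EuclideanSpace ℝ (Fin d) → EuclideanSpace ℂ ι}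
    (ha : MemLp a 2 volume) (hb : MemLp b 2 volume) :
    pair a b = inner ℂ (ha.toLp a) (hb.toLp b) := (inner_toLp ha hb).symm

theorem integrable_inner {a b : EuclideanSpace ℝ (Fin d) → EuclideanSpace ℂ ι}
    (ha : MemLp a 2 volume) (hb : MemLp b 2 volume) :
    Integrable fun x => inner ℂ (a x) (b x) := by
  refine (L2.integrable_inner (𝕜 := ℂ) (ha.toLp a) (hb.toLp b)).congr ?_
  filter_upwards [ha.coeFn_toLp, hb.coeFn_toLp] with x h1 h2
  rw [h1, h2]

theorem pair_eq_sum {a b : EuclideanSpace ℝ (Fin d) → EuclideanSpace ℂ ι}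
    (ha : MemLp a 2 volume) (hb : MemLp b 2 volume) :
    pair a b = ∑ i, ∫ x, b x i * conj (a x i) := by
  simp only [pair, inner_eq_sum]
  exact integral_finsetSum _ fun i _ =>
    (memLp_apply hb i).integrable_mul (memLp_conj (memLp_apply ha i))

theorem pair_add_left {a b c : EuclideanSpace ℝ (Fin d) → EuclideanSpace ℂ ι}
    (ha : MemLp a 2 volume) (hb : MemLp b 2 volume) (hc : MemLp c 2 volume) :
    pair (fun x => a x + b x) c = pair a c + pair b c := by
  simp only [pair, inner_add_left]
  exact integral_add (integrable_inner ha hc) (integrable_inner hb hc)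

theorem pair_sub_left {a b c : EuclideanSpace ℝ (Fin d) → EuclideanSpace ℂ ι}
    (ha : MemLp a 2 volume) (hb : MemLp b 2 volume) (hc : MemLp c 2 volume) :
    pair (fun x => a x - b x) c = pair a c - pair b c := by
  simp only [pair, inner_sub_left]
  exact integral_sub (integrable_inner ha hc) (integrable_inner hb hc)

theorem pair_add_right {a b c : EuclideanSpace ℝ (Fin d) → EuclideanSpace ℂ ι}
    (ha : MemLp a 2 volume) (hb : MemLp b 2 volume) (hc : MemLp c 2 volume) :
    pair a (fun x => b x + c x) = pair a b + pair a c := by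
  simp only [pair, inner_add_right]
  exact integral_add (integrable_inner ha hb) (integrable_inner ha hc)

theorem pair_sub_right {a b c : EuclideanSpace ℝ (Fin d) → EuclideanSpace ℂ ι}
    (ha : MemLp a 2 volume) (hb : MemLp b 2 volume) (hc : MemLp c 2 volume) :
    pair a (fun x => b x - c x) = pair a b - pair a c := by
  simp only [pair, inner_sub_right]
  exact integral_sub (integrable_inner ha hb) (integrable_inner ha hc)

theorem pair_self (a : EuclideanSpace ℝ (Fin d) → EuclideanSpace ℂ ι) :
    pair a a = ((∫ x, ‖a x‖ ^ 2 : ℝ) : ℂ) := by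
  simp only [pair, inner_self_eq_norm_sq_to_K]
  rw [← integral_complex_ofReal]
  simp

theorem integrable_norm_sq {a : EuclideanSpace ℝ (Fin d) → EuclideanSpace ℂ ι}
    (ha : MemLp a 2 volume) : Integrable fun x => ‖a x‖ ^ 2 :=
  (memLp_two_iff_integrable_sq_norm ha.1).1 ha

theorem norm_pair_le {a b : EuclideanSpace ℝ (Fin d) → EuclideanSpace ℂ ι}
    (ha : MemLp a 2 volume) (hb : MemLp b 2 volume) {t : ℝ} (ht : 0 < t) :
    ‖pair a b‖ ≤ t * (∫ x, ‖a x‖ ^ 2) + t⁻¹ * ∫ x, ‖b x‖ ^ 2 := by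
  rw [← integral_const_mul, ← integral_const_mul, ← integral_add
    ((integrable_norm_sq ha).const_mul _) ((integrable_norm_sq hb).const_mul _)]
  refine norm_integral_le_of_norm_le (((integrable_norm_sq ha).const_mul _).add
    ((integrable_norm_sq hb).const_mul _)) (.of_forall fun x => (norm_inner_le_norm _ _).trans ?_)
  have h2 : t * ‖a x‖ ^ 2 + t⁻¹ * ‖b x‖ ^ 2 - ‖a x‖ * ‖b x‖ =
      t * ((‖a x‖ - t⁻¹ * ‖b x‖ / 2) ^ 2 + 3 / 4 * (t⁻¹ * ‖b x‖) ^ 2) := by field_simp; ring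
  have h3 : 0 ≤ t * ((‖a x‖ - t⁻¹ * ‖b x‖ / 2) ^ 2 + 3 / 4 * (t⁻¹ * ‖b x‖) ^ 2) := by positivity
  linarith

theorem enorm_pair_le (a b : EuclideanSpace ℝ (Fin d) → EuclideanSpace ℂ ι) :
    ‖pair a b‖ₑ ≤ ∫⁻ x, ‖a x‖ₑ * ‖b x‖ₑ := by
  refine (enorm_integral_le_lintegral_enorm _).trans (lintegral_mono fun x => ?_)
  rw [← ofReal_norm, ← ofReal_norm, ← ofReal_norm, ← ENNReal.ofReal_mul (norm_nonneg _)]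
  exact ENNReal.ofReal_le_ofReal (norm_inner_le_norm _ _)

theorem tendsto_pair_mollify {R : ℝ} {a b : EuclideanSpace ℝ (Fin d) → EuclideanSpace ℂ ι}
    (ha : MemLp a 2 volume) (hb : MemLp b 2 volume) (has : ∀ y, R ≤ ‖y‖ → a y = 0) :
    Tendsto (fun ε => pair (mollify ε a) b) (𝓝[>] 0) (𝓝 (deltaMass d * pair a b)) := by
  rw [pair_eq_sum ha hb, Finset.mul_sum]
  have h1 : Tendsto (fun ε => ∑ i, ∫ x, b x i * conv (approxDelta ε) (fun y => conj (a y i)) x)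
      (𝓝[>] 0) (𝓝 (∑ i, deltaMass d * ∫ x, b x i * conj (a x i))) :=
    tendsto_finsetSum _ fun i _ =>
      tendsto_integral_mul_conv (memLp_apply hb i) (memLp_conj (memLp_apply ha i))
  refine h1.congr' ?_
  filter_upwards [self_mem_nhdsWithin] with ε hε
  rw [pair_eq_sum (memLp_mollify hε ha has) hb]
  simp only [mollify, conj_conv]

/-- The flux `μ ∇u`. -/
noncomputable def flux (μ : Coeff d) (D : MatField d) : MatField d :=
  fun x => WithLp.toLp 2 fun p => ∑ β, ∑ j, μ p.1 β p.2 j x * D x (β, j)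

theorem memLp_flux {m M : ℝ} {μ : Coeff d} (hμ : IsEllipticCoeff m M μ) {D : MatField d}
    (hD : MemLp D 2 volume) : MemLp (flux μ D) 2 volume := by
  refine memLp_piLp_iff.2 fun p => ?_
  have h : MemLp (fun x => ∑ β, ∑ j, μ p.1 β p.2 j x * D x (β, j)) 2 volume := by
    refine memLp_finsetSum _ fun β _ => memLp_finsetSum _ fun j _ => ?_
    exact (memLp_apply hD (β, j)).mul (hμ.memLp p.1 β p.2 j)
  exact h

theorem ae_norm_coeff_le {m M : ℝ} (hM : 0 < M) {μ : Coeff d} (hμ : IsEllipticCoeff m M μ) :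
    ∀ᵐ x, ∀ α β i j, ‖μ α β i j x‖ ≤ M := by
  simp only [ae_all_iff]
  intro α β i j
  have h1 := hμ.norm_le α β i j
  rw [eLpNorm_exponent_top] at h1
  filter_upwards [enorm_ae_le_eLpNormEssSup (μ α β i j) volume] with x hx
  have := hx.trans h1
  rwa [← ofReal_norm, ENNReal.ofReal_le_ofReal_iff hM.le] at this

/-- Each of the `d²` entries is a sum of `d²` products, hence the factor `d² * √(d²) = d³`. -/
theorem norm_flux_le {m M : ℝ} (hM : 0 < M) {μ : Coeff d} (hμ : IsEllipticCoeff m M μ)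
    (D : MatField d) : ∀ᵐ x, ‖flux μ D x‖ ≤ d ^ 3 * M * ‖D x‖ := by
  filter_upwards [ae_norm_coeff_le hM hμ] with x hx
  refine (abs_le_of_sq_le_sq' ?_ (by positivity)).2
  rw [norm_sq_euclidean]
  have h1 : ∀ p : Fin d × Fin d, ‖flux μ D x p‖ ≤ d ^ 2 * (M * ‖D x‖) := fun p => by
    calc ‖∑ β, ∑ j, μ p.1 β p.2 j x * D x (β, j)‖
        ≤ ∑ _β : Fin d, ∑ _j : Fin d, M * ‖D x‖ := by
          refine (norm_sum_le _ _).trans (Finset.sum_le_sum fun β _ =>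
            (norm_sum_le _ _).trans (Finset.sum_le_sum fun j _ => ?_))
          rw [norm_mul]
          exact mul_le_mul (hx _ _ _ _) (PiLp.norm_apply_le _ _) (norm_nonneg _) hM.le
      _ = _ := by simp; ring
  calc ∑ p, ‖flux μ D x p‖ ^ 2 ≤ ∑ _p : Fin d × Fin d, (d ^ 2 * (M * ‖D x‖)) ^ 2 :=
        Finset.sum_le_sum fun p _ => pow_le_pow_left₀ (norm_nonneg _) (h1 p) 2
    _ = _ := by simp; ring

theorem form_eq_pair {m M : ℝ} {μ : Coeff d} (hμ : IsEllipticCoeff m M μ) {Du Dv : MatField d}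
    (hDu : MemLp Du 2 volume) (hDv : MemLp Dv 2 volume) :
    form μ Du Dv = pair Dv (flux μ Du) := by
  rw [pair_eq_sum hDv (memLp_flux hμ hDu), Fintype.sum_prod_type, form]
  refine Finset.sum_congr rfl fun α _ => ?_
  rw [Finset.sum_comm]
  refine Finset.sum_congr rfl fun i _ => ?_
  have hint : ∀ β j, Integrable fun x => μ α β i j x * Du x (β, j) * conj (Dv x (α, i)) :=
    fun β j => ((memLp_apply hDu (β, j)).mul (r := 2) (hμ.memLp α β i j)).integrable_mul
      (memLp_conj (memLp_apply hDv (α, i)))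
  simp only [flux, Finset.sum_mul]
  rw [integral_finsetSum _ fun β _ => integrable_finsetSum _ fun j _ => hint β j]
  refine Finset.sum_congr rfl fun β _ => ?_
  rw [integral_finsetSum _ fun j _ => hint β j]

theorem pair_mat_eq_sum {F Dv : MatField d} (hF : MemLp F 2 volume) (hDv : MemLp Dv 2 volume) :
    ∑ α, ∑ β, ∫ x, F x (α, β) * conj (Dv x (α, β)) = pair Dv F := by
  rw [pair_eq_sum hDv hF, Fintype.sum_prod_type]

theorem pair_vec_eq (a b : Field d) : ∫ x, ∑ i, b x i * conj (a x i) = pair a b := by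
  simp only [pair, inner_eq_sum]

theorem IsSolution.pair_eq {m M : ℝ} {μ : Coeff d} (hμ : IsEllipticCoeff m M μ) {l : ℂ}
    {f u : Field d} {F Du : MatField d} (hF : MemLp F 2 volume) (hu : IsSolution μ l f F u Du)
    {v : Field d} {Dv : MatField d} (hv : IsH1Sigma v Dv) :
    l * pair v u + pair Dv (flux μ Du) = pair v f - pair Dv F := by
  have h := hu.eq v Dv hv
  rwa [pair_vec_eq, pair_vec_eq, pair_mat_eq_sum hF hv.grad_memLp,
    form_eq_pair hμ hu.isH1Sigma.grad_memLp hv.grad_memLp] at h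

/-- Testing the Stokes resolvent problem with a field which need not be solenoidal: the defect is
controlled by the divergence of the test function and by a small multiple of a dyadic sum. -/
theorem exists_defect_bound (hd : 2 ≤ d) {s δ : ℝ} (hs : s < d + 2) (hδ : 0 < δ) :
    ∃ C : ℝ, 0 < C ∧ ∀ {m M : ℝ} {μ : Coeff d}, IsEllipticCoeff m M μ → ∀ {l : ℂ}
      {f u : Field d} {F Du : MatField d}, IsL2Sigma f → MemLp F 2 volume →
      IsSolution μ l f F u Du → ∀ {x₀ : EuclideanSpace ℝ (Fin d)} {r : ℝ}, 0 < r →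
      ∀ {v : Field d} {Dv : MatField d}, IsH1 v Dv →
      (∀ y, y ∉ Metric.ball x₀ (2 * r) → v y = 0) →
      (∀ y, y ∉ Metric.ball x₀ (2 * r) → Dv y = 0) →
      ‖l * pair v u + pair Dv (fun x => flux μ Du x + F x) - pair v f‖ₑ ≤
        ENNReal.ofReal δ * dyadicSum s 0 x₀ r (fun _ x => ‖flux μ Du x + F x‖ₑ ^ 2) +
        ENNReal.ofReal C * ∫⁻ x, ‖traceField Dv x‖ₑ ^ 2 := by
  have hκ := deltaMass_pos (d := d) (by omega)
  have hK : 0 ≤ shellConst d := by unfold shellConst hessConst; positivity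
  have hq : 0 < (1 - (2 : ℝ) ^ (-((d : ℝ) + 2 - s)))⁻¹ :=
    inv_pos.2 (sub_pos.2 (two_rpow_neg_lt_one (by linarith)))
  -- Young's parameter is `deltaMass d * δ`, so that `δ` remains after division by the mass of the
  -- mollifier.
  set C₁ := shellConst d * (deltaMass d * δ)⁻¹ * 2 ^ (2 * s) *
    (1 - (2 : ℝ) ^ (-((d : ℝ) + 2 - s)))⁻¹ with hC₁
  have hC₁0 : 0 ≤ C₁ := by positivity
  refine ⟨(deltaMass d)⁻¹ * C₁ + 1, by positivity, ?_⟩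
  intro m M μ hμ l f u F Du hf hF hu x₀ r hr v Dv hv hvs hDs
  have hsub : ∀ y : EuclideanSpace ℝ (Fin d), ‖x₀‖ + 2 * r ≤ ‖y‖ → y ∉ Metric.ball x₀ (2 * r) :=
    fun y hy hm => by
      have h1 : ‖y - x₀‖ < 2 * r := by simpa [dist_eq_norm] using hm
      have := norm_sub_norm_le y x₀
      linarith
  have hR : 0 < ‖x₀‖ + 2 * r := by positivity
  have hvs' := fun y hy => hvs y (hsub y hy)
  have hDs' := fun y hy => hDs y (hsub y hy)
  have hd1 : 1 ≤ d := by omega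
  have huL := hu.isH1Sigma.memLp
  have hflux := memLp_flux hμ hu.isH1Sigma.grad_memLp
  have hG : MemLp (fun x => flux μ Du x + F x) 2 volume := hflux.add hF
  set G : MatField d := fun x => flux μ Du x + F x with hGdef
  set B := ENNReal.ofReal (deltaMass d * δ) * dyadicSum s 0 x₀ r (fun _ x => ‖G x‖ₑ ^ 2) +
    ENNReal.ofReal C₁ * ∫⁻ x, ‖traceField Dv x‖ₑ ^ 2 with hB
  have key : ∀ ε : ℝ, 0 < ε →
      ‖l * pair (mollify ε v) u + pair (mollify ε Dv) G - pair (mollify ε v) f‖ₑ ≤ B := by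
    intro ε hε
    have hw := isH1_potentialGrad hv hε hd1 hR hvs' hDs'
    have hV := memLp_mollify hε hv.memLp hvs'
    have hDV := memLp_mollify hε hv.grad_memLp hDs'
    -- The equation is tested with the mollified field minus its corrector. The corrector itself
    -- drops out against both `u` and `f`; only its gradient, paired with the flux, survives.
    have e := hu.pair_eq hμ hF (isH1Sigma_mollify_sub hv hε hd1 hR hvs' hDs')
    have o1 := integral_conj_potentialGrad hv hε hd1 hR hvs' hDs' hf
    have o2 := integral_conj_potentialGrad hv hε hd1 hR hvs' hDs' hu.isH1Sigma.isL2Sigma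
    rw [pair_vec_eq] at o1 o2
    rw [pair_sub_left hV hw.memLp huL, pair_sub_left hV hw.memLp hf.memLp,
      pair_sub_left hDV hw.grad_memLp hflux, pair_sub_left hDV hw.grad_memLp hF, o1, o2] at e
    have e2 : l * pair (mollify ε v) u + pair (mollify ε Dv) G - pair (mollify ε v) f =
        pair (potentialHess ε (traceField Dv)) G := by
      rw [hGdef, pair_add_right hDV hflux hF, pair_add_right hw.grad_memLp hflux hF]
      linear_combination e
    rw [e2]
    refine (enorm_pair_le _ _).trans ?_
    exact lintegral_mul_le_dyadicSum hG.1 hs (by positivity) hK x₀ hr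
      (lintegral_shell_potentialHess_le hv hd hε hr hvs hDs)
  have hlim : Tendsto (fun ε => ‖l * pair (mollify ε v) u + pair (mollify ε Dv) G -
      pair (mollify ε v) f‖ₑ) (𝓝[>] 0)
      (𝓝 ‖l * (deltaMass d * pair v u) + deltaMass d * pair Dv G - deltaMass d * pair v f‖ₑ) :=
    ((((tendsto_pair_mollify hv.memLp huL hvs').const_mul l).add
      (tendsto_pair_mollify hv.grad_memLp hG hDs')).sub
      (tendsto_pair_mollify hv.memLp hf.memLp hvs')).enorm
  -- The bound does not involve `ε`, so only the pairings with the mollifications of `v` and `Dv`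
  -- have to converge; no limit of the Hessian is needed.
  have hle := le_of_tendsto hlim (by
    filter_upwards [self_mem_nhdsWithin] with ε hε using key ε hε)
  have e3 : l * (deltaMass d * pair v u) + deltaMass d * pair Dv G - deltaMass d * pair v f =
      (deltaMass d : ℂ) * (l * pair v u + pair Dv G - pair v f) := by ring
  have e4 : ‖(deltaMass d : ℂ)‖ₑ = ENNReal.ofReal (deltaMass d) := by
    rw [← ofReal_norm, Complex.norm_real, Real.norm_of_nonneg hκ.le]
  rw [e3, enorm_mul, e4] at hle
  have hone : ENNReal.ofReal (deltaMass d)⁻¹ * ENNReal.ofReal (deltaMass d) = 1 := by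
    rw [← ENNReal.ofReal_mul (by positivity), inv_mul_cancel₀ hκ.ne', ENNReal.ofReal_one]
  calc ‖l * pair v u + pair Dv G - pair v f‖ₑ
      = ENNReal.ofReal (deltaMass d)⁻¹ * (ENNReal.ofReal (deltaMass d) *
        ‖l * pair v u + pair Dv G - pair v f‖ₑ) := by rw [← mul_assoc, hone, one_mul]
    _ ≤ ENNReal.ofReal (deltaMass d)⁻¹ * B := mul_le_mul_right hle _
    _ = ENNReal.ofReal δ * dyadicSum s 0 x₀ r (fun _ x => ‖G x‖ₑ ^ 2) +
        ENNReal.ofReal ((deltaMass d)⁻¹ * C₁) * ∫⁻ x, ‖traceField Dv x‖ₑ ^ 2 := by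
        rw [hB, mul_add, ← mul_assoc, ← mul_assoc, ← ENNReal.ofReal_mul (by positivity),
          ← ENNReal.ofReal_mul (by positivity), inv_mul_cancel_left₀ hκ.ne']
    _ ≤ _ := by
        gcongr
        linarith

end Pairing

/-! ### Cutoff functions and the localised energy identity. -/

section Cutoff

open Filter Topology

variable {d : ℕ}

theorem exists_scaled_cutoff (d : ℕ) : ∃ A : ℝ, 0 < A ∧ ∀ (x₀ : EuclideanSpace ℝ (Fin d)) {r : ℝ},
    0 < r → ∃ η : EuclideanSpace ℝ (Fin d) → ℝ, ContDiff ℝ ∞ η ∧ HasCompactSupport η ∧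
      (∀ x, 0 ≤ η x ∧ η x ≤ 1) ∧ (∀ x ∈ Metric.ball x₀ r, η x = 1) ∧
      (∀ x, x ∉ Metric.ball x₀ (2 * r) → η x = 0 ∧ ∀ i, partialDeriv i η x = 0) ∧
      ∀ i x, |partialDeriv i η x| ≤ A / r := by
  -- The outer radius `3/2 < 2` keeps the closed support inside the open ball of radius two, so that
  -- the derivatives vanish on its boundary sphere as well.
  let f : ContDiffBump (0 : EuclideanSpace ℝ (Fin d)) := ⟨1, 3 / 2, one_pos, by norm_num⟩
  have hf : ContDiff ℝ ∞ f := f.contDiff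
  have hb : ∀ i : Fin d, ∃ B, ∀ x, ‖partialDeriv i f x‖ ≤ B := fun i =>
    (continuous_partialDeriv hf i).bounded_above_of_compact_support
      (f.hasCompactSupport.fderiv_apply (𝕜 := ℝ) (EuclideanSpace.single i (1 : ℝ)))
  choose B hB using hb
  refine ⟨1 + ∑ i, |B i|, by positivity, fun x₀ r hr => ?_⟩
  have hlin : ContDiff ℝ ∞ fun x : EuclideanSpace ℝ (Fin d) => r⁻¹ • (x - x₀) :=
    (contDiff_id.sub contDiff_const).const_smul r⁻¹
  have hd : ∀ i x, partialDeriv i (fun x => f (r⁻¹ • (x - x₀))) x =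
      r⁻¹ * partialDeriv i f (r⁻¹ • (x - x₀)) := fun i x => by
    have h2 : HasFDerivAt (fun x : EuclideanSpace ℝ (Fin d) => r⁻¹ • (x - x₀))
      (r⁻¹ • ContinuousLinearMap.id ℝ _) x := ((hasFDerivAt_id x).sub_const x₀).const_smul r⁻¹
    have h3 : HasFDerivAt (fun x => f (r⁻¹ • (x - x₀))) _ x :=
      HasFDerivAt.comp (g := f) x
        (hf.differentiable (by simp) (r⁻¹ • (x - x₀))).hasFDerivAt h2
    rw [partialDeriv, h3.fderiv]
    simp [partialDeriv]
  have hnorm : ∀ x, ‖r⁻¹ • (x - x₀)‖ = dist x x₀ / r := fun x => by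
    rw [norm_smul, Real.norm_of_nonneg (by positivity), dist_eq_norm, inv_mul_eq_div]
  refine ⟨fun x => f (r⁻¹ • (x - x₀)), hf.comp hlin, ?_, fun x => ⟨f.nonneg, f.le_one⟩,
    fun x hx => ?_, fun x hx => ?_, fun i x => ?_⟩
  · exact f.hasCompactSupport.comp_homeomorph ((Homeomorph.subRight x₀).trans
      (Homeomorph.smulOfNeZero r⁻¹ (inv_ne_zero hr.ne')))
  · refine f.one_of_mem_closedBall ?_
    rw [mem_closedBall_zero_iff, hnorm]
    exact (div_le_one hr).2 (Metric.mem_ball.1 hx).le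
  · have h1 : 2 ≤ ‖r⁻¹ • (x - x₀)‖ := by
      rw [hnorm, le_div_iff₀ hr]
      simpa using hx
    refine ⟨f.zero_of_le_dist ?_, fun i => ?_⟩
    · rw [dist_zero_right]
      exact le_trans (by change (3 / 2 : ℝ) ≤ 2; norm_num) h1
    · have h2 : r⁻¹ • (x - x₀) ∉ tsupport f := by
        rw [f.tsupport_eq, mem_closedBall_zero_iff]
        change ¬ (_ ≤ (3 / 2 : ℝ))
        linarith
      rw [hd, partialDeriv, fderiv_of_notMem_tsupport (𝕜 := ℝ) h2]
      simp
  · rw [hd, abs_mul, abs_of_pos (inv_pos.2 hr), div_eq_inv_mul]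
    refine mul_le_mul_of_nonneg_left ?_ (inv_pos.2 hr).le
    refine (hB i _).trans ((le_abs_self _).trans ?_)
    have := Finset.single_le_sum (f := fun i => |B i|) (fun i _ => abs_nonneg _) (Finset.mem_univ i)
    linarith

theorem HasWeakPartialDeriv.mul_smooth {α : Fin d} {h g : EuclideanSpace ℝ (Fin d) → ℂ}
    (hw : HasWeakPartialDeriv α h g) (hh : LocallyIntegrable h) (hg : LocallyIntegrable g)
    {η : EuclideanSpace ℝ (Fin d) → ℝ} (hη : ContDiff ℝ ∞ η) :
    HasWeakPartialDeriv α (fun x => (η x : ℂ) * h x)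
      (fun x => (η x : ℂ) * g x + (partialDeriv α η x : ℂ) * h x) := by
  intro φ hφ hc
  have key := hw (fun x => φ x * η x) (hφ.mul hη) hc.mul_right
  have hdc : HasCompactSupport (partialDeriv α φ) := hc.fderiv_apply (𝕜 := ℝ) _
  have i1 : Integrable fun x => (φ x * partialDeriv α η x) • h x :=
    hh.integrable_smul_left_of_hasCompactSupport
      (hφ.continuous.mul (continuous_partialDeriv hη α)) hc.mul_right
  have i2 : Integrable fun x => (partialDeriv α φ x * η x) • h x :=
    hh.integrable_smul_left_of_hasCompactSupport
      ((continuous_partialDeriv hφ α).mul hη.continuous) hdc.mul_right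
  have i3 : Integrable fun x => (φ x * η x) • g x :=
    hg.integrable_smul_left_of_hasCompactSupport (hφ.continuous.mul hη.continuous) hc.mul_right
  simp only [partialDeriv_mul hφ hη, add_smul] at key
  rw [integral_add i1 i2] at key
  have e1 : ∀ x, partialDeriv α φ x • ((η x : ℂ) * h x) = (partialDeriv α φ x * η x) • h x :=
    fun x => by simp only [Complex.real_smul]; push_cast; ring
  have e2 : ∀ x, φ x • ((η x : ℂ) * g x + (partialDeriv α η x : ℂ) * h x) =
      (φ x * η x) • g x + (φ x * partialDeriv α η x) • h x :=
    fun x => by simp only [Complex.real_smul]; push_cast; ring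
  simp only [e1, e2]
  rw [integral_add i3 i1]
  linear_combination key

theorem HasWeakPartialDeriv.add_const {α : Fin d} {h g : EuclideanSpace ℝ (Fin d) → ℂ}
    (hw : HasWeakPartialDeriv α h g) (hh : LocallyIntegrable h) (c : ℂ) :
    HasWeakPartialDeriv α (fun x => h x + c) g := by
  intro φ hφ hc
  have hdc : HasCompactSupport (partialDeriv α φ) := hc.fderiv_apply (𝕜 := ℝ) _
  have h0 := hasWeakPartialDeriv_of_fderiv (α := α) (h := fun _ => c) (g := fun _ => 0)
    (differentiable_const c) continuous_const (by simp) φ hφ hc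
  simp only [smul_add]
  rw [integral_add (hh.integrable_smul_left_of_hasCompactSupport (continuous_partialDeriv hφ α) hdc)
    ((locallyIntegrable_const c).integrable_smul_left_of_hasCompactSupport
      (continuous_partialDeriv hφ α) hdc), h0, hw φ hφ hc]
  simp

/-- The tensor product `∇η ⊗ y`. -/
noncomputable def gradTensor (η : EuclideanSpace ℝ (Fin d) → ℝ) (y : Field d) : MatField d :=
  fun x => WithLp.toLp 2 fun p => (partialDeriv p.1 η x : ℂ) * y x p.2

theorem memLp_cutoff_mul {η : EuclideanSpace ℝ (Fin d) → ℝ} (hη : Continuous η)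
    (hc : HasCompactSupport η) {h : EuclideanSpace ℝ (Fin d) → ℂ} (hh : MemLp h 2 volume) (c : ℂ) :
    MemLp (fun x => (η x : ℂ) * (h x + c)) 2 volume := by
  have hη' : Continuous fun x => (η x : ℂ) := Complex.continuous_ofReal.comp hη
  have hc' : HasCompactSupport fun x => (η x : ℂ) := hc.comp_left Complex.ofReal_zero
  have h1 : MemLp (fun x => (η x : ℂ)) ⊤ volume := hη'.memLp_of_hasCompactSupport hc'
  have h2 : MemLp (fun x => (η x : ℂ)) 2 volume := hη'.memLp_of_hasCompactSupport hc'
  have h3 : MemLp (fun x => (η x : ℂ) * h x) 2 volume := hh.mul h1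
  simp only [mul_add]
  exact h3.add (h2.mul_const c)

theorem memLp_gradTensor {η : EuclideanSpace ℝ (Fin d) → ℝ} (hη : ContDiff ℝ ∞ η)
    (hc : HasCompactSupport η) {u : Field d} (hu : MemLp u 2 volume)
    (c : EuclideanSpace ℂ (Fin d)) : MemLp (gradTensor η fun x => u x + c) 2 volume :=
  memLp_piLp_iff.2 fun p => memLp_cutoff_mul (continuous_partialDeriv hη p.1)
    (hc.fderiv_apply (𝕜 := ℝ) _) (memLp_apply hu p.2) (c p.2)

theorem memLp_cutoff_smul {ι : Type*} [Fintype ι] {η : EuclideanSpace ℝ (Fin d) → ℝ}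
    (hη : Continuous η) (hc : HasCompactSupport η)
    {u : EuclideanSpace ℝ (Fin d) → EuclideanSpace ℂ ι} (hu : MemLp u 2 volume) :
    MemLp (fun x => (η x : ℂ) • u x) 2 volume :=
  memLp_piLp_iff.2 fun i => by
    simpa using memLp_cutoff_mul hη hc (memLp_apply hu i) 0

theorem IsH1.cutoff {u : Field d} {Du : MatField d} (hu : IsH1 u Du)
    {η : EuclideanSpace ℝ (Fin d) → ℝ} (hη : ContDiff ℝ ∞ η) (hc : HasCompactSupport η)
    (c : EuclideanSpace ℂ (Fin d)) :
    IsH1 (fun x => (η x : ℂ) • (u x + c))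
      (fun x => (η x : ℂ) • Du x + gradTensor η (fun x => u x + c) x) where
  memLp := memLp_piLp_iff.2 fun i => memLp_cutoff_mul hη.continuous hc (memLp_apply hu.memLp i) (c i)
  grad_memLp := (memLp_cutoff_smul hη.continuous hc hu.grad_memLp).add
    (memLp_gradTensor hη hc hu.memLp c)
  weakDeriv α i := by
    have h1 : LocallyIntegrable fun x => u x i :=
      (memLp_apply hu.memLp i).locallyIntegrable (by norm_num)
    have h2 : LocallyIntegrable fun x => Du x (α, i) :=
      (memLp_apply hu.grad_memLp (α, i)).locallyIntegrable (by norm_num)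
    exact ((hu.weakDeriv α i).add_const h1 (c i)).mul_smooth
      (h1.add (locallyIntegrable_const (c i))) h2 hη

theorem flux_add (μ : Coeff d) (D D' : MatField d) (x : EuclideanSpace ℝ (Fin d)) :
    flux μ (fun x => D x + D' x) x = flux μ D x + flux μ D' x := by
  ext p
  simp [flux, mul_add, Finset.sum_add_distrib]

theorem flux_sub (μ : Coeff d) (D D' : MatField d) (x : EuclideanSpace ℝ (Fin d)) :
    flux μ (fun x => D x - D' x) x = flux μ D x - flux μ D' x := by
  ext p
  simp [flux, mul_sub, Finset.sum_sub_distrib]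

theorem flux_smul (μ : Coeff d) (a : EuclideanSpace ℝ (Fin d) → ℂ) (D : MatField d)
    (x : EuclideanSpace ℝ (Fin d)) :
    flux μ (fun x => a x • D x) x = a x • flux μ D x := by
  ext p
  simp [flux, Finset.mul_sum, mul_left_comm]

theorem integral_norm_sq_flux_le {m M : ℝ} (hM : 0 < M) {μ : Coeff d} (hμ : IsEllipticCoeff m M μ)
    {D : MatField d} (hD : MemLp D 2 volume) :
    ∫ x, ‖flux μ D x‖ ^ 2 ≤ (d ^ 3 * M) ^ 2 * ∫ x, ‖D x‖ ^ 2 := by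
  rw [← integral_const_mul]
  refine integral_mono_ae (integrable_norm_sq (memLp_flux hμ hD))
    ((integrable_norm_sq hD).const_mul _) ?_
  filter_upwards [norm_flux_le hM hμ D] with x hx
  rw [← mul_pow]
  exact pow_le_pow_left₀ (norm_nonneg _) hx 2

/-- The energy identity for a localised solution, in the form of an estimate. -/
theorem norm_localized_form_le {m M : ℝ} (hM : 0 < M) {μ : Coeff d} (hμ : IsEllipticCoeff m M μ)
    {u : Field d} {Du : MatField d} (hu : IsH1 u Du) {f : Field d} (hf : MemLp f 2 volume)
    {F : MatField d} (hF : MemLp F 2 volume) {η : EuclideanSpace ℝ (Fin d) → ℝ}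
    (hη : ContDiff ℝ ∞ η) (hc : HasCompactSupport η) (c : EuclideanSpace ℂ (Fin d)) {l : ℂ}
    (hl : l ≠ 0) {t : ℝ} (ht : 0 < t)
    {z v : Field d} {Dz Dv e : MatField d} (he : e = gradTensor η fun x => u x + c)
    (hz : z = fun x => (η x : ℂ) • (u x + c)) (hDz : Dz = fun x => (η x : ℂ) • Du x + e x)
    (hv : v = fun x => (η x : ℂ) • z x) (hDv : Dv = fun x => (η x : ℂ) • (Dz x + e x)) :
    ‖l * pair z (fun x => (η x : ℂ) • u x) + pair Dz (flux μ Dz)‖ ≤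
      ‖l * pair v u + pair Dv (fun x => flux μ Du x + F x) - pair v f‖ +
      t⁻¹ * ((d ^ 3 * M) ^ 2 + 2) * (∫ x, ‖Dz x‖ ^ 2) +
      (t + t * (d ^ 3 * M) ^ 2 + 2 + (d ^ 3 * M) ^ 2) * (∫ x, ‖e x‖ ^ 2) +
      (t + 1) * (∫ x, ‖(η x : ℂ) • F x‖ ^ 2) + t⁻¹ * ‖l‖ * (∫ x, ‖z x‖ ^ 2) +
      t / ‖l‖ * ∫ x, ‖(η x : ℂ) • f x‖ ^ 2 := by
  have heL : MemLp e 2 volume := he ▸ memLp_gradTensor hη hc hu.memLp c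
  have hzL : MemLp z 2 volume := hz ▸ (hu.cutoff hη hc c).memLp
  have hDzL : MemLp Dz 2 volume := by
    rw [hDz, he]; exact (hu.cutoff hη hc c).grad_memLp
  have hηF := memLp_cutoff_smul hη.continuous hc hF
  have hηf := memLp_cutoff_smul hη.continuous hc hf
  have hfl := memLp_flux hμ hDzL
  have hfe := memLp_flux hμ heL
  have hSL : MemLp (fun x => Dz x + e x) 2 volume := hDzL.add heL
  have hDvL : MemLp Dv 2 volume := hDv ▸ memLp_cutoff_smul hη.continuous hc hSL
  have hmove : ∀ {ι : Type} [Fintype ι] (a b : EuclideanSpace ℝ (Fin d) → EuclideanSpace ℂ ι),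
      pair (fun x => (η x : ℂ) • a x) b = pair a fun x => (η x : ℂ) • b x := by
    intro ι _ a b
    simp only [pair, inner_smul_left, inner_smul_right, Complex.conj_ofReal]
  have e1 : pair v f = pair z fun x => (η x : ℂ) • f x := by rw [hv, hmove]
  have e2 : pair v u = pair z fun x => (η x : ℂ) • u x := by rw [hv, hmove]
  have e3 : pair Dv F = pair Dz (fun x => (η x : ℂ) • F x) + pair e fun x => (η x : ℂ) • F x := by
    rw [hDv, hmove, pair_add_left hDzL heL hηF]
  -- One factor `η` of the test field is moved onto the flux: `η ∇u = Dz - e` and `Dv = η (Dz + e)`,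
  -- so the form becomes that of `Dz` up to terms containing `e`.
  have e4 : pair Dv (flux μ Du) = pair Dz (flux μ Dz) + pair e (flux μ Dz) -
      pair Dz (flux μ e) - pair e (flux μ e) := by
    have h1 : (fun x => (η x : ℂ) • flux μ Du x) = fun x => flux μ Dz x - flux μ e x := by
      funext x
      have h2 : (fun y => (η y : ℂ) • Du y) = fun y => Dz y - e y := by
        funext y
        rw [hDz]; simp
      rw [← flux_sub, ← h2, flux_smul μ (fun y => (η y : ℂ))]
    rw [hDv, hmove, h1, pair_sub_right hSL hfl hfe, pair_add_left hDzL heL hfl,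
      pair_add_left hDzL heL hfe]
    ring
  have e5 := pair_add_right hDvL (memLp_flux hμ hu.grad_memLp) hF
  have hid : l * pair z (fun x => (η x : ℂ) • u x) + pair Dz (flux μ Dz) =
      (l * pair v u + pair Dv (fun x => flux μ Du x + F x) - pair v f) - pair e (flux μ Dz) +
      pair Dz (flux μ e) + pair e (flux μ e) - pair Dz (fun x => (η x : ℂ) • F x) -
      pair e (fun x => (η x : ℂ) • F x) + pair z (fun x => (η x : ℂ) • f x) := by
    rw [e5, e4, e3, e2, e1]; ring
  have hl' : 0 < ‖l‖ := norm_pos_iff.2 hl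
  -- The Young weights put the small factor `t⁻¹` on every integral of `Dz` and `z`, which are
  -- absorbed later.
  have n1 := norm_pair_le heL hfl ht
  have n2 := norm_pair_le hDzL hfe (inv_pos.2 ht)
  have n3 := norm_pair_le heL hfe one_pos
  have n4 := norm_pair_le hDzL hηF (inv_pos.2 ht)
  have n5 := norm_pair_le heL hηF one_pos
  have n6 := norm_pair_le hzL hηf (t := t⁻¹ * ‖l‖) (by positivity)
  have f1 := mul_le_mul_of_nonneg_left (integral_norm_sq_flux_le hM hμ hDzL) (inv_pos.2 ht).le
  have f2 := mul_le_mul_of_nonneg_left (integral_norm_sq_flux_le hM hμ heL) ht.le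
  have f3 := integral_norm_sq_flux_le hM hμ heL
  rw [inv_inv] at n2 n4
  rw [mul_inv, inv_inv, ← div_eq_mul_inv] at n6
  rw [inv_one, one_mul, one_mul] at n3 n5
  rw [hid]
  have tri : ∀ a1 a2 a3 a4 a5 a6 a7 : ℂ, ‖a1 - a2 + a3 + a4 - a5 - a6 + a7‖ ≤
      ‖a1‖ + ‖a2‖ + ‖a3‖ + ‖a4‖ + ‖a5‖ + ‖a6‖ + ‖a7‖ := by
    intro a1 a2 a3 a4 a5 a6 a7
    refine (norm_add_le _ _).trans (add_le_add_left ?_ _)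
    refine (norm_sub_le _ _).trans (add_le_add_left ?_ _)
    refine (norm_sub_le _ _).trans (add_le_add_left ?_ _)
    refine (norm_add_le _ _).trans (add_le_add_left ?_ _)
    refine (norm_add_le _ _).trans (add_le_add_left ?_ _)
    exact norm_sub_le _ _
  refine (tri _ _ _ _ _ _ _).trans ?_
  linarith

end Cutoff

/-! ### Coercivity in a sector beyond the half plane. -/

section LocalEstimate

open Filter Topology

variable {d : ℕ}

/-- The sum is rotated by the angle `φ = arctan (m / (2 L))` towards the real axis. As `L sin φ = (m
/ 2) cos φ`, this costs at most half of the lower bound for the real part of `a`. For `|arg l| < π/2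
+ φ/2` the rotated `l` has argument at most `γ < π/2` in modulus. The angle `ω₀` depends on `m` and
`L` only. -/
theorem exists_rotation (m L : ℝ) (hm : 0 < m) (hL : 0 < L) :
    ∃ ω₀ ∈ Set.Ioo (Real.pi / 2) Real.pi, ∃ c₀ : ℝ, 0 < c₀ ∧ ∀ l ∈ sector ω₀, ∃ ζ : ℂ, ‖ζ‖ = 1 ∧
      ∀ (a : ℂ) (n x : ℝ), 0 ≤ n → 0 ≤ x → m * n ≤ a.re → ‖a‖ ≤ L * n →
        c₀ * (‖l‖ * x + n) ≤ (ζ * (l * x + a)).re := by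
  set φ := Real.arctan (m / (2 * L)) with hφ
  have hφ0 : 0 < φ := Real.arctan_pos.2 (by positivity)
  have hφ1 : φ < Real.pi / 2 := Real.arctan_lt_pi_div_two _
  have hcos : 0 < Real.cos φ := Real.cos_arctan_pos _
  have hsin : 0 < Real.sin φ := Real.sin_pos_of_pos_of_lt_pi hφ0 (by linarith [Real.pi_pos])
  have htan : L * Real.sin φ = m / 2 * Real.cos φ := by
    have h1 : Real.tan φ = m / (2 * L) := Real.tan_arctan _
    rw [Real.tan_eq_sin_div_cos, div_eq_div_iff hcos.ne' (by positivity)] at h1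
    linarith
  -- The rotated argument `|arg l| - φ` lies between `-φ` and `π/2 - φ/2`.
  set γ := max φ (Real.pi / 2 - φ / 2) with hγ
  have hγ1 : γ < Real.pi / 2 := max_lt hφ1 (by linarith)
  have hγ0 : 0 < γ := hφ0.trans_le (le_max_left _ _)
  have hcγ : 0 < Real.cos γ := Real.cos_pos_of_mem_Ioo ⟨by linarith, hγ1⟩
  refine ⟨Real.pi / 2 + φ / 2, ⟨by linarith, by linarith⟩, min (Real.cos γ) (m / 2 * Real.cos φ),
    lt_min hcγ (by positivity), fun l hl => ?_⟩
  -- Here `σ` is the sign of `arg l`; it selects the direction of rotation.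
  have hbase : ∀ σ : ℝ, σ ^ 2 = 1 → σ * Real.sin l.arg = Real.sin |l.arg| →
      ∃ ζ : ℂ, ‖ζ‖ = 1 ∧ ∀ (a : ℂ) (n x : ℝ), 0 ≤ n → 0 ≤ x → m * n ≤ a.re → ‖a‖ ≤ L * n →
        min (Real.cos γ) (m / 2 * Real.cos φ) * (‖l‖ * x + n) ≤ (ζ * (l * x + a)).re := by
    intro σ hσ hσs
    refine ⟨⟨Real.cos φ, -(σ * Real.sin φ)⟩, ?_, ?_⟩
    · have : ‖(⟨Real.cos φ, -(σ * Real.sin φ)⟩ : ℂ)‖ ^ 2 = 1 := by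
        rw [Complex.sq_norm, Complex.normSq_mk]
        have := Real.sin_sq_add_cos_sq φ
        nlinarith
      exact (pow_eq_one_iff_of_nonneg (norm_nonneg _) two_ne_zero).1 this
    · intro a n x hn hx ha1 ha2
      have hre : l.re = ‖l‖ * Real.cos |l.arg| := by
        rw [Real.cos_abs, Complex.norm_mul_cos_arg]
      have him : σ * l.im = ‖l‖ * Real.sin |l.arg| := by
        rw [← hσs, ← Complex.norm_mul_sin_arg]
        ring
      have e1 : ((⟨Real.cos φ, -(σ * Real.sin φ)⟩ : ℂ) * (l * x + a)).re =
          ‖l‖ * x * Real.cos (|l.arg| - φ) + (Real.cos φ * a.re + σ * Real.sin φ * a.im) := by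
        rw [Real.cos_sub]
        simp only [Complex.mul_re, Complex.add_re, Complex.add_im, Complex.mul_im,
          Complex.ofReal_re, Complex.ofReal_im]
        linear_combination (Real.cos φ * x) * hre + (Real.sin φ * x) * him
      have h1 : Real.cos γ ≤ Real.cos (|l.arg| - φ) := by
        rw [← Real.cos_abs (|l.arg| - φ)]
        refine Real.cos_le_cos_of_nonneg_of_le_pi (abs_nonneg _) (by linarith) ?_
        rw [abs_le]
        have := hl.2
        have := le_max_left φ (Real.pi / 2 - φ / 2)
        have := le_max_right φ (Real.pi / 2 - φ / 2)
        have := abs_nonneg l.arg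
        constructor <;> linarith
      have h2 : -(L * n) ≤ σ * a.im := by
        have h3 : |σ| = 1 := by
          rw [← sq_abs] at hσ
          exact (pow_eq_one_iff_of_nonneg (abs_nonneg _) two_ne_zero).1 hσ
        have h4 : |σ * a.im| ≤ L * n := by
          rw [abs_mul, h3, one_mul]; exact (Complex.abs_im_le_norm a).trans ha2
        exact (abs_le.1 h4).1
      rw [e1, mul_add]
      have hlx : 0 ≤ ‖l‖ * x := by positivity
      refine add_le_add ?_ ?_
      · calc _ ≤ Real.cos γ * (‖l‖ * x) := mul_le_mul_of_nonneg_right (min_le_left _ _) hlx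
          _ ≤ _ := by rw [mul_comm]; exact mul_le_mul_of_nonneg_left h1 hlx
      · calc _ ≤ m / 2 * Real.cos φ * n := mul_le_mul_of_nonneg_right (min_le_right _ _) hn
          _ = Real.cos φ * (m * n) + Real.sin φ * (-(L * n)) := by
            linear_combination n * htan
          _ ≤ Real.cos φ * a.re + Real.sin φ * (σ * a.im) := by gcongr
          _ = _ := by ring
  rcases le_total 0 l.arg with h | h
  · exact hbase 1 (by norm_num) (by rw [abs_of_nonneg h, one_mul])
  · exact hbase (-1) (by norm_num) (by rw [abs_of_nonpos h, Real.sin_neg]; ring)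

theorem integral_norm_sq_le_of_indicator {F G : Type*} [NormedAddCommGroup F]
    [NormedAddCommGroup G] {g : EuclideanSpace ℝ (Fin d) → F} {y : EuclideanSpace ℝ (Fin d) → G}
    {S : Set (EuclideanSpace ℝ (Fin d))} (hS : MeasurableSet S) {K : ℝ}
    (hy : IntegrableOn (fun x => ‖y x‖ ^ 2) S) (h0 : ∀ x, x ∉ S → g x = 0)
    (h1 : ∀ x ∈ S, ‖g x‖ ^ 2 ≤ K * ‖y x‖ ^ 2) :
    ∫ x, ‖g x‖ ^ 2 ≤ K * ∫ x in S, ‖y x‖ ^ 2 := by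
  rw [← setIntegral_eq_integral_of_forall_compl_eq_zero (s := S)
    (fun x hx => by simp [h0 x hx]), ← integral_const_mul]
  exact integral_mono_of_nonneg (.of_forall fun x => by positivity) (hy.const_mul K)
    ((ae_restrict_iff' hS).2 (.of_forall h1))

/-- The weights are summable and each ball integral is at most the global one. Finiteness is what
allows terms to be absorbed into the left-hand side. -/
theorem dyadicSum_ne_top {s : ℝ} (hs : 0 < s) (n : ℕ) (x₀ : EuclideanSpace ℝ (Fin d)) (r : ℝ)
    {F : Type*} [NormedAddCommGroup F] {g : EuclideanSpace ℝ (Fin d) → F}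
    (hg : MemLp g 2 volume) : dyadicSum s n x₀ r (fun _ x => ‖g x‖ₑ ^ 2) ≠ ⊤ := by
  have h1 : dyadicSum s n x₀ r (fun _ x => ‖g x‖ₑ ^ 2) ≤
      ∑' k : ℕ, ENNReal.ofReal (((2 : ℝ) ^ (-s)) ^ k) * ∫⁻ x, ‖g x‖ₑ ^ 2 := by
    refine ENNReal.tsum_le_tsum fun k => ?_
    rw [two_rpow_neg_mul]
    exact mul_le_mul_right (setLIntegral_le_lintegral _ _) _
  rw [ENNReal.tsum_mul_right, tsum_ofReal_geometric (by positivity) (two_rpow_neg_lt_one hs),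
    lintegral_enorm_sq_eq' hg] at h1
  exact (h1.trans_lt (ENNReal.mul_lt_top ENNReal.ofReal_lt_top ENNReal.ofReal_lt_top)).ne

theorem integrableOn_norm_sq_add_const {u : Field d} (hu : MemLp u 2 volume)
    (c : EuclideanSpace ℂ (Fin d)) (x₀ : EuclideanSpace ℝ (Fin d)) (r : ℝ) :
    IntegrableOn (fun x => ‖u x + c‖ ^ 2) (Metric.ball x₀ r) := by
  have : IsFiniteMeasure (volume.restrict (Metric.ball x₀ r)) :=
    isFiniteMeasure_restrict.2 measure_ball_lt_top.ne
  have h1 : MemLp (fun x => u x + c) 2 (volume.restrict (Metric.ball x₀ r)) :=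
    (hu.restrict _).add (memLp_const c)
  exact (memLp_two_iff_integrable_sq_norm h1.1).1 h1

end LocalEstimate

/-! ### Localisation of a solution to one ball. -/

section LocalEstimate

open Filter Topology

variable {d : ℕ}

set_option maxHeartbeats 600000 in
/-- Localisation of a solution to a ball, with all error terms. -/
theorem exists_localization (hd : 2 ≤ d) {m M : ℝ} (hM : 0 < M) {s : ℝ}
    (hs0 : 0 < s) (hs : s < d + 2) {t δ : ℝ} (ht : 0 < t) (hδ : 0 < δ) :
    ∃ K : ℝ, 0 < K ∧ ∀ {μ : Coeff d}, IsEllipticCoeff m M μ → ∀ {l : ℂ}, l ≠ 0 →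
      ∀ {f u : Field d} {F Du : MatField d}, IsL2Sigma f → MemLp F 2 volume →
      IsSolution μ l f F u Du → ∀ (x₀ : EuclideanSpace ℝ (Fin d)) {r : ℝ}, 0 < r →
      ∀ c : EuclideanSpace ℂ (Fin d), ∃ (z w : Field d) (Dz : MatField d), IsH1 z Dz ∧
        ‖l * pair z w + pair Dz (flux μ Dz)‖ ≤
          δ * (dyadicSum s 0 x₀ r fun _ x => ‖flux μ Du x + F x‖ₑ ^ 2).toReal +
          K * (r⁻¹ ^ 2 * (∫ x in Metric.ball x₀ (2 * r), ‖u x + c‖ ^ 2) +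
            (∫ x in Metric.ball x₀ (2 * r), ‖F x‖ ^ 2) +
            ‖l‖⁻¹ * ∫ x in Metric.ball x₀ (2 * r), ‖f x‖ ^ 2) +
          t⁻¹ * ((d ^ 3 * M) ^ 2 + 2) * (∫ x, ‖Dz x‖ ^ 2) + t⁻¹ * ‖l‖ * (∫ x, ‖z x‖ ^ 2) ∧
        (∫ x, ‖z x‖ ^ 2) ≤ (∫ x in Metric.ball x₀ (2 * r), ‖u x + c‖ ^ 2) ∧
        (∫ x in Metric.ball x₀ r, ‖Du x‖ ^ 2) ≤ 2 * (∫ x, ‖Dz x‖ ^ 2) +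
          K * (r⁻¹ ^ 2 * ∫ x in Metric.ball x₀ (2 * r), ‖u x + c‖ ^ 2) ∧
        (c = 0 → w = z ∧ (∫ x in Metric.ball x₀ r, ‖u x‖ ^ 2) ≤ ∫ x, ‖z x‖ ^ 2) ∧
        ∀ σ : ℝ, 0 < σ → ‖pair z w‖ ≤
          σ⁻¹ * (∫ x in Metric.ball x₀ (2 * r), ‖u x + c‖ ^ 2) +
          σ * ∫ x in Metric.ball x₀ (2 * r), ‖u x‖ ^ 2 := by
  obtain ⟨A, hA, hcut⟩ := exists_scaled_cutoff d
  obtain ⟨C, hC, hdef⟩ := exists_defect_bound hd hs hδ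
  set L := (d : ℝ) ^ 3 * M with hL
  -- All terms in `e = ∇η ⊗ (u + c)` are collected here: those of the localised energy identity, and
  -- `C ‖div v‖²` with `‖div v‖² ≤ 4 d² ‖e‖²`. The last factor comes from `|∂_i η| ≤ A / r`.
  set K₁ := (t + t * L ^ 2 + 2 + L ^ 2 + 4 * d ^ 2 * C) * (d * A ^ 2) with hK₁
  have hL0 : 0 ≤ L := by positivity
  have hK₁0 : 0 ≤ K₁ := by positivity
  refine ⟨K₁ + t + 1 + 2 * (d * A ^ 2), by positivity, ?_⟩
  intro μ hμ l hl f u F Du hf hF hu x₀ r hr c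
  obtain ⟨η, hη, hηc, hη01, hη1, hη0, hηd⟩ := hcut x₀ hr
  have hl' : 0 < ‖l‖ := norm_pos_iff.2 hl
  set B₁ := Metric.ball x₀ (2 * r) with hB₁
  have hBm : MeasurableSet B₁ := measurableSet_ball
  have hu1 := hu.isH1Sigma.toIsH1
  have hηn : ∀ x, ‖(η x : ℂ)‖ = η x := fun x => by
    rw [Complex.norm_real, Real.norm_of_nonneg (hη01 x).1]
  set e : MatField d := gradTensor η fun x => u x + c with he
  set z : Field d := fun x => (η x : ℂ) • (u x + c) with hz
  set Dz : MatField d := fun x => (η x : ℂ) • Du x + e x with hDz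
  set v : Field d := fun x => (η x : ℂ) • z x with hv
  set Dv : MatField d := fun x => (η x : ℂ) • (Dz x + e x) with hDv
  have hz1 : IsH1 z Dz := hu1.cutoff hη hηc c
  have hge : ∀ x, gradTensor η (fun y => z y + 0) x = (η x : ℂ) • e x := fun x => by
    ext p
    simp [gradTensor, z, e]
    ring
  have hv1 : IsH1 v Dv := by
    have h := hz1.cutoff hη hηc 0
    simp only [hge] at h
    simpa [v, Dv] using h
  have hvs : ∀ y, y ∉ B₁ → v y = 0 := fun y hy => by simp [v, (hη0 y hy).1]
  have hDs : ∀ y, y ∉ B₁ → Dv y = 0 := fun y hy => by simp [Dv, (hη0 y hy).1]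
  have heL : MemLp e 2 volume := memLp_gradTensor hη hηc hu1.memLp c
  have hY := integrableOn_norm_sq_add_const hu1.memLp c x₀ (2 * r)
  set Y := ∫ x in B₁, ‖u x + c‖ ^ 2 with hYdef
  have hY0 : 0 ≤ Y := integral_nonneg fun x => by positivity
  have hE : ∫ x, ‖e x‖ ^ 2 ≤ d * A ^ 2 * (r⁻¹ ^ 2 * Y) := by
    rw [← mul_assoc]
    refine integral_norm_sq_le_of_indicator hBm hY (fun x hx => ?_) fun x _ => ?_
    · ext p
      simp [e, gradTensor, (hη0 x hx).2]
    · rw [norm_sq_euclidean, Fintype.sum_prod_type]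
      calc ∑ α, ∑ i, ‖e x (α, i)‖ ^ 2 ≤ ∑ _α : Fin d, (A / r) ^ 2 * ‖u x + c‖ ^ 2 := by
            refine Finset.sum_le_sum fun α _ => ?_
            rw [norm_sq_euclidean (u x + c), Finset.mul_sum]
            refine Finset.sum_le_sum fun i _ => ?_
            simp only [e, gradTensor, norm_mul, mul_pow, Complex.norm_real, Real.norm_eq_abs]
            gcongr
            exact hηd α x
        _ = _ := by simp; ring
  have hNz : ∫ x, ‖z x‖ ^ 2 ≤ Y := by
    have := integral_norm_sq_le_of_indicator (g := z) (K := 1) hBm hY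
      (fun x hx => by simp [z, (hη0 x hx).1]) fun x _ => by
        rw [norm_smul, hηn, mul_pow]
        exact mul_le_mul_of_nonneg_right (pow_le_one₀ (hη01 x).1 (hη01 x).2) (by positivity)
    simpa using this
  have hcutoff_le : ∀ {ι : Type} [Fintype ι] {a : EuclideanSpace ℝ (Fin d) → EuclideanSpace ℂ ι},
      MemLp a 2 volume → ∫ x, ‖(η x : ℂ) • a x‖ ^ 2 ≤ ∫ x in B₁, ‖a x‖ ^ 2 := by
    intro ι _ a ha
    have := integral_norm_sq_le_of_indicator (g := fun x => (η x : ℂ) • a x) (K := 1) hBm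
      (integrable_norm_sq ha).integrableOn
      (fun x hx => by simp [(hη0 x hx).1]) fun x _ => by
        rw [norm_smul, hηn, mul_pow]
        exact mul_le_mul_of_nonneg_right (pow_le_one₀ (hη01 x).1 (hη01 x).2) (by positivity)
    simpa using this
  have hball_le : ∀ {ι : Type} [Fintype ι] {a : EuclideanSpace ℝ (Fin d) → EuclideanSpace ℂ ι},
      MemLp a 2 volume → ∫ x in Metric.ball x₀ r, ‖a x‖ ^ 2 ≤ ∫ x, ‖(η x : ℂ) • a x‖ ^ 2 := by
    intro ι _ a ha
    have h1 : ∫ x in Metric.ball x₀ r, ‖a x‖ ^ 2 =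
        ∫ x in Metric.ball x₀ r, ‖(η x : ℂ) • a x‖ ^ 2 :=
      setIntegral_congr_fun measurableSet_ball fun x hx => by simp [hη1 x hx]
    rw [h1]
    exact setIntegral_le_integral (integrable_norm_sq (memLp_cutoff_smul hη.continuous hηc ha))
      (.of_forall fun x => by positivity)
  have htr : ∫ x, ‖traceField Dv x‖ ^ 2 ≤ 4 * d ^ 2 * ∫ x, ‖e x‖ ^ 2 := by
    rw [← integral_const_mul]
    refine integral_mono_ae ((memLp_two_iff_integrable_sq_norm
      (memLp_traceField hv1.grad_memLp).1).1 (memLp_traceField hv1.grad_memLp))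
      ((integrable_norm_sq heL).const_mul _) ?_
    filter_upwards [hu.isH1Sigma.div_eq_zero] with x hx
    -- The divergence of `η² (u + c)` contains no derivative of `u`, because `div u = 0`.
    have h1 : traceField Dv x = 2 * η x * ∑ i, e x (i, i) := by
      have : traceField Dv x = η x * (η x * (∑ i, Du x (i, i)) + 2 * ∑ i, e x (i, i)) := by
        simp only [traceField, Dv, Dz, PiLp.smul_apply, PiLp.add_apply, smul_eq_mul,
          Finset.mul_sum, ← Finset.sum_add_distrib]
        exact Finset.sum_congr rfl fun i _ => by ring
      rw [this, hx]; ring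
    have h2 : ‖traceField Dv x‖ ≤ 2 * (d * ‖e x‖) := by
      rw [h1, norm_mul, norm_mul, hηn]
      have h3 : ‖∑ i, e x (i, i)‖ ≤ d * ‖e x‖ := by
        refine (norm_sum_le _ _).trans ?_
        calc ∑ i, ‖e x (i, i)‖ ≤ ∑ _i : Fin d, ‖e x‖ :=
              Finset.sum_le_sum fun i _ => PiLp.norm_apply_le _ _
          _ = _ := by simp
      have h4 := (hη01 x).1
      have h5 := (hη01 x).2
      calc ‖(2 : ℂ)‖ * η x * ‖∑ i, e x (i, i)‖ ≤ 2 * 1 * (d * ‖e x‖) := by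
            rw [Complex.norm_ofNat]; gcongr
        _ = _ := by ring
    calc ‖traceField Dv x‖ ^ 2 ≤ (2 * (d * ‖e x‖)) ^ 2 := by gcongr
      _ = _ := by ring
  have hGL : MemLp (fun x => flux μ Du x + F x) 2 volume :=
    (memLp_flux hμ hu1.grad_memLp).add hF
  have hX : ‖l * pair v u + pair Dv (fun x => flux μ Du x + F x) - pair v f‖ ≤
      δ * (dyadicSum s 0 x₀ r fun _ x => ‖flux μ Du x + F x‖ₑ ^ 2).toReal +
        C * ∫ x, ‖traceField Dv x‖ ^ 2 := by
    have h1 := hdef hμ hf hF hu hr hv1 hvs hDs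
    have hfin := dyadicSum_ne_top hs0 0 x₀ r hGL
    rw [lintegral_enorm_sq_eq' (memLp_traceField hv1.grad_memLp), ← ofReal_norm,
      ← ENNReal.ofReal_toReal hfin, ← ENNReal.ofReal_mul hδ.le, ← ENNReal.ofReal_mul hC.le,
      ← ENNReal.ofReal_add (by positivity)
        (mul_nonneg hC.le (integral_nonneg fun x => by positivity))] at h1
    exact (ENNReal.ofReal_le_ofReal_iff (add_nonneg (by positivity)
      (mul_nonneg hC.le (integral_nonneg fun x => by positivity)))).1 h1
  have hmain := norm_localized_form_le hM hμ hu1 hf.memLp hF hη hηc c hl ht he hz hDz hv hDv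
  -- The term with `λ` pairs `z = η (u + c)` with `w = η u`, since the constant belongs to the test
  -- function and not to the solution. It is a square only when `c = 0`.
  refine ⟨z, fun x => (η x : ℂ) • u x, Dz, hz1, ?_, hNz, ?_, fun hc0 => ⟨?_, ?_⟩, fun σ hσ => ?_⟩
  · have b1 := hcutoff_le hF
    have b2 := hcutoff_le hf.memLp
    set Ψ := ∫ x in B₁, ‖F x‖ ^ 2
    set Φ := ∫ x in B₁, ‖f x‖ ^ 2
    have hΨ : 0 ≤ Ψ := integral_nonneg fun x => by positivity
    have hΦ : 0 ≤ Φ := integral_nonneg fun x => by positivity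
    have b3 : (t + t * L ^ 2 + 2 + L ^ 2) * (∫ x, ‖e x‖ ^ 2) + C * (∫ x, ‖traceField Dv x‖ ^ 2) ≤
        K₁ * (r⁻¹ ^ 2 * Y) := by
      calc _ ≤ (t + t * L ^ 2 + 2 + L ^ 2) * (∫ x, ‖e x‖ ^ 2) +
            C * (4 * d ^ 2 * ∫ x, ‖e x‖ ^ 2) := by gcongr
        _ = (t + t * L ^ 2 + 2 + L ^ 2 + 4 * d ^ 2 * C) * ∫ x, ‖e x‖ ^ 2 := by ring
        _ ≤ (t + t * L ^ 2 + 2 + L ^ 2 + 4 * d ^ 2 * C) * (d * A ^ 2 * (r⁻¹ ^ 2 * Y)) := by gcongr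
        _ = _ := by rw [hK₁]; ring
    have b4 : (t + 1) * (∫ x, ‖(η x : ℂ) • F x‖ ^ 2) ≤ (t + 1) * Ψ := by gcongr
    have b5 : t / ‖l‖ * (∫ x, ‖(η x : ℂ) • f x‖ ^ 2) ≤ t * (‖l‖⁻¹ * Φ) := by
      rw [div_eq_mul_inv, mul_assoc]; gcongr
    have p1 : 0 ≤ r⁻¹ ^ 2 * Y := by positivity
    have p2 : 0 ≤ ‖l‖⁻¹ * Φ := by positivity
    have p3 : 0 ≤ d * A ^ 2 := by positivity
    have p4 : K₁ * (r⁻¹ ^ 2 * Y) + (t + 1) * Ψ + t * (‖l‖⁻¹ * Φ) ≤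
        (K₁ + t + 1 + 2 * (d * A ^ 2)) * (r⁻¹ ^ 2 * Y + Ψ + ‖l‖⁻¹ * Φ) := by
      rw [← sub_nonneg]
      have : (K₁ + t + 1 + 2 * (d * A ^ 2)) * (r⁻¹ ^ 2 * Y + Ψ + ‖l‖⁻¹ * Φ) -
          (K₁ * (r⁻¹ ^ 2 * Y) + (t + 1) * Ψ + t * (‖l‖⁻¹ * Φ)) =
          (t + 1 + 2 * (d * A ^ 2)) * (r⁻¹ ^ 2 * Y) + (K₁ + 2 * (d * A ^ 2)) * Ψ +
            (K₁ + 1 + 2 * (d * A ^ 2)) * (‖l‖⁻¹ * Φ) := by ring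
      rw [this]
      positivity
    rw [← hL] at hmain
    clear_value e z Dz v Dv Y Ψ Φ K₁ L
    linarith
  · refine (hball_le hu1.grad_memLp).trans ?_
    have h1 : ∫ x, ‖(η x : ℂ) • Du x‖ ^ 2 ≤ 2 * (∫ x, ‖Dz x‖ ^ 2) + 2 * ∫ x, ‖e x‖ ^ 2 := by
      rw [← integral_const_mul, ← integral_const_mul, ← integral_add
        ((integrable_norm_sq hz1.grad_memLp).const_mul _) ((integrable_norm_sq heL).const_mul _)]
      refine integral_mono (integrable_norm_sq
        (memLp_cutoff_smul hη.continuous hηc hu1.grad_memLp))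
        (((integrable_norm_sq hz1.grad_memLp).const_mul _).add
          ((integrable_norm_sq heL).const_mul _)) fun x => ?_
      have h2 : (η x : ℂ) • Du x = Dz x - e x := by simp [Dz]
      have h3 := norm_sub_le (Dz x) (e x)
      simp only [h2]
      clear_value e z Dz v Dv Y K₁ L
      have h4 : ‖Dz x - e x‖ ^ 2 ≤ (‖Dz x‖ + ‖e x‖) ^ 2 := by gcongr
      nlinarith [sq_nonneg (‖Dz x‖ - ‖e x‖)]
    have p1 : 0 ≤ r⁻¹ ^ 2 * Y := by positivity
    have p2 : 2 * (d * A ^ 2 * (r⁻¹ ^ 2 * Y)) ≤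
        (K₁ + t + 1 + 2 * (d * A ^ 2)) * (r⁻¹ ^ 2 * Y) := by
      rw [← mul_assoc]
      exact mul_le_mul_of_nonneg_right (by linarith) p1
    clear_value e z Dz v Dv Y K₁ L
    linarith
  · simp [z, hc0]
  · have := hball_le hu1.memLp
    simpa [z, hc0] using this
  · have h1 := norm_pair_le hz1.memLp (memLp_cutoff_smul hη.continuous hηc hu1.memLp)
      (inv_pos.2 hσ)
    rw [inv_inv] at h1
    refine h1.trans (add_le_add (mul_le_mul_of_nonneg_left hNz (inv_pos.2 hσ).le)
      (mul_le_mul_of_nonneg_left (hcutoff_le hu1.memLp) hσ.le))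

end LocalEstimate

/-! ### The one-ball inequality for large and for small `|λ| r²`. -/

section LocalInequality

open Filter Topology

variable {d : ℕ}

theorem norm_pair_flux_le {m M : ℝ} (hM : 0 < M) {μ : Coeff d} (hμ : IsEllipticCoeff m M μ)
    {D : MatField d} (hD : MemLp D 2 volume) :
    ‖pair D (flux μ D)‖ ≤ d ^ 3 * M * ∫ x, ‖D x‖ ^ 2 := by
  rw [← integral_const_mul]
  refine norm_integral_le_of_norm_le ((integrable_norm_sq hD).const_mul _) ?_
  filter_upwards [norm_flux_le hM hμ D] with x hx
  calc ‖inner ℂ (D x) (flux μ D x)‖ ≤ ‖D x‖ * (d ^ 3 * M * ‖D x‖) :=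
        (norm_inner_le_norm _ _).trans (by gcongr)
    _ = _ := by ring

theorem IsEllipticCoeff.re_pair_flux {m M : ℝ} {μ : Coeff d} (hμ : IsEllipticCoeff m M μ)
    {z : Field d} {Dz : MatField d} (hz : IsH1 z Dz) :
    m * (∫ x, ‖Dz x‖ ^ 2) ≤ (pair Dz (flux μ Dz)).re := by
  rw [← form_eq_pair hμ hz.grad_memLp hz.grad_memLp]
  exact hμ.elliptic z Dz hz

/-- For `c = 0` the term with `λ` is `λ` times a squared norm, so the rotation gives control of both
`|λ| ‖z‖²` and `‖Dz‖²`. -/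
theorem exists_local_estimate_centered (hd : 2 ≤ d) {m M : ℝ} (hM : 0 < M) {s : ℝ}
    (hs0 : 0 < s) (hs : s < d + 2) {ω₀ c₀ : ℝ} (hc₀ : 0 < c₀)
    (hrot : ∀ l ∈ sector ω₀, ∃ ζ : ℂ, ‖ζ‖ = 1 ∧
      ∀ (a : ℂ) (n x : ℝ), 0 ≤ n → 0 ≤ x → m * n ≤ a.re → ‖a‖ ≤ d ^ 3 * M * n →
        c₀ * (‖l‖ * x + n) ≤ (ζ * (l * x + a)).re) {δ : ℝ} (hδ : 0 < δ) :
    ∃ K : ℝ, 0 < K ∧ ∀ {μ : Coeff d}, IsEllipticCoeff m M μ → ∀ {l : ℂ}, l ∈ sector ω₀ →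
      ∀ {f u : Field d} {F Du : MatField d}, IsL2Sigma f → MemLp F 2 volume →
      IsSolution μ l f F u Du → ∀ (x₀ : EuclideanSpace ℝ (Fin d)) {r : ℝ}, 0 < r →
        ‖l‖ * (∫ x in Metric.ball x₀ r, ‖u x‖ ^ 2) + (∫ x in Metric.ball x₀ r, ‖Du x‖ ^ 2) ≤
          δ * (dyadicSum s 0 x₀ r fun _ x => ‖flux μ Du x + F x‖ₑ ^ 2).toReal +
          K * (r⁻¹ ^ 2 * (∫ x in Metric.ball x₀ (2 * r), ‖u x‖ ^ 2) +
            (∫ x in Metric.ball x₀ (2 * r), ‖F x‖ ^ 2) +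
            ‖l‖⁻¹ * ∫ x in Metric.ball x₀ (2 * r), ‖f x‖ ^ 2) := by
  set L := (d : ℝ) ^ 3 * M with hL
  -- With this `t` the error terms take at most half of the coercivity constant. The remaining
  -- factor `2 / c₀`, doubled on passing from `Dz` to `Du`, explains `δ * c₀ / 4` below.
  have ht : 0 < 2 * (L ^ 2 + 2) / c₀ := by positivity
  obtain ⟨K, hK, hloc⟩ := exists_localization (m := m) hd hM hs0 hs ht
    (show 0 < δ * c₀ / 4 by positivity)
  refine ⟨4 / c₀ * K + K, by positivity, ?_⟩
  intro μ hμ l hl f u F Du hf hF hu x₀ r hr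
  obtain ⟨z, w, Dz, hz, h1, -, h3, h4, -⟩ := hloc hμ hl.1 hf hF hu x₀ hr 0
  obtain ⟨rfl, h4⟩ := h4 rfl
  obtain ⟨ζ, hζ, hζ'⟩ := hrot l hl
  have h5 := hζ' (pair Dz (flux μ Dz)) (∫ x, ‖Dz x‖ ^ 2) (∫ x, ‖w x‖ ^ 2)
    (integral_nonneg fun x => by positivity) (integral_nonneg fun x => by positivity)
    (hμ.re_pair_flux hz) (norm_pair_flux_le hM hμ hz.grad_memLp)
  rw [← pair_self] at h5
  have h6 := h5.trans ((Complex.re_le_norm _).trans_eq (by rw [norm_mul, hζ, one_mul]))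
  replace h6 := h6.trans h1
  simp only [add_zero, ← hL] at h6 h3
  clear h5 h1 hζ' hrot hloc
  have hti : (2 * (L ^ 2 + 2) / c₀)⁻¹ * (L ^ 2 + 2) = c₀ / 2 := by
    field_simp
  have hti' : (2 * (L ^ 2 + 2) / c₀)⁻¹ ≤ c₀ / 2 := by
    rw [← hti]
    exact le_mul_of_one_le_right (by positivity) (by nlinarith [sq_nonneg L])
  rw [hti] at h6
  set P := (dyadicSum s 0 x₀ r fun _ x => ‖flux μ Du x + F x‖ₑ ^ 2).toReal
  set N := ∫ x, ‖Dz x‖ ^ 2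
  set X := ∫ x, ‖w x‖ ^ 2
  set Y := ∫ x in Metric.ball x₀ (2 * r), ‖u x‖ ^ 2
  set Ψ := ∫ x in Metric.ball x₀ (2 * r), ‖F x‖ ^ 2
  set Φ := ∫ x in Metric.ball x₀ (2 * r), ‖f x‖ ^ 2
  have hΨ : 0 ≤ Ψ := integral_nonneg fun x => by positivity
  have hΦ : 0 ≤ Φ := integral_nonneg fun x => by positivity
  have hY : 0 ≤ Y := integral_nonneg fun x => by positivity
  have hX : 0 ≤ X := integral_nonneg fun x => by positivity
  have h7 : (2 * (L ^ 2 + 2) / c₀)⁻¹ * ‖l‖ * X ≤ c₀ / 2 * (‖l‖ * X) := by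
    rw [mul_assoc]; gcongr
  have h8 : ‖l‖ * X + N ≤ 2 / c₀ * (δ * c₀ / 4 * P + K * (r⁻¹ ^ 2 * Y + Ψ + ‖l‖⁻¹ * Φ)) := by
    rw [div_mul_eq_mul_div, le_div_iff₀ hc₀]
    linarith
  have h9 : ‖l‖ * (∫ x in Metric.ball x₀ r, ‖u x‖ ^ 2) ≤ ‖l‖ * X := by gcongr
  have h10 : 0 ≤ ‖l‖ * X := by positivity
  have h11 : K * (r⁻¹ ^ 2 * Y) ≤ K * (r⁻¹ ^ 2 * Y + Ψ + ‖l‖⁻¹ * Φ) := by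
    gcongr
    have : 0 ≤ ‖l‖⁻¹ * Φ := by positivity
    linarith
  have h12 : 2 * (2 / c₀ * (δ * c₀ / 4 * P + K * (r⁻¹ ^ 2 * Y + Ψ + ‖l‖⁻¹ * Φ))) =
      δ * P + 4 / c₀ * K * (r⁻¹ ^ 2 * Y + Ψ + ‖l‖⁻¹ * Φ) := by
    field_simp
    ring
  rw [add_mul]
  linarith

/-- From `|u + c|² = |u|² + 2 Re ⟨u, c⟩ + |c|²`, where `|c|²` is dropped. -/
theorem integral_ball_norm_sq_le {u : Field d} (hu : MemLp u 2 volume)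
    (c : EuclideanSpace ℂ (Fin d)) (x₀ : EuclideanSpace ℝ (Fin d)) (r : ℝ) :
    ∫ x in Metric.ball x₀ r, ‖u x‖ ^ 2 ≤
      (∫ x in Metric.ball x₀ r, ‖u x + c‖ ^ 2) + 2 * ‖c‖ * ∫ x in Metric.ball x₀ r, ‖u x‖ := by
  have : IsFiniteMeasure (volume.restrict (Metric.ball x₀ r)) :=
    isFiniteMeasure_restrict.2 measure_ball_lt_top.ne
  have h1 : IntegrableOn (fun x => ‖u x‖) (Metric.ball x₀ r) :=
    ((hu.restrict _).integrable one_le_two).norm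
  have h2 := integrableOn_norm_sq_add_const hu c x₀ r
  rw [← integral_const_mul, ← integral_add h2 (h1.const_mul _)]
  refine integral_mono (integrable_norm_sq hu).integrableOn (h2.add (h1.const_mul _)) fun x => ?_
  have h3 := norm_add_sq (𝕜 := ℂ) (u x) c
  have h4 := (abs_le.1 ((Complex.abs_re_le_norm _).trans (norm_inner_le_norm (𝕜 := ℂ) (u x) c))).1
  simp only [RCLike.re_to_complex] at h3 ⊢
  nlinarith [sq_nonneg ‖c‖]

/-- The gain over `integral_ball_norm_sq_le` is the coefficient `2/3 < 1`. On the small ball `|u|² ≤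
2 |u + c|² + 2 |c|²`, and for `d ≥ 2` its volume is at most a quarter of that of the large ball.
There, `(3/4) |c|² ≤ |u + c|² + |c| |u|`. -/
theorem integral_half_ball_norm_sq_le (hd : 2 ≤ d) {u : Field d} (hu : MemLp u 2 volume)
    (c : EuclideanSpace ℂ (Fin d)) (x₀ : EuclideanSpace ℝ (Fin d)) {r : ℝ} (hr : 0 < r) :
    ∫ x in Metric.ball x₀ r, ‖u x‖ ^ 2 ≤
      8 / 3 * (∫ x in Metric.ball x₀ (2 * r), ‖u x + c‖ ^ 2) +
        2 / 3 * (‖c‖ * ∫ x in Metric.ball x₀ (2 * r), ‖u x‖) := by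
  have hfin : ∀ ρ, IsFiniteMeasure (volume.restrict (Metric.ball x₀ ρ)) := fun ρ =>
    isFiniteMeasure_restrict.2 measure_ball_lt_top.ne
  have h1 : IntegrableOn (fun x => ‖u x‖) (Metric.ball x₀ (2 * r)) :=
    ((hu.restrict _).integrable one_le_two).norm
  have h2 := fun ρ => integrableOn_norm_sq_add_const hu c x₀ ρ
  have hV : volume.real (Metric.ball x₀ r) ≤ 1 / 4 * volume.real (Metric.ball x₀ (2 * r)) := by
    rw [volume_real_ball_eq x₀ hr, volume_real_ball_eq x₀ (show 0 < 2 * r by positivity), mul_pow]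
    have : (2 : ℝ) ^ 2 ≤ 2 ^ d := pow_le_pow_right₀ one_le_two hd
    have h3 : 0 ≤ r ^ d * volume.real (Metric.ball (0 : EuclideanSpace ℝ (Fin d)) 1) := by
      positivity
    nlinarith
  have hA : ∫ x in Metric.ball x₀ r, ‖u x‖ ^ 2 ≤ 2 * (∫ x in Metric.ball x₀ (2 * r), ‖u x + c‖ ^ 2) +
      2 * ‖c‖ ^ 2 * volume.real (Metric.ball x₀ r) := by
    have h3 : ∫ x in Metric.ball x₀ r, ‖u x + c‖ ^ 2 ≤
        ∫ x in Metric.ball x₀ (2 * r), ‖u x + c‖ ^ 2 :=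
      setIntegral_mono_set (h2 _) (.of_forall fun x => by positivity)
        (Metric.ball_subset_ball (by linarith)).eventuallyLE
    have h4 : ∫ x in Metric.ball x₀ r, ‖u x‖ ^ 2 ≤
        ∫ x in Metric.ball x₀ r, (2 * ‖u x + c‖ ^ 2 + 2 * ‖c‖ ^ 2) := by
      refine integral_mono (integrable_norm_sq hu).integrableOn
        (((h2 _).const_mul _).add (integrable_const _)) fun x => ?_
      have h5 : ‖u x‖ ≤ ‖u x + c‖ + ‖c‖ := by
        simpa using norm_sub_le (u x + c) c
      have h6 : ‖u x‖ ^ 2 ≤ (‖u x + c‖ + ‖c‖) ^ 2 := by gcongr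
      dsimp only
      nlinarith [sq_nonneg (‖u x + c‖ - ‖c‖)]
    rw [integral_add ((h2 _).const_mul _) (integrable_const _), integral_const_mul,
      setIntegral_const, smul_eq_mul] at h4
    linarith
  have hB : 3 / 4 * ‖c‖ ^ 2 * volume.real (Metric.ball x₀ (2 * r)) ≤
      (∫ x in Metric.ball x₀ (2 * r), ‖u x + c‖ ^ 2) +
        ‖c‖ * ∫ x in Metric.ball x₀ (2 * r), ‖u x‖ := by
    rw [← integral_const_mul, ← integral_add (h2 _) (h1.const_mul _), mul_comm, ← smul_eq_mul,
      ← setIntegral_const]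
    refine integral_mono (integrable_const _) ((h2 _).add (h1.const_mul _)) fun x => ?_
    have h5 : ‖c‖ ≤ ‖u x + c‖ + ‖u x‖ := by
      simpa using norm_sub_le (u x + c) (u x)
    dsimp only
    nlinarith [sq_nonneg (‖c‖ / 2 - ‖u x + c‖), mul_le_mul_of_nonneg_left h5 (norm_nonneg c)]
  have hC := mul_le_mul_of_nonneg_left hV (show 0 ≤ 2 * ‖c‖ ^ 2 by positivity)
  linarith

/-- For `|λ| r² ≤ Λ` no coercivity from `λ` is needed: the term with `λ` goes to the right-hand
side, where `|λ| ∫ |u + c|²` is bounded by `Λ r⁻² ∫ |u + c|²`. No sector condition enters. -/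
theorem exists_local_gradient_estimate (hd : 2 ≤ d) {m M : ℝ} (hm : 0 < m) (hM : 0 < M) {s : ℝ}
    (hs0 : 0 < s) (hs : s < d + 2) {Λ : ℝ} (hΛ : 0 < Λ) {δ : ℝ} (hδ : 0 < δ) :
    ∃ K : ℝ, 0 < K ∧ ∀ {μ : Coeff d}, IsEllipticCoeff m M μ → ∀ {l : ℂ}, l ≠ 0 →
      ∀ {f u : Field d} {F Du : MatField d}, IsL2Sigma f → MemLp F 2 volume →
      IsSolution μ l f F u Du → ∀ (x₀ : EuclideanSpace ℝ (Fin d)) {r : ℝ}, 0 < r →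
      ‖l‖ ≤ Λ * r⁻¹ ^ 2 → ∀ c : EuclideanSpace ℂ (Fin d),
        (∫ x in Metric.ball x₀ r, ‖Du x‖ ^ 2) ≤
          δ * (dyadicSum s 0 x₀ r fun _ x => ‖flux μ Du x + F x‖ₑ ^ 2).toReal +
          K * (r⁻¹ ^ 2 * (∫ x in Metric.ball x₀ (2 * r), ‖u x + c‖ ^ 2) +
            (∫ x in Metric.ball x₀ (2 * r), ‖F x‖ ^ 2) +
            ‖l‖⁻¹ * ∫ x in Metric.ball x₀ (2 * r), ‖f x‖ ^ 2) +
          1 / 24 * (‖l‖ * (‖c‖ * ∫ x in Metric.ball x₀ (2 * r), ‖u x‖)) := by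
  set L := (d : ℝ) ^ 3 * M with hL
  set t := 2 * (L ^ 2 + 2) / m with ht'
  have ht : 0 < t := by positivity
  obtain ⟨K, hK, hloc⟩ := exists_localization (m := m) hd hM hs0 hs ht
    (show 0 < δ * m / 4 by positivity)
  refine ⟨4 / m * K + K + 4 / m * (t⁻¹ + 192 / m + m / 192) * Λ, by positivity, ?_⟩
  intro μ hμ l hl f u F Du hf hF hu x₀ r hr hlr c
  obtain ⟨z, w, Dz, hz, h1, h2, h3, -, h5⟩ := hloc hμ hl hf hF hu x₀ hr c
  -- This weight produces `2 m / 192` in front of `|λ| |c| ∫ |u|`; the later factor `4 / m` makes it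
  -- `1/24`.
  replace h5 := h5 (m / 192) (by positivity)
  have h6 := integral_ball_norm_sq_le hu.isH1Sigma.memLp c x₀ (2 * r)
  have h7 : m * (∫ x, ‖Dz x‖ ^ 2) ≤
      ‖l * pair z w + pair Dz (flux μ Dz)‖ + ‖l‖ * ‖pair z w‖ := by
    refine (hμ.re_pair_flux hz).trans ((Complex.re_le_norm _).trans ?_)
    rw [← norm_mul]
    refine (norm_le_norm_add_norm_sub' _ _).trans (add_le_add le_rfl ?_)
    rw [← norm_neg]
    exact (congrArg norm (by ring)).le
  have hti : t⁻¹ * (L ^ 2 + 2) = m / 2 := by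
    rw [ht']; field_simp
  rw [← hL, hti] at h1
  set P := (dyadicSum s 0 x₀ r fun _ x => ‖flux μ Du x + F x‖ₑ ^ 2).toReal
  set N := ∫ x, ‖Dz x‖ ^ 2
  set X := ∫ x, ‖z x‖ ^ 2
  set Y := ∫ x in Metric.ball x₀ (2 * r), ‖u x + c‖ ^ 2
  set Y₀ := ∫ x in Metric.ball x₀ (2 * r), ‖u x‖ ^ 2
  set U := ∫ x in Metric.ball x₀ (2 * r), ‖u x‖
  set Ψ := ∫ x in Metric.ball x₀ (2 * r), ‖F x‖ ^ 2
  set Φ := ∫ x in Metric.ball x₀ (2 * r), ‖f x‖ ^ 2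
  have hΨ : 0 ≤ Ψ := integral_nonneg fun x => by positivity
  have hΦ : 0 ≤ Φ := integral_nonneg fun x => by positivity
  have hY : 0 ≤ Y := integral_nonneg fun x => by positivity
  have hU : 0 ≤ U := integral_nonneg fun x => by positivity
  set E := r⁻¹ ^ 2 * Y + Ψ + ‖l‖⁻¹ * Φ
  have h8 : ‖l‖ * Y ≤ Λ * (r⁻¹ ^ 2 * Y) := by rw [← mul_assoc]; gcongr
  have h9 : r⁻¹ ^ 2 * Y ≤ E := by
    have : 0 ≤ ‖l‖⁻¹ * Φ := by positivity
    simp only [E]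
    linarith
  have h10 : ‖l‖ * Y ≤ Λ * E := h8.trans (by gcongr)
  have h11 : t⁻¹ * ‖l‖ * X ≤ t⁻¹ * (‖l‖ * Y) := by rw [mul_assoc]; gcongr
  have h12 : ‖l‖ * ‖pair z w‖ ≤
      (192 / m + m / 192) * (‖l‖ * Y) + m / 96 * (‖l‖ * (‖c‖ * U)) := by
    calc ‖l‖ * ‖pair z w‖ ≤ ‖l‖ * ((m / 192)⁻¹ * Y + m / 192 * (Y + 2 * ‖c‖ * U)) := by
          gcongr
          exact h5.trans (by gcongr)
      _ = _ := by rw [inv_div]; ring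
  have h13 : (t⁻¹ + 192 / m + m / 192) * (‖l‖ * Y) ≤ (t⁻¹ + 192 / m + m / 192) * (Λ * E) := by
    gcongr
  have h14 : N ≤ 2 / m * (δ * m / 4 * P + K * E + (t⁻¹ + 192 / m + m / 192) * (Λ * E) +
      m / 96 * (‖l‖ * (‖c‖ * U))) := by
    rw [div_mul_eq_mul_div, le_div_iff₀ hm]
    linarith
  have h15 : K * (r⁻¹ ^ 2 * Y) ≤ K * E := by gcongr
  have h16 : 2 * (2 / m * (δ * m / 4 * P + K * E + (t⁻¹ + 192 / m + m / 192) * (Λ * E) +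
      m / 96 * (‖l‖ * (‖c‖ * U)))) = δ * P + 4 / m * K * E +
      4 / m * (t⁻¹ + 192 / m + m / 192) * Λ * E + 1 / 24 * (‖l‖ * (‖c‖ * U)) := by
    have : 4 / m * m = 4 := by field_simp
    linear_combination (δ / 4 * P + 1 / 96 * (‖l‖ * (‖c‖ * U))) * this
  rw [add_mul, add_mul]
  linarith

/-- The Caccioppoli inequality on one ball, with a nonlocal error term. -/
theorem exists_local_estimate (hd : 2 ≤ d) {m M : ℝ} (hm : 0 < m) (hM : 0 < M) {s : ℝ}
    (hs0 : 0 < s) (hs : s < d + 2) {ω₀ c₀ : ℝ} (hc₀ : 0 < c₀)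
    (hrot : ∀ l ∈ sector ω₀, ∃ ζ : ℂ, ‖ζ‖ = 1 ∧
      ∀ (a : ℂ) (n x : ℝ), 0 ≤ n → 0 ≤ x → m * n ≤ a.re → ‖a‖ ≤ d ^ 3 * M * n →
        c₀ * (‖l‖ * x + n) ≤ (ζ * (l * x + a)).re) {δ : ℝ} (hδ : 0 < δ) :
    ∃ K : ℝ, 0 < K ∧ ∀ {μ : Coeff d}, IsEllipticCoeff m M μ → ∀ {l : ℂ}, l ∈ sector ω₀ →
      ∀ {f u : Field d} {F Du : MatField d}, IsL2Sigma f → MemLp F 2 volume →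
      IsSolution μ l f F u Du → ∀ (x₀ : EuclideanSpace ℝ (Fin d)) {r : ℝ}, 0 < r →
      ∀ c : EuclideanSpace ℂ (Fin d),
        ‖l‖ * (∫ x in Metric.ball x₀ r, ‖u x‖ ^ 2) + (∫ x in Metric.ball x₀ r, ‖Du x‖ ^ 2) ≤
          δ * (dyadicSum s 0 x₀ r fun _ x => ‖flux μ Du x + F x‖ₑ ^ 2).toReal +
          K * (r⁻¹ ^ 2 * (∫ x in Metric.ball x₀ (2 * r), ‖u x + c‖ ^ 2) +
            (∫ x in Metric.ball x₀ (2 * r), ‖F x‖ ^ 2) +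
            ‖l‖⁻¹ * ∫ x in Metric.ball x₀ (2 * r), ‖f x‖ ^ 2) +
          3 / 4 * (‖l‖ * (‖c‖ * ∫ x in Metric.ball x₀ (2 * r), ‖u x‖)) := by
  obtain ⟨K₁, hK₁, hlarge⟩ := exists_local_estimate_centered hd hM hs0 hs hc₀ hrot hδ
  -- The threshold `8/3 * K₁` is the one for which `2 K₁ r⁻² ≤ (3/4) |λ|` in the regime of large
  -- `|λ| r²`.
  obtain ⟨K₂, hK₂, hsmall⟩ := exists_local_gradient_estimate hd hm hM hs0 hs
    (show 0 < 8 / 3 * K₁ by positivity) hδ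
  refine ⟨K₁ + K₂ + 8 / 3 * (8 / 3 * K₁), by positivity, ?_⟩
  intro μ hμ l hl f u F Du hf hF hu x₀ r hr c
  have h1 := hlarge hμ hl hf hF hu x₀ hr
  have h2 := hsmall hμ hl.1 hf hF hu x₀ hr
  have h3 := integral_ball_norm_sq_le hu.isH1Sigma.memLp c x₀ (2 * r)
  have h4 := integral_half_ball_norm_sq_le hd hu.isH1Sigma.memLp c x₀ hr
  set P := (dyadicSum s 0 x₀ r fun _ x => ‖flux μ Du x + F x‖ₑ ^ 2).toReal
  have hY : 0 ≤ ∫ x in Metric.ball x₀ (2 * r), ‖u x + c‖ ^ 2 :=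
    integral_nonneg fun x => by positivity
  have hU : 0 ≤ ∫ x in Metric.ball x₀ (2 * r), ‖u x‖ := integral_nonneg fun x => by positivity
  have hΨ : 0 ≤ ∫ x in Metric.ball x₀ (2 * r), ‖F x‖ ^ 2 := integral_nonneg fun x => by positivity
  have hΦ : 0 ≤ ∫ x in Metric.ball x₀ (2 * r), ‖f x‖ ^ 2 := integral_nonneg fun x => by positivity
  rcases le_total ‖l‖ (8 / 3 * K₁ * r⁻¹ ^ 2) with hlr | hlr
  -- Small `|λ| r²`: the zeroth order term is estimated directly by `h4`, and the coefficients add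
  -- up to `2/3 + 1/24 ≤ 3/4`.
  · replace h2 := h2 hlr c
    generalize (∫ x in Metric.ball x₀ (2 * r), ‖u x + c‖ ^ 2) = Y at *
    generalize (∫ x in Metric.ball x₀ (2 * r), ‖u x‖) = U at *
    generalize (∫ x in Metric.ball x₀ (2 * r), ‖F x‖ ^ 2) = Ψ at *
    generalize (∫ x in Metric.ball x₀ (2 * r), ‖f x‖ ^ 2) = Φ at *
    have h5 : ‖l‖ * (∫ x in Metric.ball x₀ r, ‖u x‖ ^ 2) ≤
        8 / 3 * (8 / 3 * K₁) * (r⁻¹ ^ 2 * Y) + 2 / 3 * (‖l‖ * (‖c‖ * U)) := by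
      have h6 := mul_le_mul_of_nonneg_left h4 (norm_nonneg l)
      have h7 := mul_le_mul_of_nonneg_right hlr hY
      linarith
    have h8 : 0 ≤ ‖l‖ * (‖c‖ * U) := by positivity
    have h9 : r⁻¹ ^ 2 * Y ≤ r⁻¹ ^ 2 * Y + Ψ + ‖l‖⁻¹ * Φ := by
      have : 0 ≤ ‖l‖⁻¹ * Φ := by positivity
      linarith
    have h10 := mul_le_mul_of_nonneg_left h9 (show 0 ≤ 8 / 3 * (8 / 3 * K₁) by positivity)
    have h11 : 0 ≤ K₁ * (r⁻¹ ^ 2 * Y + Ψ + ‖l‖⁻¹ * Φ) := by positivity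
    rw [add_mul, add_mul]
    linarith
  -- Large `|λ| r²`: in the estimate for `c = 0`, `∫ |u|²` is replaced through `h3`, and `2 K₁ r⁻²
  -- |c| ∫ |u|` is at most `(3/4) |λ| |c| ∫ |u|`.
  · generalize (∫ x in Metric.ball x₀ (2 * r), ‖u x + c‖ ^ 2) = Y at *
    generalize (∫ x in Metric.ball x₀ (2 * r), ‖u x‖) = U at *
    generalize (∫ x in Metric.ball x₀ (2 * r), ‖F x‖ ^ 2) = Ψ at *
    generalize (∫ x in Metric.ball x₀ (2 * r), ‖f x‖ ^ 2) = Φ at *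
    have h5 := mul_le_mul_of_nonneg_left h3 (show 0 ≤ K₁ * r⁻¹ ^ 2 by positivity)
    have h6 := mul_le_mul_of_nonneg_right hlr (show 0 ≤ ‖c‖ * U by positivity)
    have h7 : 0 ≤ (K₂ + 8 / 3 * (8 / 3 * K₁)) * (r⁻¹ ^ 2 * Y + Ψ + ‖l‖⁻¹ * Φ) := by positivity
    linarith

end LocalInequality

/-! ### Summation over the dyadic radii and absorption. -/

section Summation

open Filter Topology

variable {d : ℕ}

theorem lintegral_ball_enorm_add_const_sq {u : Field d} (hu : MemLp u 2 volume)
    (c : EuclideanSpace ℂ (Fin d)) (x₀ : EuclideanSpace ℝ (Fin d)) (r : ℝ) :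
    ∫⁻ x in Metric.ball x₀ r, ‖u x + c‖ₑ ^ 2 =
      ENNReal.ofReal (∫ x in Metric.ball x₀ r, ‖u x + c‖ ^ 2) := by
  rw [ofReal_integral_eq_lintegral_ofReal (integrableOn_norm_sq_add_const hu c x₀ r)
    (.of_forall fun x => by positivity)]
  exact lintegral_congr fun x => enorm_sq_eq_ofReal _

theorem lintegral_ball_enorm {u : Field d} (hu : MemLp u 2 volume)
    (x₀ : EuclideanSpace ℝ (Fin d)) (r : ℝ) :
    ∫⁻ x in Metric.ball x₀ r, ‖u x‖ₑ = ENNReal.ofReal (∫ x in Metric.ball x₀ r, ‖u x‖) := by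
  have : IsFiniteMeasure (volume.restrict (Metric.ball x₀ r)) :=
    isFiniteMeasure_restrict.2 measure_ball_lt_top.ne
  exact (ofReal_integral_norm_eq_lintegral_enorm ((hu.restrict _).integrable one_le_two)).symm

/-- Absorbing a quarter multiplies the rest by `4/3`, which turns `3/4` into exactly one. The term
with `|c_k|` carries no further constant in the theorem for this reason. -/
theorem le_of_le_quarter_add {T R W : ℝ≥0∞} (hT : T ≠ ⊤)
    (h : T ≤ ENNReal.ofReal (1 / 4) * T + R + ENNReal.ofReal (3 / 4) * W) :
    T ≤ ENNReal.ofReal (4 / 3) * R + W := by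
  rcases eq_or_ne R ⊤ with rfl | hR
  · simp [ENNReal.mul_top]
  rcases eq_or_ne W ⊤ with rfl | hW
  · simp
  rw [← ENNReal.ofReal_toReal hT, ← ENNReal.ofReal_toReal hR, ← ENNReal.ofReal_toReal hW] at h ⊢
  have h1 : 0 ≤ T.toReal := ENNReal.toReal_nonneg
  have h2 : 0 ≤ R.toReal := ENNReal.toReal_nonneg
  have h3 : 0 ≤ W.toReal := ENNReal.toReal_nonneg
  rw [← ENNReal.ofReal_mul (by norm_num), ← ENNReal.ofReal_mul (by norm_num),
    ← ENNReal.ofReal_add (by positivity) (by positivity),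
    ← ENNReal.ofReal_add (by positivity) (by positivity),
    ENNReal.ofReal_le_ofReal_iff (by positivity)] at h
  rw [← ENNReal.ofReal_mul (by norm_num), ← ENNReal.ofReal_add (by positivity) (by positivity)]
  exact ENNReal.ofReal_le_ofReal (by linarith)

/-- The sum at radius `2^k r` is a shifted sum at radius `r`. The gradient keeps its radii, since it
is to be absorbed; for `F` they are doubled to match the right-hand side of the theorem. -/
theorem dyadicSum_flux_le {m M : ℝ} (hM : 0 < M) {μ : Coeff d} (hμ : IsEllipticCoeff m M μ)
    {F Du : MatField d} (hF : MemLp F 2 volume) (s : ℝ) (x₀ : EuclideanSpace ℝ (Fin d))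
    (r : ℝ) (k : ℕ) :
    dyadicSum s 0 x₀ (2 ^ k * r) (fun _ x => ‖flux μ Du x + F x‖ₑ ^ 2) ≤
      ∑' j : ℕ, ENNReal.ofReal ((2 : ℝ) ^ (-(s * j))) *
        (ENNReal.ofReal (2 * (d ^ 3 * M) ^ 2) *
          (∫⁻ x in Metric.ball x₀ (2 ^ (k + j) * r), ‖Du x‖ₑ ^ 2) +
        ENNReal.ofReal 2 * ∫⁻ x in Metric.ball x₀ (2 ^ (k + j + 1) * r), ‖F x‖ₑ ^ 2) := by
  refine ENNReal.tsum_le_tsum fun j => mul_le_mul_right ?_ _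
  have hb : (2 : ℝ) ^ (j + 0) * (2 ^ k * r) = 2 ^ (k + j) * r := by rw [add_zero, pow_add]; ring
  rw [hb]
  have h1 : ∫⁻ x in Metric.ball x₀ (2 ^ (k + j) * r), ‖flux μ Du x + F x‖ₑ ^ 2 ≤
      ∫⁻ x in Metric.ball x₀ (2 ^ (k + j) * r), (ENNReal.ofReal (2 * (d ^ 3 * M) ^ 2) *
        ‖Du x‖ₑ ^ 2 + ENNReal.ofReal 2 * ‖F x‖ₑ ^ 2) := by
    refine lintegral_mono_ae (ae_restrict_of_ae ?_)
    filter_upwards [norm_flux_le hM hμ Du] with x hx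
    rw [enorm_sq_eq_ofReal, enorm_sq_eq_ofReal, enorm_sq_eq_ofReal,
      ← ENNReal.ofReal_mul (by positivity), ← ENNReal.ofReal_mul (by positivity),
      ← ENNReal.ofReal_add (by positivity) (by positivity)]
    refine ENNReal.ofReal_le_ofReal ?_
    have h2 : ‖flux μ Du x + F x‖ ^ 2 ≤ (d ^ 3 * M * ‖Du x‖ + ‖F x‖) ^ 2 := by
      gcongr
      exact (norm_add_le _ _).trans (by gcongr)
    nlinarith [sq_nonneg (d ^ 3 * M * ‖Du x‖ - ‖F x‖)]
  refine h1.trans ?_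
  rw [lintegral_add_right' _ ((hF.1.enorm.pow_const 2).const_mul _).restrict,
    lintegral_const_mul' _ _ ENNReal.ofReal_ne_top, lintegral_const_mul' _ _ ENNReal.ofReal_ne_top]
  refine add_le_add le_rfl (mul_le_mul_right ?_ _)
  refine lintegral_mono_set fun x hx => ?_
  rw [Metric.mem_ball] at hx ⊢
  have h0 : 0 < 2 ^ (k + j) * r := dist_nonneg.trans_lt hx
  rw [pow_succ]
  linarith

theorem caccioppoli_of_rotation (hd : 2 ≤ d) {m M : ℝ} (hm : 0 < m) (hM : 0 < M)
    {ω₀ c₀ : ℝ} (hc₀ : 0 < c₀)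
    (hrot : ∀ l ∈ sector ω₀, ∃ ζ : ℂ, ‖ζ‖ = 1 ∧
      ∀ (a : ℂ) (n x : ℝ), 0 ≤ n → 0 ≤ x → m * n ≤ a.re → ‖a‖ ≤ d ^ 3 * M * n →
        c₀ * (‖l‖ * x + n) ≤ (ζ * (l * x + a)).re) {ν : ℝ} (hν0 : 0 < ν) (hν : ν < d + 2) :
    ∃ C : ℝ, 0 < C ∧ ∀ {μ : Coeff d}, IsEllipticCoeff m M μ → ∀ {l : ℂ}, l ∈ sector ω₀ →
      ∀ {f u : Field d} {F Du : MatField d}, IsL2Sigma f → MemLp F 2 volume →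
      IsSolution μ l f F u Du → ∀ (x₀ : EuclideanSpace ℝ (Fin d)) {r : ℝ}, 0 < r →
      ∀ c : ℕ → EuclideanSpace ℂ (Fin d),
        ‖l‖ₑ * dyadicSum ν 0 x₀ r (fun _ x => ‖u x‖ₑ ^ 2) +
            dyadicSum ν 0 x₀ r (fun _ x => ‖Du x‖ₑ ^ 2) ≤
          ENNReal.ofReal (C / r ^ 2) * dyadicSum (ν + 2) 1 x₀ r (fun k x => ‖u x + c k‖ₑ ^ 2) +
            ‖l‖ₑ * dyadicSum ν 1 x₀ r (fun k x => ‖c k‖ₑ * ‖u x‖ₑ) +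
            ENNReal.ofReal (C / ‖l‖) * dyadicSum ν 1 x₀ r (fun _ x => ‖f x‖ₑ ^ 2) +
            ENNReal.ofReal C * dyadicSum ν 1 x₀ r (fun _ x => ‖F x‖ₑ ^ 2) := by
  obtain ⟨s, hνs, hs⟩ := exists_between hν
  set g := (1 - (2 : ℝ) ^ (-(s - ν)))⁻¹ with hg
  have hg0 : 0 < g := inv_pos.2 (sub_pos.2 (two_rpow_neg_lt_one (sub_pos.2 hνs)))
  set L := (d : ℝ) ^ 3 * M with hL
  -- Chosen so that `δ * g * 2 (L² + 1) = 1/4`, where `g` is the geometric factor from collapsing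
  -- the double sum; this leaves a quarter of the gradient sum to absorb.
  set δ := 1 / (8 * g * (L ^ 2 + 1)) with hδdef
  have hδ : 0 < δ := by positivity
  obtain ⟨K, hK, hloc⟩ := exists_local_estimate hd hm hM (hν0.trans hνs) hs hc₀ hrot hδ
  -- This is `4/3 * (K + 1/4)`: the quarter is the contribution of `F` through the nonlocal term.
  refine ⟨4 / 3 * K + 1 / 3, by positivity, ?_⟩
  intro μ hμ l hl f u F Du hf hF hu x₀ r hr c
  have hu1 := hu.isH1Sigma.toIsH1
  have hl' : 0 < ‖l‖ := norm_pos_iff.2 hl.1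
  have hGL : MemLp (fun x => flux μ Du x + F x) 2 volume :=
    (memLp_flux hμ hu1.grad_memLp).add hF
  set w : ℕ → ℝ≥0∞ := fun k => ENNReal.ofReal ((2 : ℝ) ^ (-(ν * k))) with hw
  set A : ℕ → ℝ≥0∞ := fun k => ∫⁻ x in Metric.ball x₀ (2 ^ (k + 0) * r), ‖u x‖ₑ ^ 2 with hA
  set B : ℕ → ℝ≥0∞ := fun k => ∫⁻ x in Metric.ball x₀ (2 ^ (k + 0) * r), ‖Du x‖ₑ ^ 2 with hB
  set Y : ℕ → ℝ≥0∞ := fun k => ∫⁻ x in Metric.ball x₀ (2 ^ (k + 1) * r), ‖u x + c k‖ₑ ^ 2 with hY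
  set U : ℕ → ℝ≥0∞ := fun k => ∫⁻ x in Metric.ball x₀ (2 ^ (k + 1) * r), ‖c k‖ₑ * ‖u x‖ₑ with hU
  set Φ : ℕ → ℝ≥0∞ := fun k => ∫⁻ x in Metric.ball x₀ (2 ^ (k + 1) * r), ‖f x‖ₑ ^ 2 with hΦ
  set Ψ : ℕ → ℝ≥0∞ := fun k => ∫⁻ x in Metric.ball x₀ (2 ^ (k + 1) * r), ‖F x‖ₑ ^ 2 with hΨ
  set a : ℕ → ℝ≥0∞ := fun n => ENNReal.ofReal (2 * L ^ 2) * B n + ENNReal.ofReal 2 * Ψ n with ha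
  have hpt : ∀ k : ℕ, ‖l‖ₑ * A k + B k ≤
      ENNReal.ofReal δ * (∑' j : ℕ, ENNReal.ofReal ((2 : ℝ) ^ (-(s * j))) * a (k + j)) +
      ENNReal.ofReal K * (ENNReal.ofReal ((2 ^ k * r)⁻¹ ^ 2) * Y k + Ψ k +
        ENNReal.ofReal ‖l‖⁻¹ * Φ k) + ENNReal.ofReal (3 / 4) * (‖l‖ₑ * U k) := by
    intro k
    have hrk : 0 < 2 ^ k * r := by positivity
    have h1 := ENNReal.ofReal_le_ofReal (hloc hμ hl hf hF hu x₀ hrk (c k))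
    have hb : (2 : ℝ) * (2 ^ k * r) = 2 ^ (k + 1) * r := by rw [pow_succ]; ring
    have hI : ∀ {ι : Type} [Fintype ι] (h : EuclideanSpace ℝ (Fin d) → EuclideanSpace ℂ ι)
        (S : Set (EuclideanSpace ℝ (Fin d))), 0 ≤ ∫ x in S, ‖h x‖ ^ 2 := fun h S =>
      integral_nonneg fun x => by positivity
    have hU0 : 0 ≤ ∫ x in Metric.ball x₀ (2 ^ (k + 1) * r), ‖u x‖ :=
      integral_nonneg fun x => norm_nonneg _
    have hP := dyadicSum_flux_le (Du := Du) hM hμ hF s x₀ r k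
    have e1 : A k = ENNReal.ofReal (∫ x in Metric.ball x₀ (2 ^ k * r), ‖u x‖ ^ 2) :=
      lintegral_enorm_sq_eq hu1.memLp _
    have e2 : B k = ENNReal.ofReal (∫ x in Metric.ball x₀ (2 ^ k * r), ‖Du x‖ ^ 2) :=
      lintegral_enorm_sq_eq hu1.grad_memLp _
    have e3 : Y k = ENNReal.ofReal (∫ x in Metric.ball x₀ (2 ^ (k + 1) * r), ‖u x + c k‖ ^ 2) :=
      lintegral_ball_enorm_add_const_sq hu1.memLp _ _ _
    have e4 : Ψ k = ENNReal.ofReal (∫ x in Metric.ball x₀ (2 ^ (k + 1) * r), ‖F x‖ ^ 2) :=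
      lintegral_enorm_sq_eq hF _
    have e5 : Φ k = ENNReal.ofReal (∫ x in Metric.ball x₀ (2 ^ (k + 1) * r), ‖f x‖ ^ 2) :=
      lintegral_enorm_sq_eq hf.memLp _
    have e6 : U k = ‖c k‖ₑ * ENNReal.ofReal (∫ x in Metric.ball x₀ (2 ^ (k + 1) * r), ‖u x‖) := by
      rw [← lintegral_ball_enorm hu1.memLp, ← lintegral_const_mul' _ _ enorm_ne_top]
    have e7 := ENNReal.ofReal_toReal (dyadicSum_ne_top (hν0.trans hνs) 0 x₀ (2 ^ k * r) hGL)
    rw [hb] at h1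
    have i1 := hI u (Metric.ball x₀ (2 ^ k * r))
    have i2 := hI Du (Metric.ball x₀ (2 ^ k * r))
    have i3 := hI (fun x => u x + c k) (Metric.ball x₀ (2 ^ (k + 1) * r))
    have i4 := hI F (Metric.ball x₀ (2 ^ (k + 1) * r))
    have i5 := hI f (Metric.ball x₀ (2 ^ (k + 1) * r))
    have i6 : 0 ≤ (dyadicSum s 0 x₀ (2 ^ k * r)
      fun _ x => ‖flux μ Du x + F x‖ₑ ^ 2).toReal := ENNReal.toReal_nonneg
    rw [ENNReal.ofReal_add (by positivity) i2, ENNReal.ofReal_mul hl'.le,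
      ENNReal.ofReal_add (by positivity) (by positivity),
      ENNReal.ofReal_add (by positivity) (by positivity),
      ENNReal.ofReal_mul hδ.le, ENNReal.ofReal_mul hK.le,
      ENNReal.ofReal_add (by positivity) (by positivity),
      ENNReal.ofReal_add (by positivity) (by positivity),
      ENNReal.ofReal_mul (by positivity), ENNReal.ofReal_mul (by positivity),
      ENNReal.ofReal_mul (p := 3 / 4) (by positivity), ENNReal.ofReal_mul (p := ‖l‖) hl'.le,
      ENNReal.ofReal_mul (p := ‖c k‖) (norm_nonneg _), e7, ofReal_norm, ofReal_norm,
      ← e1, ← e2, ← e3, ← e4, ← e5, ← e6] at h1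
    refine h1.trans ?_
    gcongr
    exact hP
  have hd1 : dyadicSum ν 0 x₀ r (fun _ x => ‖u x‖ₑ ^ 2) = ∑' k, w k * A k := rfl
  have hd2 : dyadicSum ν 0 x₀ r (fun _ x => ‖Du x‖ₑ ^ 2) = ∑' k, w k * B k := rfl
  have hd3 : dyadicSum ν 1 x₀ r (fun k x => ‖c k‖ₑ * ‖u x‖ₑ) = ∑' k, w k * U k := rfl
  have hd4 : dyadicSum ν 1 x₀ r (fun _ x => ‖f x‖ₑ ^ 2) = ∑' k, w k * Φ k := rfl
  have hd5 : dyadicSum ν 1 x₀ r (fun _ x => ‖F x‖ₑ ^ 2) = ∑' k, w k * Ψ k := rfl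
  -- The factor `(2^k r)⁻²` of the estimate at radius `2^k r` shifts the exponent from `ν` to `ν +
  -- 2`.
  have hd6 : ∑' k, w k * (ENNReal.ofReal ((2 ^ k * r)⁻¹ ^ 2) * Y k) =
      ENNReal.ofReal (r⁻¹ ^ 2) *
        dyadicSum (ν + 2) 1 x₀ r (fun k x => ‖u x + c k‖ₑ ^ 2) := by
    rw [dyadicSum, ← ENNReal.tsum_mul_left]
    refine tsum_congr fun k => ?_
    rw [← mul_assoc, ← mul_assoc, ← ENNReal.ofReal_mul (by positivity),
      ← ENNReal.ofReal_mul (by positivity)]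
    congr 2
    have : (2 : ℝ) ^ (-((ν + 2) * k)) = 2 ^ (-(ν * k)) * ((2 : ℝ) ^ k)⁻¹ ^ 2 := by
      rw [show -((ν + 2) * (k : ℝ)) = -(ν * k) + -((2 * k : ℕ) : ℝ) by push_cast; ring,
        Real.rpow_add two_pos, Real.rpow_neg two_pos.le ((2 * k : ℕ) : ℝ), Real.rpow_natCast,
        mul_comm 2 k, pow_mul, inv_pow]
    rw [this, mul_inv, mul_pow]
    ring
  have hfin : ‖l‖ₑ * (∑' k, w k * A k) + ∑' k, w k * B k ≠ ⊤ :=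
    ENNReal.add_ne_top.2 ⟨ENNReal.mul_ne_top enorm_ne_top
      (dyadicSum_ne_top hν0 0 x₀ r hu1.memLp), dyadicSum_ne_top hν0 0 x₀ r hu1.grad_memLp⟩
  have hsum : ‖l‖ₑ * (∑' k, w k * A k) + ∑' k, w k * B k ≤
      ENNReal.ofReal δ * (ENNReal.ofReal g * ∑' k, w k * a k) +
      ENNReal.ofReal K * (ENNReal.ofReal (r⁻¹ ^ 2) *
        dyadicSum (ν + 2) 1 x₀ r (fun k x => ‖u x + c k‖ₑ ^ 2) + (∑' k, w k * Ψ k) +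
        ENNReal.ofReal ‖l‖⁻¹ * ∑' k, w k * Φ k) +
      ENNReal.ofReal (3 / 4) * (‖l‖ₑ * ∑' k, w k * U k) := by
    calc ‖l‖ₑ * (∑' k, w k * A k) + ∑' k, w k * B k
        = ∑' k, w k * (‖l‖ₑ * A k + B k) := by
          rw [← ENNReal.tsum_mul_left, ← ENNReal.tsum_add]
          exact tsum_congr fun k => by ring
      _ ≤ _ := ENNReal.tsum_le_tsum fun k => mul_le_mul_right (hpt k) (w k)
      _ = ENNReal.ofReal δ * (∑' k, w k *
            ∑' j : ℕ, ENNReal.ofReal ((2 : ℝ) ^ (-(s * j))) * a (k + j)) +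
          ENNReal.ofReal K * ((∑' k, w k * (ENNReal.ofReal ((2 ^ k * r)⁻¹ ^ 2) * Y k)) +
            (∑' k, w k * Ψ k) + ENNReal.ofReal ‖l‖⁻¹ * ∑' k, w k * Φ k) +
          ENNReal.ofReal (3 / 4) * (‖l‖ₑ * ∑' k, w k * U k) := by
          simp only [← ENNReal.tsum_mul_left, ← ENNReal.tsum_add]
          refine tsum_congr fun k => ?_
          simp only [ENNReal.tsum_mul_left]
          ring
      _ ≤ _ := by
          rw [hd6]
          gcongr
          exact tsum_tsum_dyadic_le hνs a
  have hsa : ENNReal.ofReal δ * (ENNReal.ofReal g * ∑' k, w k * a k) ≤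
      ENNReal.ofReal (1 / 4) * (∑' k, w k * B k) + ENNReal.ofReal (1 / 4) * ∑' k, w k * Ψ k := by
    have h1 : ∑' k, w k * a k = ENNReal.ofReal (2 * L ^ 2) * (∑' k, w k * B k) +
        ENNReal.ofReal 2 * ∑' k, w k * Ψ k := by
      rw [← ENNReal.tsum_mul_left, ← ENNReal.tsum_mul_left, ← ENNReal.tsum_add]
      exact tsum_congr fun k => by simp only [ha]; ring
    have h2 : δ * (g * (2 * (L ^ 2 + 1))) = 1 / 4 := by
      rw [hδdef]; field_simp; norm_num
    rw [h1, mul_add, mul_add, ← mul_assoc, ← mul_assoc, ← mul_assoc, ← mul_assoc,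
      ← ENNReal.ofReal_mul hδ.le, ← ENNReal.ofReal_mul (by positivity),
      ← ENNReal.ofReal_mul (by positivity)]
    have h3 : 0 ≤ δ * g := by positivity
    gcongr
    · nlinarith
    · nlinarith [mul_nonneg h3 (sq_nonneg L)]
  have hfinal := le_of_le_quarter_add (R := ENNReal.ofReal (1 / 4) * (∑' k, w k * Ψ k) +
    ENNReal.ofReal K * (ENNReal.ofReal (r⁻¹ ^ 2) *
        dyadicSum (ν + 2) 1 x₀ r (fun k x => ‖u x + c k‖ₑ ^ 2) + (∑' k, w k * Ψ k) +
        ENNReal.ofReal ‖l‖⁻¹ * ∑' k, w k * Φ k)) (W := ‖l‖ₑ * ∑' k, w k * U k) hfin <| by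
    refine hsum.trans ?_
    rw [← add_assoc]
    gcongr
    refine hsa.trans ?_
    gcongr
    exact le_add_self
  rw [hd1, hd2, hd3, hd4, hd5]
  refine hfinal.trans ?_
  set D := dyadicSum (ν + 2) 1 x₀ r (fun k x => ‖u x + c k‖ₑ ^ 2)
  have c1 : ENNReal.ofReal (4 / 3) * (ENNReal.ofReal K * ENNReal.ofReal (r⁻¹ ^ 2)) ≤
      ENNReal.ofReal ((4 / 3 * K + 1 / 3) / r ^ 2) := by
    rw [← ENNReal.ofReal_mul hK.le, ← ENNReal.ofReal_mul (by positivity), div_eq_mul_inv (_ + _),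
      ← inv_pow, ← mul_assoc]
    gcongr
    linarith
  have c2 : ENNReal.ofReal (4 / 3) * (ENNReal.ofReal K * ENNReal.ofReal ‖l‖⁻¹) ≤
      ENNReal.ofReal ((4 / 3 * K + 1 / 3) / ‖l‖) := by
    rw [← ENNReal.ofReal_mul hK.le, ← ENNReal.ofReal_mul (by positivity), div_eq_mul_inv (_ + _),
      ← mul_assoc]
    gcongr
    linarith
  have c3 : ENNReal.ofReal (4 / 3) * (ENNReal.ofReal (1 / 4) + ENNReal.ofReal K) =
      ENNReal.ofReal (4 / 3 * K + 1 / 3) := by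
    rw [← ENNReal.ofReal_add (by positivity) hK.le, ← ENNReal.ofReal_mul (by positivity)]
    congr 1
    ring
  calc _ = ENNReal.ofReal (4 / 3) * (ENNReal.ofReal K * ENNReal.ofReal (r⁻¹ ^ 2)) * D +
        ‖l‖ₑ * (∑' k, w k * U k) +
        ENNReal.ofReal (4 / 3) * (ENNReal.ofReal K * ENNReal.ofReal ‖l‖⁻¹) * (∑' k, w k * Φ k) +
        ENNReal.ofReal (4 / 3) * (ENNReal.ofReal (1 / 4) + ENNReal.ofReal K) *
          (∑' k, w k * Ψ k) := by ring
    _ ≤ _ := by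
      rw [c3]
      gcongr

end Summation

/-! ### Existence and uniqueness of the solution. -/

section Existence

open Filter Topology

variable {d : ℕ}

/-- The Lax–Milgram lemma on a subspace, for forms which are coercive after a rotation. -/
theorem exists_mem_forall_inner_eq {E : Type*} [NormedAddCommGroup E] [InnerProductSpace ℂ E]
    [CompleteSpace E] {V : Submodule ℂ E} (hV : IsClosed (V : Set E)) (S : E →L[ℂ] E) {c : ℝ}
    (hc : 0 < c) {ζ : ℂ} (hζ : ‖ζ‖ = 1)
    (hcoer : ∀ v ∈ V, c * ‖v‖ ^ 2 ≤ (ζ * inner ℂ v (S v)).re) (g : E) :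
    ∃ u ∈ V, ∀ v ∈ V, inner ℂ v (S u) = inner ℂ v g := by
  have : CompleteSpace V := hV.completeSpace_coe
  set T : V →L[ℂ] V := V.orthogonalProjectionOnto ∘L S ∘L V.subtypeL with hT
  have hin : ∀ v w : V, inner ℂ v (T w) = inner ℂ (v : E) (S w) := fun v w => by
    rw [hT]
    exact V.inner_orthogonalProjectionOnto_eq_of_mem_left v (S w)
  have hbd : ∀ v : V, c * ‖v‖ ^ 2 ≤ ‖inner ℂ v (T v)‖ := fun v => by
    rw [hin]
    refine (hcoer v v.2).trans ((Complex.re_le_norm _).trans_eq ?_)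
    rw [norm_mul, hζ, one_mul]
  have hanti : AntilipschitzWith ⟨c⁻¹, (inv_pos.2 hc).le⟩ T := by
    refine T.antilipschitz_of_bound fun v => ?_
    change ‖v‖ ≤ c⁻¹ * ‖T v‖
    rw [inv_mul_eq_div, le_div_iff₀ hc]
    rcases (norm_nonneg v).eq_or_lt with h0 | h0
    · rw [← h0, zero_mul]; exact norm_nonneg _
    · have h1 := (hbd v).trans (norm_inner_le_norm v (T v))
      refine le_of_mul_le_mul_left ?_ h0
      linarith
  have hcl : IsClosed (LinearMap.range (T : V →ₗ[ℂ] V) : Set V) :=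
    hanti.isClosed_range T.uniformContinuous
  have : CompleteSpace (LinearMap.range (T : V →ₗ[ℂ] V)) := hcl.completeSpace_coe
  -- The range is closed because `T` is bounded below. Any `w` orthogonal to it satisfies `⟪w, T w⟫
  -- = 0`, so coercivity forces `w = 0`.
  have htop : LinearMap.range (T : V →ₗ[ℂ] V) = ⊤ := by
    rw [← Submodule.orthogonal_eq_bot_iff, Submodule.eq_bot_iff]
    intro w hw
    have h1 : inner ℂ w (T w) = 0 :=
      Submodule.inner_left_of_mem_orthogonal (LinearMap.mem_range_self _ w) hw
    have h2 := hbd w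
    rw [h1, norm_zero] at h2
    have h3 : ‖w‖ ^ 2 = 0 :=
      le_antisymm (nonpos_of_mul_nonpos_right h2 hc) (by positivity)
    simpa using h3
  obtain ⟨u, hu⟩ := LinearMap.range_eq_top.1 htop (V.orthogonalProjectionOnto g)
  refine ⟨u, u.2, fun v hv => ?_⟩
  have h1 := hin ⟨v, hv⟩ u
  rw [← h1, show T u = V.orthogonalProjectionOnto g from hu]
  exact V.inner_orthogonalProjectionOnto_eq_of_mem_left ⟨v, hv⟩ g

/-- The Hilbert space of pairs of a square integrable field and a square integrable matrix field. -/
abbrev JetSpace (d : ℕ) := WithLp 2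
  (Lp (EuclideanSpace ℂ (Fin d)) 2 (volume : Measure (EuclideanSpace ℝ (Fin d))) ×
    Lp (EuclideanSpace ℂ (Fin d × Fin d)) 2 (volume : Measure (EuclideanSpace ℝ (Fin d))))

/-- The element of `JetSpace d` given by a field and a matrix field. -/
noncomputable def jet {u : Field d} {Du : MatField d} (hu : MemLp u 2 volume)
    (hDu : MemLp Du 2 volume) : JetSpace d := WithLp.toLp 2 (hu.toLp u, hDu.toLp Du)

theorem inner_jet {u v : Field d} {Du Dv : MatField d} (hu : MemLp u 2 volume)
    (hDu : MemLp Du 2 volume) (hv : MemLp v 2 volume) (hDv : MemLp Dv 2 volume) :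
    inner ℂ (jet hu hDu) (jet hv hDv) = pair u v + pair Du Dv := by
  rw [WithLp.prod_inner_apply, pair_eq_inner hu hv, pair_eq_inner hDu hDv]
  rfl

theorem norm_jet_sq {u : Field d} {Du : MatField d} (hu : MemLp u 2 volume)
    (hDu : MemLp Du 2 volume) :
    ‖jet hu hDu‖ ^ 2 = (∫ x, ‖u x‖ ^ 2) + ∫ x, ‖Du x‖ ^ 2 := by
  rw [WithLp.prod_norm_sq_eq_of_L2, ← norm_toLp_sq hu, ← norm_toLp_sq hDu]
  rfl

theorem exists_eq_jet (p : JetSpace d) :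
    ∃ (u : Field d) (Du : MatField d) (hu : MemLp u 2 volume) (hDu : MemLp Du 2 volume),
      p = jet hu hDu := by
  refine ⟨p.fst, p.snd, Lp.memLp _, Lp.memLp _, ?_⟩
  rw [jet, Lp.toLp_coeFn, Lp.toLp_coeFn]
  rfl

theorem memLp_smul_single {ι : Type*} [Fintype ι] [DecidableEq ι]
    {φ : EuclideanSpace ℝ (Fin d) → ℝ} (hφ : Continuous φ) (hc : HasCompactSupport φ) (i : ι) :
    MemLp (fun x => (φ x : ℂ) • (EuclideanSpace.single i 1 : EuclideanSpace ℂ ι)) 2 volume := by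
  have h1 : Continuous fun x => (φ x : ℂ) • (EuclideanSpace.single i 1 : EuclideanSpace ℂ ι) :=
    (Complex.continuous_ofReal.comp hφ).smul continuous_const
  have h2 : HasCompactSupport fun x => (φ x : ℂ) := hc.comp_left Complex.ofReal_zero
  exact h1.memLp_of_hasCompactSupport (p := 2) h2.smul_right

theorem pair_smul_single {ι : Type*} [Fintype ι] [DecidableEq ι]
    (φ : EuclideanSpace ℝ (Fin d) → ℝ) (i : ι)
    (a : EuclideanSpace ℝ (Fin d) → EuclideanSpace ℂ ι) :
    pair (fun x => (φ x : ℂ) • (EuclideanSpace.single i 1 : EuclideanSpace ℂ ι)) a =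
      ∫ x, φ x • a x i := by
  refine integral_congr_ae (.of_forall fun x => ?_)
  simp only [inner_smul_left, EuclideanSpace.inner_single_left, map_one, one_mul,
    Complex.conj_ofReal, Complex.real_smul]

theorem memLp_scalar_smul_const {ι : Type*} [Fintype ι] {h : EuclideanSpace ℝ (Fin d) → ℂ}
    (hh : MemLp h 2 volume) (b : EuclideanSpace ℂ ι) : MemLp (fun x => h x • b) 2 volume :=
  memLp_piLp_iff.2 fun i => by simpa using hh.mul_const (b i)

/-- The identity matrix, as an element of `ℂ^{d × d}`. -/
noncomputable def idMatrix (d : ℕ) : EuclideanSpace ℂ (Fin d × Fin d) :=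
  WithLp.toLp 2 fun p => if p.1 = p.2 then 1 else 0

theorem pair_smul_idMatrix (h : EuclideanSpace ℝ (Fin d) → ℂ) (D : MatField d) :
    pair (fun x => h x • idMatrix d) D = ∫ x, conj (h x) * ∑ i, D x (i, i) := by
  refine integral_congr_ae (.of_forall fun x => ?_)
  dsimp only
  rw [inner_smul_left, inner_eq_sum, Fintype.sum_prod_type]
  simp [idMatrix]

/-- The elements of `JetSpace d` which are orthogonal to the pairs of a solenoidal field in `H¹`
and its gradient. -/
def jetConstraints (d : ℕ) : Set (JetSpace d) :=
  {q | ∃ (φ : EuclideanSpace ℝ (Fin d) → ℝ) (hφ : ContDiff ℝ ∞ φ) (hc : HasCompactSupport φ)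
      (α i : Fin d), q = jet (memLp_smul_single (continuous_partialDeriv hφ α)
        (hc.fderiv_apply (𝕜 := ℝ) _) i) (memLp_smul_single hφ.continuous hc (α, i))} ∪
  {q | ∃ (h : EuclideanSpace ℝ (Fin d) → ℂ) (hh : MemLp h 2 volume),
    q = jet (u := 0) MemLp.zero (memLp_scalar_smul_const hh (idMatrix d))}

theorem memLp_sum_diag {D : MatField d} (hD : MemLp D 2 volume) :
    MemLp (fun x => ∑ i, D x (i, i)) 2 volume :=
  memLp_finsetSum _ fun i _ => memLp_apply hD (i, i)

/-- The first family of constraints encodes the weak derivatives. The second pairs the divergence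
with every `L²` function, in particular with itself. Thus `H¹_σ` is closed in a Hilbert space, being
an orthogonal complement. -/
theorem jet_mem_orthogonal_iff {u : Field d} {Du : MatField d} (hu : MemLp u 2 volume)
    (hDu : MemLp Du 2 volume) :
    jet hu hDu ∈ (Submodule.span ℂ (jetConstraints d))ᗮ ↔ IsH1Sigma u Du := by
  have h0 : jet hu hDu ∈ (Submodule.span ℂ (jetConstraints d))ᗮ ↔
      ∀ q ∈ jetConstraints d, inner ℂ q (jet hu hDu) = 0 := by
    refine ⟨fun h q hq => Submodule.inner_right_of_mem_orthogonal (Submodule.subset_span hq) h,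
      fun h => ?_⟩
    have h1 : Submodule.span ℂ (jetConstraints d) ≤ (ℂ ∙ jet hu hDu)ᗮ :=
      Submodule.span_le.2 fun q hq => Submodule.mem_orthogonal_singleton_iff_inner_left.2 (h q hq)
    exact fun q hq => Submodule.mem_orthogonal_singleton_iff_inner_left.1 (h1 hq)
  rw [h0]
  constructor
  · intro h
    refine ⟨⟨hu, hDu, fun α i φ hφ hc => ?_⟩, ?_⟩
    · have h1 := h _ (.inl ⟨φ, hφ, hc, α, i, rfl⟩)
      rw [inner_jet, pair_smul_single, pair_smul_single] at h1
      exact eq_neg_of_add_eq_zero_left h1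
    · have ht := memLp_sum_diag hDu
      have h1 := h _ (.inr ⟨_, ht, rfl⟩)
      rw [inner_jet, pair_smul_idMatrix] at h1
      have h2 : ∀ x, conj (∑ i, Du x (i, i)) * ∑ i, Du x (i, i) =
          ((‖∑ i, Du x (i, i)‖ ^ 2 : ℝ) : ℂ) := fun x => by
        rw [mul_comm, Complex.mul_conj, Complex.normSq_eq_norm_sq]
      simp only [h2, integral_complex_ofReal] at h1
      have h3 : ∫ x, ‖∑ i, Du x (i, i)‖ ^ 2 = 0 := by
        have : pair (0 : Field d) u = 0 := by simp [pair]
        rw [this, zero_add] at h1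
        exact_mod_cast h1
      rw [integral_eq_zero_iff_of_nonneg (fun x => by positivity)
        ((memLp_two_iff_integrable_sq_norm ht.1).1 ht)] at h3
      filter_upwards [h3] with x hx
      simpa using hx
  · rintro h q (⟨φ, hφ, hc, α, i, rfl⟩ | ⟨g, hg, rfl⟩)
    · rw [inner_jet, pair_smul_single, pair_smul_single, h.weakDeriv α i φ hφ hc, neg_add_cancel]
    · rw [inner_jet, pair_smul_idMatrix]
      have h1 : ∫ x, conj (g x) * ∑ i, Du x (i, i) = 0 := by
        refine integral_eq_zero_of_ae ?_
        filter_upwards [h.div_eq_zero] with x hx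
        simp [hx]
      simp [h1, pair]

/-- The flux as a bounded operator on square integrable matrix fields. -/
noncomputable def fluxL {m M : ℝ} (hM : 0 < M) {μ : Coeff d} (hμ : IsEllipticCoeff m M μ) :
    Lp (EuclideanSpace ℂ (Fin d × Fin d)) 2 (volume : Measure (EuclideanSpace ℝ (Fin d))) →L[ℂ]
      Lp (EuclideanSpace ℂ (Fin d × Fin d)) 2 (volume : Measure (EuclideanSpace ℝ (Fin d))) :=
  LinearMap.mkContinuous
    { toFun := fun D => (memLp_flux hμ (Lp.memLp D)).toLp (flux μ D)
      map_add' := fun D D' => by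
        rw [← MemLp.toLp_add, MemLp.toLp_eq_toLp_iff]
        filter_upwards [Lp.coeFn_add D D'] with x hx
        rw [Pi.add_apply, ← flux_add]
        simp only [flux, hx, Pi.add_apply]
      map_smul' := fun a D => by
        rw [RingHom.id_apply, ← MemLp.toLp_const_smul, MemLp.toLp_eq_toLp_iff]
        filter_upwards [Lp.coeFn_smul a D] with x hx
        rw [Pi.smul_apply, ← flux_smul μ (fun _ => a)]
        simp only [flux, hx, Pi.smul_apply] }
    (d ^ 3 * M) fun D => by
      refine Lp.norm_le_mul_norm_of_ae_le_mul ?_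
      filter_upwards [norm_flux_le hM hμ D, (memLp_flux hμ (Lp.memLp D)).coeFn_toLp] with x h1 h2
      change ‖((memLp_flux hμ (Lp.memLp D)).toLp (flux μ D)) x‖ ≤ _
      rw [h2]
      exact h1

theorem fluxL_toLp {m M : ℝ} (hM : 0 < M) {μ : Coeff d} (hμ : IsEllipticCoeff m M μ)
    {D : MatField d} (hD : MemLp D 2 volume) :
    fluxL hM hμ (hD.toLp D) = (memLp_flux hμ hD).toLp (flux μ D) := by
  change (memLp_flux hμ (Lp.memLp (hD.toLp D))).toLp _ = _
  rw [MemLp.toLp_eq_toLp_iff]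
  filter_upwards [hD.coeFn_toLp] with x hx
  simp only [flux, hx]

/-- The operator `(u, D) ↦ (l u, μ D)` on `JetSpace d`. -/
noncomputable def resolventL {m M : ℝ} (hM : 0 < M) {μ : Coeff d} (hμ : IsEllipticCoeff m M μ)
    (l : ℂ) : JetSpace d →L[ℂ] JetSpace d :=
  (WithLp.prodContinuousLinearEquiv 2 ℂ _ _).symm.toContinuousLinearMap ∘L
    ((l • ContinuousLinearMap.id ℂ _).prodMap (fluxL hM hμ)) ∘L
      (WithLp.prodContinuousLinearEquiv 2 ℂ _ _).toContinuousLinearMap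

theorem inner_resolventL {m M : ℝ} (hM : 0 < M) {μ : Coeff d} (hμ : IsEllipticCoeff m M μ)
    (l : ℂ) {u v : Field d} {Du Dv : MatField d} (hu : MemLp u 2 volume)
    (hDu : MemLp Du 2 volume) (hv : MemLp v 2 volume) (hDv : MemLp Dv 2 volume) :
    inner ℂ (jet hv hDv) (resolventL hM hμ l (jet hu hDu)) =
      l * pair v u + pair Dv (flux μ Du) := by
  have h1 : resolventL hM hμ l (jet hu hDu) =
      WithLp.toLp 2 (l • hu.toLp u, fluxL hM hμ (hDu.toLp Du)) := rfl
  rw [h1, fluxL_toLp, WithLp.prod_inner_apply, pair_eq_inner hv hu,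
    pair_eq_inner hDv (memLp_flux hμ hDu), ← inner_smul_right]
  rfl

/-- The rotated form controls `|λ| ‖v‖² + ‖∇v‖²`, hence `min |λ| 1` times the squared `H¹` norm. The
right-hand side is the inner product with the pair `(f, -F)`. -/
theorem exists_isSolution {m M : ℝ} (hM : 0 < M) {ω₀ c₀ : ℝ} (hc₀ : 0 < c₀)
    (hrot : ∀ l ∈ sector ω₀, ∃ ζ : ℂ, ‖ζ‖ = 1 ∧
      ∀ (a : ℂ) (n x : ℝ), 0 ≤ n → 0 ≤ x → m * n ≤ a.re → ‖a‖ ≤ d ^ 3 * M * n →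
        c₀ * (‖l‖ * x + n) ≤ (ζ * (l * x + a)).re) {μ : Coeff d} (hμ : IsEllipticCoeff m M μ)
    {l : ℂ} (hl : l ∈ sector ω₀) {f : Field d} {F : MatField d} (hf : MemLp f 2 volume)
    (hF : MemLp F 2 volume) : ∃ u Du, IsSolution μ l f F u Du := by
  obtain ⟨ζ, hζ, hζ'⟩ := hrot l hl
  have hl' : 0 < ‖l‖ := norm_pos_iff.2 hl.1
  obtain ⟨p, hp, hpe⟩ := exists_mem_forall_inner_eq
    (Submodule.isClosed_orthogonal (Submodule.span ℂ (jetConstraints d))) (resolventL hM hμ l) (show 0 < c₀ * min ‖l‖ 1 by positivity) hζ (fun q hq => by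
      obtain ⟨v, Dv, hv, hDv, rfl⟩ := exists_eq_jet q
      have hv1 := ((jet_mem_orthogonal_iff hv hDv).1 hq).toIsH1
      have h1 := hζ' (pair Dv (flux μ Dv)) (∫ x, ‖Dv x‖ ^ 2) (∫ x, ‖v x‖ ^ 2)
        (integral_nonneg fun x => by positivity) (integral_nonneg fun x => by positivity)
        (hμ.re_pair_flux hv1) (norm_pair_flux_le hM hμ hDv)
      rw [inner_resolventL, pair_self, norm_jet_sq]
      refine le_trans ?_ h1
      have h2 : 0 ≤ ∫ x, ‖v x‖ ^ 2 := integral_nonneg fun x => by positivity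
      have h3 : 0 ≤ ∫ x, ‖Dv x‖ ^ 2 := integral_nonneg fun x => by positivity
      rw [mul_assoc, mul_add]
      gcongr
      · exact min_le_left _ _
      · exact mul_le_of_le_one_left h3 (min_le_right _ _)) (jet hf hF.neg)
  obtain ⟨u, Du, hu, hDu, rfl⟩ := exists_eq_jet p
  refine ⟨u, Du, (jet_mem_orthogonal_iff hu hDu).1 hp, fun v Dv hv => ?_⟩
  have h1 := hpe _ ((jet_mem_orthogonal_iff hv.memLp hv.grad_memLp).2 hv)
  rw [inner_resolventL, inner_jet] at h1
  rw [pair_vec_eq, pair_vec_eq, pair_mat_eq_sum hF hv.grad_memLp,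
    form_eq_pair hμ hDu hv.grad_memLp, h1, sub_eq_add_neg]
  congr 1
  simp only [pair, Pi.neg_apply, inner_neg_right, integral_neg]

/-- The difference of two solutions is an admissible test function; testing with it makes the form
vanish, and the rotated coercivity gives zero norm. -/
theorem IsSolution.ae_eq {m M : ℝ} (hM : 0 < M) {ω₀ c₀ : ℝ} (hc₀ : 0 < c₀)
    (hrot : ∀ l ∈ sector ω₀, ∃ ζ : ℂ, ‖ζ‖ = 1 ∧
      ∀ (a : ℂ) (n x : ℝ), 0 ≤ n → 0 ≤ x → m * n ≤ a.re → ‖a‖ ≤ d ^ 3 * M * n →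
        c₀ * (‖l‖ * x + n) ≤ (ζ * (l * x + a)).re) {μ : Coeff d} (hμ : IsEllipticCoeff m M μ)
    {l : ℂ} (hl : l ∈ sector ω₀) {f : Field d} {F : MatField d} (hF : MemLp F 2 volume)
    {u u' : Field d} {Du Du' : MatField d} (hu : IsSolution μ l f F u Du)
    (hu' : IsSolution μ l f F u' Du') : u =ᵐ[volume] u' := by
  obtain ⟨ζ, -, hζ'⟩ := hrot l hl
  have hz : IsH1Sigma (fun x => u x - u' x) (fun x => Du x - Du' x) :=
    ⟨hu.isH1Sigma.toIsH1.sub hu'.isH1Sigma.toIsH1, by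
      filter_upwards [hu.isH1Sigma.div_eq_zero, hu'.isH1Sigma.div_eq_zero] with x h1 h2
      simp [Finset.sum_sub_distrib, h1, h2]⟩
  have h1 := hu.pair_eq hμ hF hz
  have h2 := hu'.pair_eq hμ hF hz
  have h3 := hζ' _ (∫ x, ‖Du x - Du' x‖ ^ 2) (∫ x, ‖u x - u' x‖ ^ 2)
    (integral_nonneg fun x => by positivity) (integral_nonneg fun x => by positivity)
    (hμ.re_pair_flux hz.toIsH1) (norm_pair_flux_le hM hμ hz.grad_memLp)
  have h4 : flux μ (fun x => Du x - Du' x) = fun x => flux μ Du x - flux μ Du' x :=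
    funext fun x => flux_sub μ Du Du' x
  have h5 : l * ((∫ x, ‖u x - u' x‖ ^ 2 : ℝ) : ℂ) +
      pair (fun x => Du x - Du' x) (flux μ fun x => Du x - Du' x) = 0 := by
    rw [← pair_self, h4, pair_sub_right hz.memLp hu.isH1Sigma.memLp hu'.isH1Sigma.memLp,
      pair_sub_right hz.grad_memLp (memLp_flux hμ hu.isH1Sigma.grad_memLp)
        (memLp_flux hμ hu'.isH1Sigma.grad_memLp)]
    linear_combination h1 - h2
  rw [h5, mul_zero, Complex.zero_re] at h3
  have h6 : 0 ≤ ∫ x, ‖u x - u' x‖ ^ 2 := integral_nonneg fun x => by positivity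
  have h7 : 0 ≤ ∫ x, ‖Du x - Du' x‖ ^ 2 := integral_nonneg fun x => by positivity
  have hl' : 0 < ‖l‖ := norm_pos_iff.2 hl.1
  have h8 : ∫ x, ‖u x - u' x‖ ^ 2 = 0 := by
    have h9 : ‖l‖ * (∫ x, ‖u x - u' x‖ ^ 2) + ∫ x, ‖Du x - Du' x‖ ^ 2 ≤ 0 :=
      nonpos_of_mul_nonpos_right h3 hc₀
    exact le_antisymm (nonpos_of_mul_nonpos_right (by linarith) hl') h6
  rw [integral_eq_zero_iff_of_nonneg (fun x => by positivity) (integrable_norm_sq hz.memLp)] at h8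
  filter_upwards [h8] with x hx
  simpa [sub_eq_zero] using hx

end Existence

end StokesCaccioppoli

theorem mainTheorem1 (d : ℕ) (hd : 2 ≤ d) (m M : ℝ) (hm : 0 < m) (hM : 0 < M) :
    ∃ ω₀ ∈ Set.Ioo (Real.pi / 2) Real.pi,
      ∀ θ ∈ Set.Ioo (0 : ℝ) ω₀, ∀ ν ∈ Set.Ioo (0 : ℝ) ((d : ℝ) + 2),
      ∃ C : ℝ, 0 < C ∧
        ∀ μ : StokesCaccioppoli.Coeff d, StokesCaccioppoli.IsEllipticCoeff m M μ →
        ∀ l ∈ StokesCaccioppoli.sector θ,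
        ∀ f : StokesCaccioppoli.Field d, StokesCaccioppoli.IsL2Sigma f →
        ∀ F : StokesCaccioppoli.MatField d, MemLp F 2 volume →
          (∃ u Du, StokesCaccioppoli.IsSolution μ l f F u Du) ∧
          (∀ u Du u' Du', StokesCaccioppoli.IsSolution μ l f F u Du →
            StokesCaccioppoli.IsSolution μ l f F u' Du' → u =ᵐ[volume] u') ∧
          ∀ u Du, StokesCaccioppoli.IsSolution μ l f F u Du →
            ∀ (x₀ : EuclideanSpace ℝ (Fin d)) (r : ℝ), 0 < r →
            ∀ c : ℕ → EuclideanSpace ℂ (Fin d),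
              ‖l‖ₑ * StokesCaccioppoli.dyadicSum ν 0 x₀ r (fun _ x => ‖u x‖ₑ ^ 2) +
                  StokesCaccioppoli.dyadicSum ν 0 x₀ r (fun _ x => ‖Du x‖ₑ ^ 2) ≤
                ENNReal.ofReal (C / r ^ 2) *
                    StokesCaccioppoli.dyadicSum (ν + 2) 1 x₀ r (fun k x => ‖u x + c k‖ₑ ^ 2) +
                  ‖l‖ₑ *
                    StokesCaccioppoli.dyadicSum ν 1 x₀ r (fun k x => ‖c k‖ₑ * ‖u x‖ₑ) +
                  ENNReal.ofReal (C / ‖l‖) *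
                    StokesCaccioppoli.dyadicSum ν 1 x₀ r (fun _ x => ‖f x‖ₑ ^ 2) +
                  ENNReal.ofReal C *
                    StokesCaccioppoli.dyadicSum ν 1 x₀ r (fun _ x => ‖F x‖ₑ ^ 2) := by
  obtain ⟨ω₀, hω₀, c₀, hc₀, hrot⟩ := StokesCaccioppoli.exists_rotation m ((d : ℝ) ^ 3 * M) hm
    (by positivity)
  refine ⟨ω₀, hω₀, fun θ hθ ν hν => ?_⟩
  obtain ⟨C, hC, hmain⟩ :=
    StokesCaccioppoli.caccioppoli_of_rotation hd hm hM hc₀ hrot hν.1 hν.2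
  refine ⟨C, hC, fun μ hμ l hl f hf F hF => ?_⟩
  -- The constant has been obtained on the whole sector of angle `ω₀`, so it does not even depend on
  -- `θ`.
  have hl' : l ∈ StokesCaccioppoli.sector ω₀ := ⟨hl.1, hl.2.trans hθ.2⟩
  exact ⟨StokesCaccioppoli.exists_isSolution hM hc₀ hrot hμ hl' hf.memLp hF,
    fun u Du u' Du' hu hu' => hu.ae_eq hM hc₀ hrot hμ hl' hF hu',
    fun u Du hu x₀ r hr c => hmain hμ hl' hf hF hu x₀ hr c⟩
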